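/- Let $M$ be a smooth, compact, orientable surface without boundary, endowed with an orientation and a smooth Riemannian metric $\langle\cdot,\cdot\rangle$. For $1\le r\le\infty$ let $\mathfrak X^r(M)$ be the space of vector fields of class $C^r$ on $M$ with the $C^r$-topology. For $X\in\mathfrak X^r(M)$ let $X^\perp\in\mathfrak X^r(M)$ be the vector field determined by $\langle X,X\rangle=\langle X^\perp,X^\perp\rangle$ and by the condition that $(X(x),X^\perp(x))$ is a positive orthogonal basis of $T_xM$ wherever $X(x)\neq0$. A \emph{flow box} of $X$ is an open set which is the image of an open square under a $C^r$ diffeomorphism that maps the oriented vertical segments into oriented trajectories of $X$. A \emph{figure-eight flow box} for $X$ is a compact set $F\subset M$ whose interior is a flow box of $X$ and whose boundary is homeomorphic to the figure "8" and is the union of an arc of trajectory of $X$ (the tangent edge) and an arc of trajectory of $X^\perp$ (the orthogonal edge) having the same two end points; that is, the two arcs have exactly one common point besides their end points. A point $p\in M$ is a \emph{nontrivial recurrent point} of $X$ if it belongs to the $\omega$-limit set or to the $\alpha$-limit set of its own trajectory, and this trajectory is neither a singularity nor closed. For such $p$, $X$ is \emph{T-closable} (twist-closable) at $p$ if there exists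 a half-open interval $\Sigma=[p,q)$ tangent to $X^\perp$ (an embedded half-open arc of a trajectory of $X^\perp$, in either direction from $p$) such that, for every neighbourhood $V$ of $p$, there exists a figure-eight flow box for $X$ whose orthogonal edge is contained in $\Sigma\cap V$. \textbf{Theorem.} Let $X\in\mathfrak X^r(M)$, $1\le r\le\infty$, let $p\in M$ be a nontrivial recurrent point of $X$, and suppose that $X$ is T-closable at $p$. Then every neighbourhood of $X$ in the $C^r$-topology contains a vector field $Y\in\mathfrak X^r(M)$ that has a closed (periodic, nonconstant) trajectory through $p$. -/

import Mathlib

open Set Filter Topology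
open scoped Manifold ContDiff

noncomputable section

/-- The Euclidean plane, on which surfaces are modelled. -/
abbrev Plane : Type := EuclideanSpace ℝ (Fin 2)

section Surface

variable {M : Type*} [TopologicalSpace M] [ChartedSpace Plane M] [IsManifold (𝓡 2) ∞ M]

/-- The space `𝔛^r(M)` of vector fields of class `C^r` on `M`. -/
abbrev VField (r : ℕ∞) (M : Type*) [TopologicalSpace M] [ChartedSpace Plane M]
    [IsManifold (𝓡 2) ∞ M] :=
  ContMDiffSection (𝓡 2) Plane (r : ℕ∞ω) (fun x : M => TangentSpace (𝓡 2) x)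

/-- The local representative of a vector field in the chart around `x₀`: at a point `y` of the
chart's target, the image of the vector of the field at the point with coordinates `y` under the
derivative of the chart. -/
def localRep (X : (x : M) → TangentSpace (𝓡 2) x) (x₀ : M) (y : Plane) : Plane :=
  (trivializationAt Plane (fun x : M => TangentSpace (𝓡 2) x) x₀
    ⟨(extChartAt (𝓡 2) x₀).symm y, X ((extChartAt (𝓡 2) x₀).symm y)⟩).2

/-- The `C^r` topology: uniform convergence, on compact subsets of chart domains, of all
derivatives of (finite) order at most `r` of the local representatives. -/
instance VField.crTopology (r : ℕ∞) : TopologicalSpace (VField r M) :=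
  ⨅ (x₀ : M) (k : ℕ) (_ : (k : ℕ∞) ≤ r),
    TopologicalSpace.induced
      (fun X : VField r M =>
        UniformOnFun.ofFun {K : Set Plane | IsCompact K ∧ K ⊆ (extChartAt (𝓡 2) x₀).target}
          (iteratedFDeriv ℝ k (localRep (fun x => X x) x₀)))
      inferInstance

/-- An orientation of the surface `M`: an orientation of every tangent space which is locally
constant when read in the charts. -/
structure SurfaceOrientation (M : Type*) [TopologicalSpace M] [ChartedSpace Plane M]
    [IsManifold (𝓡 2) ∞ M] where
  at_point : (x : M) → Orientation ℝ (TangentSpace (𝓡 2) x) (Fin 2)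
  locally_const : ∀ x₀ : M, ∃ o : Orientation ℝ Plane (Fin 2), ∀ᶠ x in 𝓝 x₀,
    ∀ hx : x ∈ (trivializationAt Plane (fun x : M => TangentSpace (𝓡 2) x) x₀).baseSet,
      Orientation.map (Fin 2)
        ((trivializationAt Plane (fun x : M => TangentSpace (𝓡 2) x) x₀).continuousLinearEquivAt
          ℝ x hx).toLinearEquiv (at_point x) = o

/-- The ordered pair `(v, w)` is a positive basis of `T_x M`. -/
def SurfaceOrientation.IsPositiveBasis (o : SurfaceOrientation M) (x : M)
    (v w : TangentSpace (𝓡 2) x) : Prop :=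
  ∃ b : Module.Basis (Fin 2) ℝ (TangentSpace (𝓡 2) x),
    b 0 = v ∧ b 1 = w ∧ b.orientation = o.at_point x

/-- A smooth Riemannian metric on `M`. -/
abbrev SurfaceMetric (M : Type*) [TopologicalSpace M] [ChartedSpace Plane M]
    [IsManifold (𝓡 2) ∞ M] :=
  Bundle.ContMDiffRiemannianMetric (𝓡 2) ∞ Plane (fun x : M => TangentSpace (𝓡 2) x)

/-- `Xp` is the field `X^⊥`: it has the same length as `X` everywhere and, where `X` does not
vanish, `(X, X^⊥)` is a positive orthogonal basis. These conditions determine `X^⊥`. -/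
def IsPerp (g : SurfaceMetric M) (o : SurfaceOrientation M)
    (X Xp : (x : M) → TangentSpace (𝓡 2) x) : Prop :=
  ∀ x : M, g.inner x (X x) (X x) = g.inner x (Xp x) (Xp x) ∧
    (X x ≠ 0 → g.inner x (X x) (Xp x) = 0 ∧ o.IsPositiveBasis x (X x) (Xp x))

/-- The trajectory of `X` through `p` is closed, i.e. a periodic orbit, not a singularity. -/
def HasClosedTrajectory (X : (x : M) → TangentSpace (𝓡 2) x) (p : M) : Prop :=
  X p ≠ 0 ∧ ∃ γ : ℝ → M, IsMIntegralCurve γ X ∧ γ 0 = p ∧ ∃ T > 0, Function.Periodic γ T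

/-- `p` is a nontrivial recurrent point of `X`: it belongs to the `ω`-limit set or to the `α`-limit
set of its own trajectory, which is neither a singularity nor closed. -/
def IsNontrivialRecurrent (X : (x : M) → TangentSpace (𝓡 2) x) (p : M) : Prop :=
  X p ≠ 0 ∧ ¬ HasClosedTrajectory X p ∧
    ∃ γ : ℝ → M, IsMIntegralCurve γ X ∧ γ 0 = p ∧
      (MapClusterPt p atTop γ ∨ MapClusterPt p atBot γ)

/-- `A` is a (compact, embedded) arc of trajectory of `X` going from `x` to `y`. -/
def IsTrajectoryArc (X : (x : M) → TangentSpace (𝓡 2) x) (A : Set M) (x y : M) : Prop :=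
  ∃ (γ : ℝ → M) (T : ℝ), 0 < T ∧ IsMIntegralCurve γ X ∧ γ 0 = x ∧ γ T = y ∧
    InjOn γ (Icc 0 T) ∧ A = γ '' Icc 0 T

/-- `U` is a flow box of `X`: the image of an open square under a `C^r` diffeomorphism which maps
the oriented vertical segments into oriented trajectories of `X`. -/
def IsFlowBox (r : ℕ∞) (X : (x : M) → TangentSpace (𝓡 2) x) (U : Set M) : Prop :=
  ∃ φ : OpenPartialHomeomorph (ℝ × ℝ) M,
    φ.source = Ioo (0 : ℝ) 1 ×ˢ Ioo (0 : ℝ) 1 ∧ φ.target = U ∧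
    ContMDiffOn 𝓘(ℝ, ℝ × ℝ) (𝓡 2) (r : ℕ∞ω) φ φ.source ∧
    ContMDiffOn (𝓡 2) 𝓘(ℝ, ℝ × ℝ) (r : ℕ∞ω) φ.symm φ.target ∧
    ∀ z ∈ φ.source, ∃ c : ℝ, 0 < c ∧
      mfderiv 𝓘(ℝ, ℝ × ℝ) (𝓡 2) φ z ((0, 1) : ℝ × ℝ) = c • X (φ z)

/-- `F` is a flow box of `X` pinched along a figure eight, with orthogonal edge `O`: `F` is compact,
its interior is a flow box of `X`, and its boundary is the union of an arc of trajectory of `X`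
from `c` to `a` (the tangent edge) and an arc `O` of trajectory of `X^⊥` connecting `a` and `c`.
Apart from their common end points these arcs have exactly one common point, the vertex `b`, which
is to say that the boundary is a figure eight. -/
def IsFigureEightFlowBox (r : ℕ∞) (X Xp : (x : M) → TangentSpace (𝓡 2) x) (F O : Set M) : Prop :=
  IsCompact F ∧ IsFlowBox r X (interior F) ∧
    ∃ (a b c : M) (A : Set M),
      IsTrajectoryArc X A c a ∧ (IsTrajectoryArc Xp O a c ∨ IsTrajectoryArc Xp O c a) ∧
      frontier F = A ∪ O ∧ A ∩ O = {a, b, c} ∧ b ≠ a ∧ b ≠ c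

/-- `X` is T-closable (twist-closable) at `p`: there is a half-open interval `S = [p, q)` tangent to
`X^⊥` such that every neighbourhood `V` of `p` admits a figure-eight flow box with orthogonal edge
contained in `S ∩ V`. -/
def IsTClosable (g : SurfaceMetric M) (o : SurfaceOrientation M) (r : ℕ∞)
    (X : (x : M) → TangentSpace (𝓡 2) x) (p : M) : Prop :=
  ∃ Xp : (x : M) → TangentSpace (𝓡 2) x, IsPerp g o X Xp ∧
    ∃ (q : M) (S : Set M), (IsTrajectoryArc Xp S p q ∨ IsTrajectoryArc Xp S q p) ∧
      ∀ V ∈ 𝓝 p, ∃ F O : Set M, IsFigureEightFlowBox r X Xp F O ∧ O ⊆ (S \ {q}) ∩ V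

end Surface

end

set_option linter.unusedSectionVars false

noncomputable section

/-! ### Vector fields and curves read in a chart. -/

section Surface

variable {M : Type*} [TopologicalSpace M] [ChartedSpace Plane M] [IsManifold (𝓡 2) ∞ M]

/-! Let `W` be `X^⊥` or its opposite, with the sign for which the orthogonal edge of the
figure-eight box runs along `W` from `a` to `c`, and let `b` be the vertex. A closed trajectory is
first found through `b`, for some field `X + ε W` with `0 < ε ≤ δ`. The trajectory of `X + ε W` from
`b` enters the interior of the box. It cannot stay there, because the transverse coordinate `π` of
the flow box increases strictly along it. It can leave only through the part of the orthogonal edge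
between `a` and `b`, through the part of the tangent edge between `c` and `b`, or at `b` itself
(`FigureEight.exit_cases`). In the first two cases it passes to the outside of the box at once, so
the type of the exit does not change under small changes of `ε`. For `ε` near `0` the trajectory
follows the tangent edge up to `a` and leaves through the orthogonal edge. For `ε = δ`, if the
orthogonal edge is short compared with `δ`, it runs into the tangent edge just above `c` first
(`FigureEight.exists_crossing`). Since `(0, δ]` is connected, some `ε` makes the trajectory return
to `b` (`FigureEight.exists_closed`).

The definition of a figure-eight box prescribes only the frontier, so it must be determined on which
side of each boundary arc the interior lies. The key is `FigureEight.not_up`: the interior is not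
above the arc from `a` to `b`. Otherwise the value of `π` just above that arc would be a continuous
function with no local maximum, and since the tangent edge leads from `b` to `a`, its limit at `b`
would be its value at `a`. Such a function on a circle attains a maximum, a contradiction. The
positions at the other arcs follow from this one.

The vertex `b` is only close to `p`. A small displacement in a chart, cut off by a bump function,
carries `p` to `b`; the pullback of `X + ε W` under it is `C^r`-close to `X` and has a closed
trajectory through `p` (`exists_hasClosedTrajectory_of_near`). The perturbation is admissible
because `X^⊥` is of class `C^r` (`IsPerp.contMDiff`). -/

theorem isManifold_one : IsManifold (𝓡 2) 1 M := IsManifold.of_le (n := ∞) (by norm_num)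

/-- The derivative at `x` of the chart around `x₀`. -/
def chartDeriv (x₀ x : M) : TangentSpace (𝓡 2) x →L[ℝ] Plane :=
  (trivializationAt Plane (fun x : M => TangentSpace (𝓡 2) x) x₀).continuousLinearMapAt ℝ x

theorem chartDeriv_apply {x₀ x : M} (hx : x ∈ (chartAt Plane x₀).source)
    (v : TangentSpace (𝓡 2) x) :
    chartDeriv x₀ x v = (trivializationAt Plane (fun x : M => TangentSpace (𝓡 2) x) x₀ ⟨x, v⟩).2 := by
  rw [chartDeriv, Bundle.Trivialization.continuousLinearMapAt_apply,
    Bundle.Trivialization.linearMapAt_apply, if_pos]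
  simpa using hx

theorem chartDeriv_eq_mfderiv {x₀ x : M} (hx : x ∈ (chartAt Plane x₀).source) :
    chartDeriv x₀ x = mfderiv (𝓡 2) 𝓘(ℝ, Plane) (extChartAt (𝓡 2) x₀) x :=
  have : IsManifold (𝓡 2) 1 M := isManifold_one
  TangentBundle.continuousLinearMapAt_trivializationAt hx

theorem localRep_extChartAt (X : (x : M) → TangentSpace (𝓡 2) x) {x₀ x : M}
    (hx : x ∈ (chartAt Plane x₀).source) :
    localRep X x₀ (extChartAt (𝓡 2) x₀ x) = chartDeriv x₀ x (X x) := by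
  rw [chartDeriv_apply hx, localRep,
    (extChartAt (𝓡 2) x₀).left_inv (by simpa using hx)]

theorem chartDeriv_injective {x₀ x : M} (hx : x ∈ (chartAt Plane x₀).source) :
    Function.Injective (chartDeriv x₀ x) := by
  have h : x ∈ (trivializationAt Plane (fun x : M => TangentSpace (𝓡 2) x) x₀).baseSet := by
    simpa using hx
  have := ((trivializationAt Plane (fun x : M => TangentSpace (𝓡 2) x)
    x₀).continuousLinearEquivAt ℝ x h).injective
  intro v w hvw
  apply this
  rw [chartDeriv_apply hx, chartDeriv_apply hx] at hvw
  exact hvw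

theorem hasDerivAt_extChartAt_comp {γ : ℝ → M} {t : ℝ} {x₀ : M}
    (hx : γ t ∈ (chartAt Plane x₀).source) {v : TangentSpace (𝓡 2) (γ t)}
    (h : HasMFDerivAt 𝓘(ℝ, ℝ) (𝓡 2) γ t ((1 : ℝ →L[ℝ] ℝ).smulRight v)) :
    HasDerivAt (fun s => extChartAt (𝓡 2) x₀ (γ s)) (chartDeriv x₀ (γ t) v) t := by
  have : IsManifold (𝓡 2) 1 M := isManifold_one
  have h1 := (mdifferentiableAt_extChartAt (I := 𝓡 2) hx).hasMFDerivAt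
  let A : ℝ →L[ℝ] Plane := (mfderiv (𝓡 2) 𝓘(ℝ, Plane) (extChartAt (𝓡 2) x₀) (γ t)).comp
    ((1 : ℝ →L[ℝ] ℝ).smulRight v)
  have h2 : HasFDerivAt (fun s => extChartAt (𝓡 2) x₀ (γ s)) A t :=
    (HasMFDerivAt.comp t h1 h).hasFDerivAt
  have h4 : A 1 = chartDeriv x₀ (γ t) v := by
    rw [chartDeriv_eq_mfderiv hx]
    change mfderiv (𝓡 2) 𝓘(ℝ, Plane) (extChartAt (𝓡 2) x₀) (γ t) ((1 : ℝ) • v) = _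
    rw [one_smul]
    rfl
  rw [← h4]
  exact h2.hasDerivAt

/-- Composing with the inverse chart shows that the curve is differentiable; its velocity is then
identified by injectivity of the derivative of the chart. -/
theorem hasMFDerivAt_of_hasDerivAt_extChartAt {γ : ℝ → M} {t : ℝ} {x₀ : M}
    (hx : γ t ∈ (chartAt Plane x₀).source) (hc : ContinuousAt γ t) {v : TangentSpace (𝓡 2) (γ t)}
    (h : HasDerivAt (fun s => extChartAt (𝓡 2) x₀ (γ s)) (chartDeriv x₀ (γ t) v) t) :
    HasMFDerivAt 𝓘(ℝ, ℝ) (𝓡 2) γ t ((1 : ℝ →L[ℝ] ℝ).smulRight v) := by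
  have : IsManifold (𝓡 2) 1 M := isManifold_one
  have hx' : γ t ∈ (extChartAt (𝓡 2) x₀).source := by simpa using hx
  have h1 : MDifferentiableAt 𝓘(ℝ, Plane) (𝓡 2) (extChartAt (𝓡 2) x₀).symm
      (extChartAt (𝓡 2) x₀ (γ t)) := by
    have := mdifferentiableWithinAt_extChartAt_symm (I := 𝓡 2)
      ((extChartAt (𝓡 2) x₀).map_source hx')
    rw [ModelWithCorners.range_eq_univ] at this
    exact mdifferentiableWithinAt_univ.1 this
  have h2 : HasMFDerivAt 𝓘(ℝ, ℝ) 𝓘(ℝ, Plane) (fun s => extChartAt (𝓡 2) x₀ (γ s)) t _ :=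
    h.hasFDerivAt.hasMFDerivAt
  have h3 := HasMFDerivAt.comp t h1.hasMFDerivAt h2
  have h4 : MDifferentiableAt 𝓘(ℝ, ℝ) (𝓡 2) γ t := by
    refine (h3.congr_of_eventuallyEq ?_).mdifferentiableAt
    filter_upwards [hc ((isOpen_extChartAt_source (I := 𝓡 2) x₀).mem_nhds hx')] with s hs
    exact ((extChartAt (𝓡 2) x₀).left_inv hs).symm
  have h5 := h4.hasMFDerivAt
  set w : TangentSpace (𝓡 2) (γ t) := mfderiv 𝓘(ℝ, ℝ) (𝓡 2) γ t (1 : ℝ) with hw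
  have h6 : mfderiv 𝓘(ℝ, ℝ) (𝓡 2) γ t = (1 : ℝ →L[ℝ] ℝ).smulRight w :=
    ContinuousLinearMap.ext_ring (one_smul ℝ w).symm
  rw [h6] at h5
  have h7 := (hasDerivAt_extChartAt_comp hx h5).unique h
  rw [← chartDeriv_injective hx h7]
  exact h5

theorem contMDiffVectorBundle_tangent (r : ℕ∞) :
    ContMDiffVectorBundle (r : ℕ∞ω) Plane (fun x : M => TangentSpace (𝓡 2) x) (𝓡 2) := by
  have : IsManifold (𝓡 2) ((r : ℕ∞ω) + 1) M := by
    refine IsManifold.of_le (n := ∞) ?_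
    cases r with
    | top => simp
    | coe r => exact_mod_cast le_top
  exact TangentBundle.contMDiffVectorBundle

theorem isManifold_coe (r : ℕ∞) : IsManifold (𝓡 2) (r : ℕ∞ω) M := by
  refine IsManifold.of_le (n := ∞) ?_
  exact_mod_cast le_top

theorem contMDiffAt_section_of_localRep {r : ℕ∞} {X : (x : M) → TangentSpace (𝓡 2) x} {x₀ : M}
    (h : ContDiffAt ℝ r (localRep X x₀) (extChartAt (𝓡 2) x₀ x₀)) :
    ContMDiffAt (𝓡 2) ((𝓡 2).prod 𝓘(ℝ, Plane)) r
      (fun x => Bundle.TotalSpace.mk' Plane (E := fun x : M => TangentSpace (𝓡 2) x) x (X x))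
      x₀ := by
  have := isManifold_coe (M := M) r
  have := contMDiffVectorBundle_tangent (M := M) r
  rw [Bundle.contMDiffAt_section]
  have h1 : ContMDiffAt (𝓡 2) 𝓘(ℝ, Plane) r (fun x => localRep X x₀ (extChartAt (𝓡 2) x₀ x)) x₀ :=
    h.contMDiffAt.comp x₀ (contMDiffAt_extChartAt (I := 𝓡 2))
  refine h1.congr_of_eventuallyEq ?_
  filter_upwards [extChartAt_source_mem_nhds (I := 𝓡 2) x₀] with x hx
  rw [localRep_extChartAt X (by simpa using hx), chartDeriv_apply (by simpa using hx)]

theorem contDiffAt_localRep {r : ℕ∞} {X : (x : M) → TangentSpace (𝓡 2) x} {x₀ : M} {y : Plane}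
    (h : ContMDiffAt (𝓡 2) ((𝓡 2).prod 𝓘(ℝ, Plane)) r
      (fun x => Bundle.TotalSpace.mk' Plane (E := fun x : M => TangentSpace (𝓡 2) x) x (X x))
      ((extChartAt (𝓡 2) x₀).symm y))
    (hy : y ∈ (extChartAt (𝓡 2) x₀).target) :
    ContDiffAt ℝ r (localRep X x₀) y := by
  have := isManifold_coe (M := M) r
  have := contMDiffVectorBundle_tangent (M := M) r
  have hs := (extChartAt (𝓡 2) x₀).map_target hy
  rw [Bundle.Trivialization.contMDiffAt_section_iff
    (trivializationAt Plane (fun x : M => TangentSpace (𝓡 2) x) x₀) (by simpa using hs)] at h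
  have h1 : ContMDiffAt 𝓘(ℝ, Plane) (𝓡 2) r (extChartAt (𝓡 2) x₀).symm y :=
    (contMDiffOn_extChartAt_symm (I := 𝓡 2) x₀).contMDiffAt
      ((isOpen_extChartAt_target (I := 𝓡 2) x₀).mem_nhds hy)
  exact (h.comp y h1).contDiffAt

theorem VField.contDiffAt_localRep {r : ℕ∞} (X : VField r M) {x₀ : M} {y : Plane}
    (hy : y ∈ (extChartAt (𝓡 2) x₀).target) :
    ContDiffAt ℝ r (localRep (fun x => X x) x₀) y :=
  _root_.contDiffAt_localRep (X.contMDiff _) hy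

theorem localRep_eq_chartDeriv (X : (x : M) → TangentSpace (𝓡 2) x) {x₀ : M} {y : Plane}
    (hy : y ∈ (extChartAt (𝓡 2) x₀).target) :
    localRep X x₀ y = chartDeriv x₀ ((extChartAt (𝓡 2) x₀).symm y)
      (X ((extChartAt (𝓡 2) x₀).symm y)) := by
  have hs := (extChartAt (𝓡 2) x₀).map_target hy
  rw [chartDeriv_apply (by simpa using hs), localRep]

end Surface

/-! ### First integrals of planar fields of class `C^1`. -/

/-- `G` is the mean of `∂f/∂x` over the segment from `x'` to `x`. With it, the difference of two
solutions of `x' = f (x, y)` solves a linear equation. -/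
theorem exists_hadamard_quotient {f : ℝ × ℝ → ℝ} (hf : ContDiff ℝ 1 f) :
    ∃ G : ℝ × ℝ × ℝ → ℝ, Continuous G ∧
      ∀ x x' y, f (x, y) - f (x', y) = G (x, x', y) * (x - x') := by
  have hc : Continuous (fun z => fderiv ℝ f z (1, 0)) :=
    (hf.continuous_fderiv one_ne_zero).clm_apply continuous_const
  refine ⟨fun w => ∫ θ in (0 : ℝ)..1,
    fderiv ℝ f (w.2.1 + θ * (w.1 - w.2.1), w.2.2) (1, 0), ?_, ?_⟩
  · apply intervalIntegral.continuous_parametric_intervalIntegral_of_continuous'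
      (f := fun (w : ℝ × ℝ × ℝ) θ => fderiv ℝ f (w.2.1 + θ * (w.1 - w.2.1), w.2.2) (1, 0))
    exact hc.comp (by fun_prop)
  · intro x x' y
    have h1 : ∀ θ : ℝ, HasDerivAt (fun θ : ℝ => f (x' + θ * (x - x'), y))
        (fderiv ℝ f (x' + θ * (x - x'), y) (1, 0) * (x - x')) θ := by
      intro θ
      have h2 : HasDerivAt (fun θ : ℝ => (x' + θ * (x - x'), y)) (x - x', 0) θ := by
        apply HasDerivAt.prodMk
        · simpa using ((hasDerivAt_id θ).mul_const (x - x')).const_add x'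
        · exact hasDerivAt_const _ _
      have h3 := ((hf.differentiable one_ne_zero) (x' + θ * (x - x'), y)).hasFDerivAt
      have h4 := h3.comp_hasDerivAt θ h2
      refine h4.congr_deriv ?_
      have : ((x - x', 0) : ℝ × ℝ) = (x - x') • (1, 0) := by simp
      rw [this, map_smul, smul_eq_mul, mul_comm]
    have h5 := intervalIntegral.integral_eq_sub_of_hasDerivAt (a := 0) (b := 1)
      (fun θ _ => h1 θ) (by
        apply Continuous.intervalIntegrable
        exact (hc.comp (by fun_prop)).mul continuous_const)
    rw [intervalIntegral.integral_mul_const] at h5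
    rw [h5]
    simp

/-- The second variable is the time. Compact support makes `f` bounded and Lipschitz, so
Picard–Lindelöf applies on all of `[-1, 1]`: starting in the ball of radius `1`, solutions stay in
the ball of radius `C + 1`. -/
theorem exists_scalar_solution {f : ℝ × ℝ → ℝ} (hf : ContDiff ℝ 1 f) (hs : HasCompactSupport f) :
    ∃ φ : ℝ × ℝ → ℝ, Continuous φ ∧ (∀ x ∈ Icc (-1 : ℝ) 1, φ (x, 0) = x) ∧
      ∀ x ∈ Icc (-1 : ℝ) 1, ∀ y ∈ Ioo (-1 : ℝ) 1,
        HasDerivAt (fun s => φ (x, s)) (f (φ (x, y), y)) y := by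
  obtain ⟨C, hC⟩ := hf.continuous.bounded_above_of_compact_support hs
  obtain ⟨K, hK⟩ := hf.lipschitzWith_of_hasCompactSupport hs one_ne_zero
  have hC0 : 0 ≤ C := (norm_nonneg _).trans (hC 0)
  have hpl : IsPicardLindelof (fun t x => f (x, t)) (tmin := -1) (tmax := 1)
      ⟨0, by norm_num, by norm_num⟩ (0 : ℝ) (⟨C, hC0⟩ + 1) 1 ⟨C, hC0⟩ K := by
    refine ⟨fun t _ => ?_, fun x _ => ?_, fun t _ x _ => hC _, ?_⟩
    · refine LipschitzWith.lipschitzOnWith (LipschitzWith.of_dist_le_mul fun x y => ?_)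
      refine (hK.dist_le_mul _ _).trans (le_of_eq ?_)
      simp [Prod.dist_eq]
    · exact (hf.continuous.comp (by fun_prop)).continuousOn
    · change C * max ((1 : ℝ) - 0) (0 - -1) ≤ (C + 1) - 1
      simp
  obtain ⟨α, hα, hαc⟩ := hpl.exists_forall_mem_closedBall_eq_hasDerivWithinAt_continuousOn
  have hI : ∀ x : ℝ, x ∈ Icc (-1 : ℝ) 1 → x ∈ Metric.closedBall (0 : ℝ) 1 := by
    intro x hx
    rw [Metric.mem_closedBall, Real.dist_eq, sub_zero, abs_le]
    exact hx
  -- Clamping both variables to `[-1, 1]` turns the solution, continuous on a square, into a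
  -- continuous function on the plane that is unchanged on the square.
  let c : ℝ → ℝ := fun x => max (-1) (min 1 x)
  have hcc : Continuous c := by fun_prop
  have hc : ∀ x, c x ∈ Icc (-1 : ℝ) 1 := fun x => ⟨le_max_left _ _, by
    simp only [c, max_le_iff]; exact ⟨by norm_num, min_le_left _ _⟩⟩
  have hcx : ∀ x ∈ Icc (-1 : ℝ) 1, c x = x := fun x hx => by
    simp only [c]; rw [min_eq_right hx.2, max_eq_right hx.1]
  refine ⟨fun z => α (c z.1, c z.2), ?_, fun x hx => ?_, fun x hx y hy => ?_⟩
  · refine hαc.comp_continuous (by fun_prop) fun z => ⟨hI _ (hc _), hc _⟩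
  · simp only [hcx x hx, hcx 0 (by norm_num)]
    exact (hα x (hI x hx)).1
  · have h1 := ((hα x (hI x hx)).2 y (Ioo_subset_Icc_self hy)).hasDerivAt (Icc_mem_nhds hy.1 hy.2)
    simp only [hcx x hx, hcx y (Ioo_subset_Icc_self hy)]
    refine h1.congr_of_eventuallyEq ?_
    filter_upwards [Icc_mem_nhds hy.1 hy.2] with s hs
    simp [hcx s hs]

/-- Differentiability in the initial value comes from an exact formula: by the Hadamard quotient, `φ
(x, y) - φ (x', y) = (x - x') exp J` with `J` the integral of `G` along the two solutions. Letting
`x'` tend to `x` gives the continuous positive derivative `E`. -/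
theorem exists_scalar_flow {f : ℝ × ℝ → ℝ} (hf : ContDiff ℝ 1 f) (hs : HasCompactSupport f) :
    ∃ φ E : ℝ × ℝ → ℝ, Continuous φ ∧ Continuous E ∧ (∀ z, 0 < E z) ∧
      (∀ x ∈ Icc (-1 : ℝ) 1, φ (x, 0) = x) ∧
      ∀ x ∈ Ioo (-1 : ℝ) 1, ∀ y ∈ Ioo (-1 : ℝ) 1,
        HasDerivAt (fun s => φ (x, s)) (f (φ (x, y), y)) y ∧
        HasDerivAt (fun s => φ (s, y)) (E (x, y)) x := by
  obtain ⟨φ, hφc, hφ0, hφ⟩ := exists_scalar_solution hf hs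
  obtain ⟨G, hGc, hG⟩ := exists_hadamard_quotient hf
  let g : ℝ × ℝ → ℝ → ℝ := fun w s => G (φ (w.1, s), φ (w.2, s), s)
  have hgc : Continuous (Function.uncurry g) := by
    simp only [g, Function.uncurry_def]
    fun_prop
  have hgw : ∀ w, Continuous (g w) := fun w => hgc.comp (by fun_prop : Continuous fun s => (w, s))
  let J : (ℝ × ℝ) × ℝ → ℝ := fun w => ∫ s in (0 : ℝ)..w.2, g w.1 s
  have hJc : Continuous J := intervalIntegral.continuous_parametric_primitive_of_continuous hgc
  have key : ∀ x ∈ Icc (-1 : ℝ) 1, ∀ x' ∈ Icc (-1 : ℝ) 1, ∀ y ∈ Ioo (-1 : ℝ) 1,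
      φ (x, y) - φ (x', y) = (x - x') * Real.exp (J ((x, x'), y)) := by
    intro x hx x' hx' y hy
    have hJ : ∀ s, HasDerivAt (fun s => J ((x, x'), s)) (g (x, x') s) s := fun s =>
      intervalIntegral.integral_hasDerivAt_right ((hgw _).intervalIntegrable _ _)
        ((hgw _).stronglyMeasurableAtFilter _ _) (hgw _).continuousAt
    have hD : ∀ s ∈ Ioo (-1 : ℝ) 1, HasDerivAt
        (fun s => (φ (x, s) - φ (x', s)) * Real.exp (-J ((x, x'), s))) 0 s := by
      intro s hs
      have := ((hφ x hx s hs).sub (hφ x' hx' s hs)).mul (hJ s).neg.exp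
      refine this.congr_deriv ?_
      rw [hG]
      simp only [g, Pi.sub_apply, Pi.neg_apply]
      ring
    have hconst : (φ (x, y) - φ (x', y)) * Real.exp (-J ((x, x'), y))
        = (φ (x, 0) - φ (x', 0)) * Real.exp (-J ((x, x'), 0)) := by
      refine (convex_Ioo (-1 : ℝ) 1).is_const_of_fderivWithin_eq_zero (𝕜 := ℝ)
        (f := fun s => (φ (x, s) - φ (x', s)) * Real.exp (-J ((x, x'), s)))
        (fun s hs => (hD s hs).differentiableAt.differentiableWithinAt) (fun s hs => ?_) hy
        ⟨by norm_num, by norm_num⟩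
      rw [fderivWithin_of_isOpen isOpen_Ioo hs]
      ext
      simp [(hD s hs).deriv]
    have hJ0 : J ((x, x'), 0) = 0 := by simp [J]
    rw [hφ0 x hx, hφ0 x' hx', hJ0, neg_zero, Real.exp_zero, mul_one] at hconst
    rw [← hconst, mul_assoc, ← Real.exp_add]
    simp
  refine ⟨φ, fun z => Real.exp (J ((z.1, z.1), z.2)), hφc, by fun_prop, fun z => Real.exp_pos _,
    hφ0, fun x hx y hy => ⟨hφ x (Ioo_subset_Icc_self hx) y hy, ?_⟩⟩
  rw [hasDerivAt_iff_tendsto_slope]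
  have h1 : Tendsto (fun s => Real.exp (J ((s, x), y))) (𝓝[≠] x)
      (𝓝 (Real.exp (J ((x, x), y)))) := by
    have : Continuous (fun s => Real.exp (J ((s, x), y))) := by fun_prop
    exact this.continuousAt.tendsto.mono_left nhdsWithin_le_nhds
  refine h1.congr' ?_
  filter_upwards [self_mem_nhdsWithin, nhdsWithin_le_nhds (Icc_mem_nhds hx.1 hx.2)] with s hs hs'
  rw [slope_def_field, key s hs' x (Ioo_subset_Icc_self hx) y hy,
    mul_div_cancel_left₀ _ (sub_ne_zero.2 hs)]

theorem exists_contDiff_compactSupport_eventuallyEq {f : ℝ × ℝ → ℝ} {n : ℕ}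
    (hf : ContDiffAt ℝ n f 0) :
    ∃ g : ℝ × ℝ → ℝ, ContDiff ℝ n g ∧ HasCompactSupport g ∧ g =ᶠ[𝓝 0] f := by
  have h1 : ∀ᶠ z in 𝓝 (0 : ℝ × ℝ), ContDiffAt ℝ n f z := hf.eventually (by simp)
  obtain ⟨ρ, hρ, hb⟩ := Metric.eventually_nhds_iff_ball.1 h1
  let χ : ContDiffBump (0 : ℝ × ℝ) := ⟨ρ / 4, ρ / 2, by positivity, by linarith⟩
  refine ⟨fun z => χ z * f z, ?_, χ.hasCompactSupport.mul_right, ?_⟩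
  · rw [contDiff_iff_contDiffAt]
    intro z
    by_cases hz : z ∈ Metric.ball (0 : ℝ × ℝ) ρ
    · exact χ.contDiffAt.mul (hb z hz)
    · have h0 : (fun z => χ z * f z) =ᶠ[𝓝 z] fun _ => 0 := by
        have : z ∈ (tsupport χ)ᶜ := by
          rw [χ.tsupport_eq]
          intro hz'
          apply hz
          rw [Metric.mem_ball]
          refine (Metric.mem_closedBall.1 hz').trans_lt ?_
          change ρ / 2 < ρ
          linarith
        filter_upwards [(isClosed_tsupport χ).isOpen_compl.mem_nhds this] with w hw
        rw [image_eq_zero_of_notMem_tsupport hw, zero_mul]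
      exact contDiffAt_const.congr_of_eventuallyEq h0
  · filter_upwards [χ.eventuallyEq_one] with z hz
    rw [hz]
    simp

/-- The map `(x, y) ↦ (φ (x, y), y)` has continuous partial derivatives and an invertible derivative
at `0`. It straightens the vertical lines into solutions, so the first coordinate of its inverse is
a first integral. -/
theorem exists_firstIntegral_graph {f : ℝ × ℝ → ℝ} (hf : ContDiffAt ℝ 1 f 0) :
    ∃ u : ℝ × ℝ → ℝ, ContDiffAt ℝ 1 u 0 ∧
      ∀ᶠ z in 𝓝 (0 : ℝ × ℝ), fderiv ℝ u z (f z, 1) = 0 ∧ fderiv ℝ u z ≠ 0 := by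
  obtain ⟨g, hg, hgs, hgf⟩ := exists_contDiff_compactSupport_eventuallyEq (n := 1) (by simpa using hf)
  obtain ⟨φ, E, hφc, hEc, hE, hφ0, hφ⟩ := exists_scalar_flow (by simpa using hg) hgs
  have hgc : Continuous g := hg.continuous
  let D : ℝ × ℝ → (ℝ × ℝ →L[ℝ] ℝ × ℝ) := fun z =>
    ((ContinuousLinearMap.toSpanSingleton ℝ (E z)).coprod
      (ContinuousLinearMap.toSpanSingleton ℝ (g (φ z, z.2)))).prod (ContinuousLinearMap.snd ℝ ℝ ℝ)
  let Ψ : ℝ × ℝ → ℝ × ℝ := fun z => (φ z, z.2)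
  let Q : Set (ℝ × ℝ) := Ioo (-1 : ℝ) 1 ×ˢ Ioo (-1 : ℝ) 1
  have hQo : IsOpen Q := isOpen_Ioo.prod isOpen_Ioo
  have hQ0 : (0 : ℝ × ℝ) ∈ Q := by simp [Q]
  have hΨ : ∀ z ∈ Q, HasFDerivAt Ψ (D z) z := by
    intro z hz
    have h1 : HasStrictFDerivAt (Function.HasUncurry.uncurry fun x y => φ (x, y))
        ((ContinuousLinearMap.toSpanSingleton ℝ (E z)).coprod
          (ContinuousLinearMap.toSpanSingleton ℝ (g (φ z, z.2)))) z :=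
      hasStrictFDerivAt_uncurry_coprod (u := z) (f := fun x y => φ (x, y))
        (f₁ := fun x y => ContinuousLinearMap.toSpanSingleton ℝ (E (x, y)))
        (f₂ := fun x y => ContinuousLinearMap.toSpanSingleton ℝ (g (φ (x, y), y)))
        (by filter_upwards [hQo.mem_nhds hz] with w hw using (hφ w.1 hw.1 w.2 hw.2).2.hasFDerivAt)
        (by filter_upwards [hQo.mem_nhds hz] with w hw using (hφ w.1 hw.1 w.2 hw.2).1.hasFDerivAt)
        (by
          have : Continuous fun w : ℝ × ℝ =>
            ContinuousLinearMap.toSpanSingletonCLE (𝕜 := ℝ) (E := ℝ) (E w) := by fun_prop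
          exact this.continuousAt)
        (by
          have : Continuous fun w : ℝ × ℝ =>
            ContinuousLinearMap.toSpanSingletonCLE (𝕜 := ℝ) (E := ℝ) (g (φ w, w.2)) := by fun_prop
          exact this.continuousAt)
    exact h1.hasFDerivAt.prodMk hasFDerivAt_snd
  have hDc : Continuous D := by
    have : D = fun z => E z • ((ContinuousLinearMap.inl ℝ ℝ ℝ).comp (ContinuousLinearMap.fst ℝ ℝ ℝ))
        + g (φ z, z.2) • ((ContinuousLinearMap.inl ℝ ℝ ℝ).comp (ContinuousLinearMap.snd ℝ ℝ ℝ))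
        + (ContinuousLinearMap.inr ℝ ℝ ℝ).comp (ContinuousLinearMap.snd ℝ ℝ ℝ) := by
      funext z
      ext <;> simp [D]
    rw [this]
    fun_prop
  have hΨ1 : ContDiffAt ℝ 1 Ψ 0 :=
    contDiffAt_one_iff.2 ⟨D, Q, hQo.mem_nhds hQ0, hDc.continuousOn, hΨ⟩
  let D₀ : (ℝ × ℝ) ≃L[ℝ] (ℝ × ℝ) := ContinuousLinearEquiv.equivOfInverse (D 0)
    (((E 0)⁻¹ • (ContinuousLinearMap.fst ℝ ℝ ℝ - g (φ 0, 0) • ContinuousLinearMap.snd ℝ ℝ ℝ)).prod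
      (ContinuousLinearMap.snd ℝ ℝ ℝ))
    (by
      intro z
      have := (hE 0).ne'
      ext
      · simp [D]; field_simp; ring
      · simp [D])
    (by
      intro z
      have := (hE 0).ne'
      ext
      · simp [D]; field_simp; ring
      · simp [D])
  have hΨ0 : HasFDerivAt Ψ (D₀ : ℝ × ℝ →L[ℝ] ℝ × ℝ) 0 := hΨ 0 hQ0
  have hΨz : Ψ 0 = 0 := by
    have := hφ0 0 (by norm_num)
    exact Prod.ext this rfl
  let P := hΨ1.toOpenPartialHomeomorph Ψ hΨ0 one_ne_zero
  have hPt : (0 : ℝ × ℝ) ∈ P.target := by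
    have := hΨ1.image_mem_toOpenPartialHomeomorph_target hΨ0 one_ne_zero
    rwa [hΨz] at this
  have hPs : (0 : ℝ × ℝ) ∈ P.source := hΨ1.mem_toOpenPartialHomeomorph_source hΨ0 one_ne_zero
  have hP0 : P.symm 0 = 0 := by
    have h := P.left_inv hPs
    have h' : P 0 = 0 := hΨz
    rwa [h'] at h
  have hinv : ContDiffAt ℝ 1 P.symm 0 := by
    have := hΨ1.to_localInverse hΨ0 one_ne_zero
    rw [hΨz] at this
    exact this
  have hu : ContDiffAt ℝ 1 (fun z => (P.symm z).1) 0 := contDiffAt_fst.comp 0 hinv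
  refine ⟨fun z => (P.symm z).1, hu, ?_⟩
  have hQ' : ∀ᶠ z in 𝓝 (0 : ℝ × ℝ), P.symm z ∈ Q := by
    have := (P.continuousAt_symm hPt).tendsto
    rw [hP0] at this
    exact this (hQo.mem_nhds hQ0)
  filter_upwards [hgf, P.open_target.mem_nhds hPt, hQ', hu.eventually (by simp)] with z hz hzt hzQ huz
  set w := P.symm z with hw
  have hws : w ∈ P.source := P.map_target hzt
  have hwz : Ψ w = z := P.right_inv hzt
  have hcomp : HasFDerivAt (fun w => (P.symm (Ψ w)).1)
      ((fderiv ℝ (fun z => (P.symm z).1) z).comp (D w)) w := by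
    have h1 := (huz.differentiableAt one_ne_zero).hasFDerivAt
    rw [← hwz] at h1 ⊢
    exact h1.comp w (hΨ w hzQ)
  have hfst : HasFDerivAt (fun w => (P.symm (Ψ w)).1) (ContinuousLinearMap.fst ℝ ℝ ℝ) w := by
    refine hasFDerivAt_fst.congr_of_eventuallyEq ?_
    filter_upwards [P.open_source.mem_nhds hws] with w' hw'
    exact congrArg Prod.fst (P.left_inv hw')
  have heq := hcomp.unique hfst
  have hgz : g (φ w, w.2) = f z := by
    have : (φ w, w.2) = z := hwz
    rw [this, hz]
  constructor
  · have := congrArg (fun A : ℝ × ℝ →L[ℝ] ℝ => A (0, 1)) heq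
    simpa [D, hgz] using this
  · intro h0
    have := congrArg (fun A : ℝ × ℝ →L[ℝ] ℝ => A (1, 0)) heq
    simp [h0] at this

/-- A linear change of coordinates makes `V z₀` vertical; near `z₀` the field is then proportional
to `(f, 1)`, where `f` is the quotient of its components. -/
theorem exists_firstIntegral {V : Plane → Plane} {z₀ : Plane} (hV : ContDiffAt ℝ 1 V z₀)
    (h0 : V z₀ ≠ 0) :
    ∃ u : Plane → ℝ, ContDiffAt ℝ 1 u z₀ ∧
      ∀ᶠ z in 𝓝 z₀, fderiv ℝ u z (V z) = 0 ∧ fderiv ℝ u z ≠ 0 := by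
  obtain ⟨L, hL⟩ : ∃ L : Plane ≃L[ℝ] ℝ × ℝ, L (V z₀) = (0, 1) := by
    let L₀ : Plane ≃L[ℝ] ℝ × ℝ := ContinuousLinearEquiv.ofFinrankEq (by simp)
    obtain ⟨A, hA⟩ := SeparatingDual.exists_continuousLinearEquiv_apply_eq (R := ℝ)
      (V := ℝ × ℝ) (x := L₀ (V z₀)) (y := (0, 1)) (by simpa using h0) (by simp)
    exact ⟨L₀.trans A, hA⟩
  let f : ℝ × ℝ → ℝ := fun w => (L (V (z₀ + L.symm w))).1 / (L (V (z₀ + L.symm w))).2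
  have hVc : ContDiffAt ℝ 1 (fun w : ℝ × ℝ => L (V (z₀ + L.symm w))) 0 := by
    have h1 : ContDiffAt ℝ 1 (fun w : ℝ × ℝ => V (z₀ + L.symm w)) 0 := by
      have h2 : ContDiffAt ℝ 1 V (z₀ + L.symm 0) := by simpa using hV
      exact ContDiffAt.comp (0 : ℝ × ℝ) (f := fun w : ℝ × ℝ => z₀ + L.symm w) h2 (by fun_prop)
    exact L.contDiff.contDiffAt.comp 0 h1
  have hf : ContDiffAt ℝ 1 f 0 :=
    (contDiffAt_fst.comp 0 hVc).div (contDiffAt_snd.comp 0 hVc) (by simp [hL])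
  obtain ⟨u, hu, hue⟩ := exists_firstIntegral_graph hf
  have hlin : ContDiff ℝ 1 (fun z : Plane => L (z - z₀)) := by fun_prop
  have hlim : Tendsto (fun z : Plane => L (z - z₀)) (𝓝 z₀) (𝓝 0) := by
    have := hlin.continuous.tendsto z₀
    simpa using this
  have hu' : ContDiffAt ℝ 1 u (L (z₀ - z₀)) := by simpa using hu
  have hpos : ∀ᶠ z in 𝓝 z₀, 0 < (L (V z)).2 := by
    have : ContinuousAt (fun z => (L (V z)).2) z₀ :=
      continuous_snd.continuousAt.comp (L.continuous.continuousAt.comp hV.continuousAt)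
    refine this.eventually (lt_mem_nhds ?_)
    simp [hL]
  refine ⟨fun z => u (L (z - z₀)), hu'.comp z₀ hlin.contDiffAt, ?_⟩
  filter_upwards [hlim.eventually hue, hpos, hlim.eventually (hu.eventually (by simp))]
    with z hz hz2 hzu
  have hd : HasFDerivAt (fun z : Plane => L (z - z₀)) (L : Plane →L[ℝ] ℝ × ℝ) z := by
    have := (L : Plane →L[ℝ] ℝ × ℝ).hasFDerivAt.comp z ((hasFDerivAt_id z).sub_const z₀)
    rwa [ContinuousLinearMap.comp_id] at this
  have hcomp := (hzu.differentiableAt one_ne_zero).hasFDerivAt.comp z hd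
  have hfd : fderiv ℝ (fun z => u (L (z - z₀))) z
      = (fderiv ℝ u (L (z - z₀))).comp (L : Plane →L[ℝ] ℝ × ℝ) := hcomp.fderiv
  rw [hfd]
  constructor
  · have hV2 : L (V z) = (L (V z)).2 • (f (L (z - z₀)), 1) := by
      ext
      · simp [f]
        field_simp
      · simp
    rw [ContinuousLinearMap.comp_apply]
    change fderiv ℝ u (L (z - z₀)) (L (V z)) = 0
    rw [hV2, map_smul, hz.1, smul_zero]
  · intro h
    apply hz.2
    ext1
    all_goals
      ext
    · have := congrArg (fun A : Plane →L[ℝ] ℝ => A (L.symm (1, 0))) h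
      simpa using this
    · have := congrArg (fun A : Plane →L[ℝ] ℝ => A (L.symm (0, 1))) h
      simpa using this

/-! ### The flows of the fields `X + ε W`, jointly continuous in `ε`, time and point. -/

section Flow

variable {M : Type*} [TopologicalSpace M] [ChartedSpace Plane M] [IsManifold (𝓡 2) ∞ M]

theorem localRep_add_smul (X W : (x : M) → TangentSpace (𝓡 2) x) (ε : ℝ) {x₀ : M} {y : Plane}
    (hy : y ∈ (extChartAt (𝓡 2) x₀).target) :
    localRep (fun x => X x + ε • W x) x₀ y = localRep X x₀ y + ε • localRep W x₀ y := by
  simp only [localRep_eq_chartDeriv _ hy, map_add, map_smul]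

theorem exists_local_flow {r : ℕ∞} (hr : 1 ≤ r) (X W : VField r M) (x₀ : M) (ε₀ : ℝ) :
    ∃ N ∈ 𝓝 (x₀, ε₀), ∃ τ > 0, ∃ β : (M × ℝ) × ℝ → M,
      ContinuousOn β (N ×ˢ Ioo (-τ) τ) ∧ ∀ w ∈ N, β (w, 0) = w.1 ∧
        IsMIntegralCurveOn (fun t => β (w, t)) (fun x => X x + w.2 • W x) (Ioo (-τ) τ) := by
  have hr' : (1 : ℕ∞ω) ≤ (r : ℕ∞ω) := by exact_mod_cast hr
  let e := extChartAt (𝓡 2) x₀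
  have hto : IsOpen e.target := isOpen_extChartAt_target (I := 𝓡 2) x₀
  have hy₀ : e x₀ ∈ e.target := mem_extChartAt_target (I := 𝓡 2) x₀
  -- The parameter is carried along as a coordinate with zero velocity, so continuity in the
  -- parameter is a case of continuity in the initial value.
  let G : Plane × ℝ → Plane × ℝ := fun w =>
    (localRep (fun x => X x) x₀ w.1 + w.2 • localRep (fun x => W x) x₀ w.1, 0)
  have hG : ContDiffAt ℝ 1 G (e x₀, ε₀) := by
    have h1 : ContDiffAt ℝ 1 (localRep (fun x => X x) x₀) (e x₀, ε₀).1 :=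
      (X.contDiffAt_localRep hy₀).of_le hr'
    have h2 : ContDiffAt ℝ 1 (localRep (fun x => W x) x₀) (e x₀, ε₀).1 :=
      (W.contDiffAt_localRep hy₀).of_le hr'
    exact ((h1.comp _ contDiffAt_fst).add (contDiffAt_snd.smul (h2.comp _ contDiffAt_fst))).prodMk
      contDiffAt_const
  obtain ⟨τ₀, hτ₀, a, ρ, L, K, hρ, hpl⟩ := IsPicardLindelof.of_contDiffAt_one hG
  obtain ⟨α, hα, hαc⟩ := (hpl 0).exists_forall_mem_closedBall_eq_hasDerivWithinAt_continuousOn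
  simp only [zero_sub, zero_add] at hα hαc
  have hmem : Metric.closedBall (e x₀, ε₀) (ρ : ℝ) ×ˢ Icc (-τ₀) τ₀ ∈ 𝓝 ((e x₀, ε₀), (0 : ℝ)) :=
    prod_mem_nhds (Metric.closedBall_mem_nhds _ hρ) (Icc_mem_nhds (by linarith) hτ₀)
  have hα0 := (hα (e x₀, ε₀) (Metric.mem_closedBall_self (by positivity))).1
  have hev : ∀ᶠ w in 𝓝 ((e x₀, ε₀), (0 : ℝ)), (α w).1 ∈ e.target := by
    have h1 : ContinuousAt (fun w => (α w).1) ((e x₀, ε₀), (0 : ℝ)) :=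
      continuous_fst.continuousAt.comp (hαc.continuousAt hmem)
    refine h1 (hto.mem_nhds ?_)
    change (α ((e x₀, ε₀), 0)).1 ∈ e.target
    rw [hα0]
    exact hy₀
  rw [nhds_prod_eq] at hev
  obtain ⟨A, hA, B, hB, hAB⟩ := Filter.eventually_prod_iff.1 hev
  obtain ⟨τ₁, hτ₁, hB'⟩ := Metric.eventually_nhds_iff_ball.1 hB
  let τ := min τ₀ τ₁
  have hτ : 0 < τ := lt_min hτ₀ hτ₁
  have hB'' : ∀ t ∈ Ioo (-τ) τ, B t := fun t ht => hB' t (by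
    rw [Metric.mem_ball, Real.dist_eq, sub_zero, abs_lt]
    exact ⟨by linarith [ht.1, min_le_right τ₀ τ₁], ht.2.trans_le (min_le_right _ _)⟩)
  have hI : Ioo (-τ) τ ⊆ Ioo (-τ₀) τ₀ := fun t ht =>
    ⟨by linarith [ht.1, min_le_left τ₀ τ₁], ht.2.trans_le (min_le_left _ _)⟩
  let N : Set (M × ℝ) := {w | w.1 ∈ e.source ∧ (e w.1, w.2) ∈ Metric.closedBall (e x₀, ε₀) (ρ : ℝ) ∧
    A (e w.1, w.2)}
  have hec : ContinuousAt (fun w : M × ℝ => (e w.1, w.2)) (x₀, ε₀) := by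
    have : ContinuousAt e x₀ := continuousAt_extChartAt (I := 𝓡 2) x₀
    exact ContinuousAt.prodMk (this.comp (x := (x₀, ε₀)) continuousAt_fst) continuousAt_snd
  have hN : N ∈ 𝓝 (x₀, ε₀) := by
    refine inter_mem ?_ (inter_mem ?_ ?_)
    · exact continuousAt_fst (extChartAt_source_mem_nhds (I := 𝓡 2) x₀)
    · exact hec (Metric.closedBall_mem_nhds _ hρ)
    · exact hec hA
  refine ⟨N, hN, τ, hτ, fun w => e.symm (α ((e w.1.1, w.1.2), w.2)).1, ?_, ?_⟩
  · have h1 : ContinuousOn (fun w : (M × ℝ) × ℝ => ((e w.1.1, w.1.2), w.2)) (N ×ˢ Ioo (-τ) τ) := by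
      have : ContinuousOn e e.source := continuousOn_extChartAt (I := 𝓡 2) x₀
      have h2 : ContinuousOn (fun w : (M × ℝ) × ℝ => e w.1.1) (N ×ˢ Ioo (-τ) τ) :=
        this.comp (by fun_prop) fun w hw => hw.1.1
      exact (h2.prodMk (by fun_prop)).prodMk (by fun_prop)
    have h2 : ContinuousOn (fun w : (M × ℝ) × ℝ => (α ((e w.1.1, w.1.2), w.2)).1)
        (N ×ˢ Ioo (-τ) τ) :=
      continuous_fst.comp_continuousOn (hαc.comp h1 fun w hw =>
        ⟨hw.1.2.1, Ioo_subset_Icc_self (hI hw.2)⟩)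
    exact (continuousOn_extChartAt_symm (I := 𝓡 2) x₀).comp h2 fun w hw =>
      hAB hw.1.2.2 (hB'' _ hw.2)
  · intro w hw
    obtain ⟨h0, hd⟩ := hα (e w.1, w.2) hw.2.1
    have hd' : ∀ t ∈ Ioo (-τ₀) τ₀, HasDerivAt (fun t => α ((e w.1, w.2), t))
        (G (α ((e w.1, w.2), t))) t := fun t ht =>
      (hd t (Ioo_subset_Icc_self ht)).hasDerivAt (Icc_mem_nhds ht.1 ht.2)
    have hsnd : ∀ t ∈ Ioo (-τ₀) τ₀, (α ((e w.1, w.2), t)).2 = w.2 := by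
      intro t ht
      have h1 : ∀ t ∈ Ioo (-τ₀) τ₀, HasDerivAt (fun t => (α ((e w.1, w.2), t)).2) 0 t :=
        fun t ht => (hd' t ht).snd
      have := (convex_Ioo (-τ₀) τ₀).is_const_of_fderivWithin_eq_zero (𝕜 := ℝ)
        (f := fun t => (α ((e w.1, w.2), t)).2)
        (fun s hs => (h1 s hs).differentiableAt.differentiableWithinAt) (fun s hs => by
          rw [fderivWithin_of_isOpen isOpen_Ioo hs]
          ext
          simp [(h1 s hs).deriv]) ht (by simpa using hτ₀ : (0 : ℝ) ∈ Ioo (-τ₀) τ₀)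
      rw [this, h0]
    refine ⟨?_, fun t ht => HasMFDerivAt.hasMFDerivWithinAt ?_⟩
    · simp only
      rw [h0]
      exact e.left_inv hw.1
    · have htar : ∀ s ∈ Ioo (-τ) τ, (α ((e w.1, w.2), s)).1 ∈ e.target :=
        fun s hs => hAB hw.2.2 (hB'' s hs)
      have hsrc := e.map_target (htar t ht)
      have hfst : HasDerivAt (fun t => (α ((e w.1, w.2), t)).1) _ t := (hd' t (hI ht)).fst
      refine hasMFDerivAt_of_hasDerivAt_extChartAt (x₀ := x₀) ?_ ?_ ?_
      · simpa [e] using hsrc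
      · exact ContinuousAt.comp (f := fun t => (α ((e w.1, w.2), t)).1)
          ((continuousOn_extChartAt_symm (I := 𝓡 2) x₀).continuousAt (hto.mem_nhds (htar t ht)))
          hfst.continuousAt
      · have h2 : (fun s => e (e.symm (α ((e w.1, w.2), s)).1))
            =ᶠ[𝓝 t] fun s => (α ((e w.1, w.2), s)).1 := by
          filter_upwards [isOpen_Ioo.mem_nhds ht] with s hs
          exact e.right_inv (htar s hs)
        refine (hfst.congr_of_eventuallyEq h2).congr_deriv ?_
        simp only [G]
        rw [hsnd t (hI ht), ← localRep_add_smul _ _ _ (htar t ht),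
          localRep_eq_chartDeriv _ (htar t ht)]

theorem VField.contMDiff_one {r : ℕ∞} (hr : 1 ≤ r) (X : VField r M) :
    ContMDiff (𝓡 2) (𝓡 2).tangent 1 (fun x => (⟨x, X x⟩ : TangentBundle (𝓡 2) M)) :=
  X.contMDiff.of_le (by exact_mod_cast hr)

theorem VField.contMDiff_add_smul {r : ℕ∞} (hr : 1 ≤ r) (X W : VField r M) (ε : ℝ) :
    ContMDiff (𝓡 2) (𝓡 2).tangent 1
      (fun x => (⟨x, X x + ε • W x⟩ : TangentBundle (𝓡 2) M)) :=
  VField.contMDiff_one hr (X + ε • W)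

variable [T2Space M] [CompactSpace M]

/-- Compactness gives one existence time for all starting points, and this extends integral curves
to the whole line. -/
theorem exists_isMIntegralCurve_add_smul {r : ℕ∞} (hr : 1 ≤ r) (X W : VField r M) (ε : ℝ) (x : M) :
    ∃ γ : ℝ → M, γ 0 = x ∧ IsMIntegralCurve γ (fun x => X x + ε • W x) := by
  have := isManifold_one (M := M)
  have key : ∃ τ > 0, ∀ x ∈ (univ : Set M), ∃ γ : ℝ → M, γ 0 = x ∧
      IsMIntegralCurveOn γ (fun x => X x + ε • W x) (Ioo (-τ) τ) := by
    refine isCompact_univ.induction_on (p := fun s : Set M => ∃ τ > 0, ∀ x ∈ s, ∃ γ : ℝ → M,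
      γ 0 = x ∧ IsMIntegralCurveOn γ (fun x => X x + ε • W x) (Ioo (-τ) τ)) ?_ ?_ ?_ ?_
    · exact ⟨1, one_pos, fun x hx => absurd hx (notMem_empty x)⟩
    · rintro s t hst ⟨τ, hτ, h⟩
      exact ⟨τ, hτ, fun x hx => h x (hst hx)⟩
    · rintro s t ⟨τ, hτ, h⟩ ⟨τ', hτ', h'⟩
      have hle : ∀ {a b : ℝ}, a ≤ b → Ioo (-a) a ⊆ Ioo (-b) b := fun hab =>
        Ioo_subset_Ioo (by linarith) hab
      refine ⟨min τ τ', lt_min hτ hτ', fun x hx => ?_⟩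
      rcases hx with hx | hx
      · obtain ⟨γ, h0, hγ⟩ := h x hx
        exact ⟨γ, h0, hγ.mono (hle (min_le_left _ _))⟩
      · obtain ⟨γ, h0, hγ⟩ := h' x hx
        exact ⟨γ, h0, hγ.mono (hle (min_le_right _ _))⟩
    · intro x _
      obtain ⟨N, hN, τ, hτ, β, -, hβ⟩ := exists_local_flow hr X W x ε
      refine ⟨{x | (x, ε) ∈ N}, ?_, τ, hτ, fun y hy => ⟨fun t => β ((y, ε), t), hβ _ hy⟩⟩
      rw [nhdsWithin_univ]
      exact (by fun_prop : Continuous fun y : M => (y, ε)).continuousAt hN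
  obtain ⟨τ, hτ, h⟩ := key
  exact exists_isMIntegralCurve_of_isMIntegralCurveOn (VField.contMDiff_add_smul hr X W ε) hτ
    (fun x => h x (mem_univ x)) x

theorem VField.exists_isMIntegralCurve {r : ℕ∞} (hr : 1 ≤ r) (X : VField r M) (x : M) :
    ∃ γ : ℝ → M, γ 0 = x ∧ IsMIntegralCurve γ (fun x => X x) := by
  obtain ⟨γ, h0, h⟩ := exists_isMIntegralCurve_add_smul hr X 0 0 x
  refine ⟨γ, h0, ?_⟩
  simpa using h

/-- A choice of the integral curves of the fields `X + ε • W`. -/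
structure IsFlowFamily (X W : (x : M) → TangentSpace (𝓡 2) x) (Z : ℝ → ℝ → M → M) : Prop where
  zero : ∀ ε x, Z ε 0 x = x
  curve : ∀ ε x, IsMIntegralCurve (fun t => Z ε t x) (fun x => X x + ε • W x)
  unique : ∀ ε (γ : ℝ → M), IsMIntegralCurve γ (fun x => X x + ε • W x) →
    ∀ t, γ t = Z ε t (γ 0)
  add : ∀ ε s t x, Z ε (s + t) x = Z ε s (Z ε t x)
  cont : Continuous fun w : ℝ × ℝ × M => Z w.1 w.2.1 w.2.2

theorem exists_isFlowFamily {r : ℕ∞} (hr : 1 ≤ r) (X W : VField r M) :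
    ∃ Z : ℝ → ℝ → M → M, IsFlowFamily (fun x => X x) (fun x => W x) Z := by
  have := isManifold_one (M := M)
  choose Γ hΓ0 hΓ using fun (ε : ℝ) (x : M) => exists_isMIntegralCurve_add_smul hr X W ε x
  let Z : ℝ → ℝ → M → M := fun ε t x => Γ ε x t
  have huniq : ∀ ε (γ : ℝ → M), IsMIntegralCurve γ (fun x => X x + ε • W x) →
      ∀ t, γ t = Z ε t (γ 0) := by
    intro ε γ hγ t
    exact congrFun (isMIntegralCurve_Ioo_eq_of_contMDiff_boundaryless (t₀ := 0)
      (VField.contMDiff_add_smul hr X W ε) hγ (hΓ ε (γ 0)) (hΓ0 ε (γ 0)).symm) t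
  have hadd : ∀ ε s t x, Z ε (s + t) x = Z ε s (Z ε t x) := by
    intro ε s t x
    have := huniq ε _ ((hΓ ε x).comp_add t) s
    simpa [Z] using this
  refine ⟨Z, hΓ0, hΓ, huniq, hadd, ?_⟩
  rw [continuous_iff_continuousAt]
  rintro ⟨ε, t, x⟩
  have key : ∃ τ > 0, ∀ x ∈ (univ : Set M), ∀ t ∈ Ioo (-τ) τ,
      ContinuousAt (fun w : ℝ × ℝ × M => Z w.1 w.2.1 w.2.2) (ε, t, x) := by
    refine isCompact_univ.induction_on (p := fun s : Set M => ∃ τ > 0, ∀ x ∈ s, ∀ t ∈ Ioo (-τ) τ,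
      ContinuousAt (fun w : ℝ × ℝ × M => Z w.1 w.2.1 w.2.2) (ε, t, x)) ?_ ?_ ?_ ?_
    · exact ⟨1, one_pos, fun x hx => absurd hx (notMem_empty x)⟩
    · rintro s t hst ⟨τ, hτ, h⟩
      exact ⟨τ, hτ, fun x hx => h x (hst hx)⟩
    · rintro s t ⟨τ, hτ, h⟩ ⟨τ', hτ', h'⟩
      have hle : ∀ {a b : ℝ}, a ≤ b → Ioo (-a) a ⊆ Ioo (-b) b := fun hab =>
        Ioo_subset_Ioo (by linarith) hab
      refine ⟨min τ τ', lt_min hτ hτ', fun x hx u hu => ?_⟩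
      rcases hx with hx | hx
      · exact h x hx u (hle (min_le_left _ _) hu)
      · exact h' x hx u (hle (min_le_right _ _) hu)
    · intro x _
      obtain ⟨N, hN, τ, hτ, β, hβc, hβ⟩ := exists_local_flow hr X W x ε
      refine ⟨{x | (x, ε) ∈ interior N}, ?_, τ, hτ, fun y hy t ht => ?_⟩
      · rw [nhdsWithin_univ]
        exact (by fun_prop : Continuous fun y : M => (y, ε)).continuousAt (interior_mem_nhds.2 hN)
      · have h0 : (0 : ℝ) ∈ Ioo (-τ) τ := ⟨by linarith, hτ⟩
        have hnh : N ×ˢ Ioo (-τ) τ ∈ 𝓝 ((y, ε), t) :=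
          prod_mem_nhds (mem_interior_iff_mem_nhds.1 hy) (isOpen_Ioo.mem_nhds ht)
        have hσ : ContinuousAt (fun w : ℝ × ℝ × M => ((w.2.2, w.1), w.2.1)) (ε, t, y) := by
          fun_prop
        have h1 : ContinuousAt (fun w : ℝ × ℝ × M => β ((w.2.2, w.1), w.2.1)) (ε, t, y) :=
          ContinuousAt.comp (g := β) (hβc.continuousAt hnh) hσ
        refine h1.congr ?_
        filter_upwards [hσ hnh] with w hw
        have h2 := hβ _ hw.1
        exact isMIntegralCurveOn_Ioo_eqOn_of_contMDiff_boundaryless h0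
          (VField.contMDiff_add_smul hr X W w.1) h2.2 ((hΓ w.1 w.2.2).isMIntegralCurveOn _)
          (h2.1.trans (hΓ0 _ _).symm) hw.2
  obtain ⟨τ, hτ, h⟩ := key
  -- Continuity for short times, uniform in the point, spreads to all times since `Z ε t` is the
  -- square of `Z ε (t / 2)`.
  have hdouble : ∀ n : ℕ, ∀ x : M, ∀ t ∈ Ioo (-(2 ^ n * τ)) (2 ^ n * τ),
      ContinuousAt (fun w : ℝ × ℝ × M => Z w.1 w.2.1 w.2.2) (ε, t, x) := by
    intro n
    induction n with
    | zero => simpa using fun x => h x (mem_univ x)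
    | succ n ih =>
      intro x t ht
      have ht' : t / 2 ∈ Ioo (-(2 ^ n * τ)) (2 ^ n * τ) := by
        rw [pow_succ] at ht
        constructor
        · linarith [ht.1]
        · linarith [ht.2]
      have heq : (fun w : ℝ × ℝ × M => Z w.1 w.2.1 w.2.2)
          = fun w : ℝ × ℝ × M => Z w.1 (w.2.1 / 2) (Z w.1 (w.2.1 / 2) w.2.2) := by
        funext w
        rw [← hadd, add_halves]
      rw [heq]
      have hin : ContinuousAt (fun w : ℝ × ℝ × M => (w.1, w.2.1 / 2, w.2.2)) (ε, t, x) := by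
        fun_prop
      have h1 : ContinuousAt (fun w : ℝ × ℝ × M => Z w.1 (w.2.1 / 2) w.2.2) (ε, t, x) :=
        ContinuousAt.comp (g := fun w : ℝ × ℝ × M => Z w.1 w.2.1 w.2.2)
          (f := fun w : ℝ × ℝ × M => (w.1, w.2.1 / 2, w.2.2)) (ih x _ ht') hin
      have h2 : ContinuousAt (fun w : ℝ × ℝ × M => (w.1, w.2.1 / 2, Z w.1 (w.2.1 / 2) w.2.2))
          (ε, t, x) := by fun_prop
      exact ContinuousAt.comp (g := fun w : ℝ × ℝ × M => Z w.1 w.2.1 w.2.2)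
        (f := fun w : ℝ × ℝ × M => (w.1, w.2.1 / 2, Z w.1 (w.2.1 / 2) w.2.2)) (ih _ _ ht') h2
  obtain ⟨n, hn⟩ := pow_unbounded_of_one_lt (|t| / τ) (one_lt_two (α := ℝ))
  refine hdouble n x t ?_
  rw [div_lt_iff₀ hτ] at hn
  exact abs_lt.1 hn

end Flow

/-- Two independent vectors of the plane detect nonzero functionals. -/
theorem clm_ne_zero_of_independent {v w : Plane} (h : LinearIndependent ℝ ![v, w])
    {A : Plane →L[ℝ] ℝ} (hA : A ≠ 0) (hv : A v = 0) : A w ≠ 0 := by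
  intro hw
  apply hA
  have hspan := h.span_eq_top_of_card_eq_finrank (by simp)
  have : (A : Plane →ₗ[ℝ] ℝ) = 0 := by
    refine LinearMap.ext_on_range (v := ![v, w]) hspan fun i => ?_
    fin_cases i
    · simpa using hv
    · simpa using hw
  ext x
  exact congrArg (fun B : Plane →ₗ[ℝ] ℝ => B x) this

theorem exists_normalized_firstIntegral {V W : Plane → Plane} {z₀ : Plane}
    (hV : ContDiffAt ℝ 1 V z₀) (h : LinearIndependent ℝ ![V z₀, W z₀]) :
    ∃ u : Plane → ℝ, ContDiffAt ℝ 1 u z₀ ∧ u z₀ = 0 ∧ 0 < fderiv ℝ u z₀ (W z₀) ∧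
      ∀ᶠ z in 𝓝 z₀, fderiv ℝ u z (V z) = 0 := by
  have h0 : V z₀ ≠ 0 := by simpa using h.ne_zero 0
  obtain ⟨u, hu, hue⟩ := exists_firstIntegral hV h0
  have hne := clm_ne_zero_of_independent h hue.self_of_nhds.2 hue.self_of_nhds.1
  let c : ℝ := fderiv ℝ u z₀ (W z₀)
  have hfd : ∀ z, DifferentiableAt ℝ u z →
      fderiv ℝ (fun z => c * (u z - u z₀)) z = c • fderiv ℝ u z := by
    intro z hz
    rw [fderiv_const_mul (hz.sub_const _), fderiv_sub_const]
  -- The factor `c`, the derivative of `u` along `W` at `z₀`, makes the new derivative `c * c`,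
  -- hence positive whatever the sign of `c`.
  refine ⟨fun z => c * (u z - u z₀), contDiffAt_const.mul (hu.sub contDiffAt_const), by simp, ?_, ?_⟩
  · rw [hfd _ (hu.differentiableAt one_ne_zero)]
    change 0 < c * c
    exact mul_self_pos.2 hne
  · filter_upwards [hue, hu.eventually (by simp)] with z hz hzu
    rw [hfd _ (hzu.differentiableAt one_ne_zero)]
    simp [hz.1]

/-! ### Coordinates adapted to two transverse fields. -/

section Box

variable {M : Type*} [TopologicalSpace M] [ChartedSpace Plane M] [IsManifold (𝓡 2) ∞ M]

/-- The curve `γ` has velocity `v` at time `t`. -/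
def HasVelocity (γ : ℝ → M) (t : ℝ) (v : TangentSpace (𝓡 2) (γ t)) : Prop :=
  HasMFDerivAt 𝓘(ℝ, ℝ) (𝓡 2) γ t ((1 : ℝ →L[ℝ] ℝ).smulRight v)

/-- Coordinates onto a square centred at `e` for which the trajectories of `X` are vertical and
those of `W` horizontal, oriented upwards and to the right. -/
structure TransverseBox (X W : (x : M) → TangentSpace (𝓡 2) x) (e : M) where
  ψ : OpenPartialHomeomorph M (ℝ × ℝ)
  κ : ℝ
  κ_pos : 0 < κ
  target_eq : ψ.target = Ioo (-κ) κ ×ˢ Ioo (-κ) κ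
  mem_source : e ∈ ψ.source
  map_center : ψ e = (0, 0)
  lo : ℝ
  hi : ℝ
  lo_pos : 0 < lo
  p : M → ℝ
  q : M → ℝ
  p_mem : ∀ x ∈ ψ.source, p x ∈ Icc lo hi
  q_mem : ∀ x ∈ ψ.source, q x ∈ Icc lo hi
  hasDerivAt : ∀ (γ : ℝ → M) (t α β : ℝ), γ t ∈ ψ.source →
    HasVelocity γ t (α • X (γ t) + β • W (γ t)) →
    HasDerivAt (fun s => (ψ (γ s)).1) (β * p (γ t)) t ∧
    HasDerivAt (fun s => (ψ (γ s)).2) (α * q (γ t)) t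

/-- The two coordinates are a first integral `u` of `X` and a first integral `v` of `W`, normalized
so that each increases along the other field. The speeds are continuous and positive at the centre,
so in a small square they lie between positive constants. -/
theorem exists_transverseBox {r : ℕ∞} (hr : 1 ≤ r) (X W : VField r M) {e : M}
    (h : LinearIndependent ℝ ![X e, W e]) {N : Set M} (hN : N ∈ 𝓝 e) :
    ∃ B : TransverseBox (fun x => X x) (fun x => W x) e, B.ψ.source ⊆ N := by
  have hr' : (1 : ℕ∞ω) ≤ (r : ℕ∞ω) := by exact_mod_cast hr
  have hes : e ∈ (chartAt Plane e).source := mem_chart_source Plane e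
  have hy₀ : chartAt Plane e e ∈ (extChartAt (𝓡 2) e).target := mem_extChartAt_target (I := 𝓡 2) e
  set y₀ : Plane := chartAt Plane e e with hy₀def
  let Xh := localRep (fun x => X x) e
  let Wh := localRep (fun x => W x) e
  have hXh : ContDiffAt ℝ 1 Xh y₀ := (X.contDiffAt_localRep hy₀).of_le hr'
  have hWh : ContDiffAt ℝ 1 Wh y₀ := (W.contDiffAt_localRep hy₀).of_le hr'
  have hXc : ∀ x ∈ (chartAt Plane e).source, Xh (chartAt Plane e x) = chartDeriv e x (X x) :=
    fun x hx => localRep_extChartAt (fun x => X x) hx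
  have hWc : ∀ x ∈ (chartAt Plane e).source, Wh (chartAt Plane e x) = chartDeriv e x (W x) :=
    fun x hx => localRep_extChartAt (fun x => W x) hx
  have hli : LinearIndependent ℝ ![Xh y₀, Wh y₀] := by
    have h1 := h.map' (chartDeriv e e : TangentSpace (𝓡 2) e →ₗ[ℝ] Plane)
      (LinearMap.ker_eq_bot.2 (chartDeriv_injective hes))
    have h2 : ![Xh y₀, Wh y₀]
        = (chartDeriv e e : TangentSpace (𝓡 2) e →ₗ[ℝ] Plane) ∘ ![X e, W e] := by
      ext1 i
      fin_cases i
      · exact hXc e hes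
      · exact hWc e hes
    rw [h2]
    exact h1
  have hli' : LinearIndependent ℝ ![Wh y₀, Xh y₀] := by
    rw [LinearIndependent.pair_symm_iff]
    exact hli
  obtain ⟨u, hu, hu0, hup, hue⟩ := exists_normalized_firstIntegral hXh hli
  obtain ⟨v, hv, hv0, hvp, hve⟩ := exists_normalized_firstIntegral hWh hli'
  let p : Plane → ℝ := fun y => fderiv ℝ u y (Wh y)
  let q : Plane → ℝ := fun y => fderiv ℝ v y (Xh y)
  have hpc : ContinuousAt p y₀ :=
    (hu.fderiv_right (m := 0) (by simp)).continuousAt.clm_apply hWh.continuousAt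
  have hqc : ContinuousAt q y₀ :=
    (hv.fderiv_right (m := 0) (by simp)).continuousAt.clm_apply hXh.continuousAt
  let lo := min (p y₀) (q y₀) / 2
  let hi := max (p y₀) (q y₀) + 1
  have hlo : 0 < lo := half_pos (lt_min hup hvp)
  have hpb : ∀ᶠ y in 𝓝 y₀, p y ∈ Icc lo hi := by
    refine hpc (Icc_mem_nhds ?_ ?_)
    · have := min_le_left (p y₀) (q y₀)
      have : 0 < p y₀ := hup
      simp only [lo]; linarith
    · have := le_max_left (p y₀) (q y₀)
      simp only [hi]; linarith
  have hqb : ∀ᶠ y in 𝓝 y₀, q y ∈ Icc lo hi := by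
    refine hqc (Icc_mem_nhds ?_ ?_)
    · have := min_le_right (p y₀) (q y₀)
      have : 0 < q y₀ := hvp
      simp only [lo]; linarith
    · have := le_max_right (p y₀) (q y₀)
      simp only [hi]; linarith
  let G : Plane → ℝ × ℝ := fun y => (u y, v y)
  have hG : ContDiffAt ℝ 1 G y₀ := hu.prodMk hv
  let A : Plane →L[ℝ] ℝ × ℝ := (fderiv ℝ u y₀).prod (fderiv ℝ v y₀)
  have hGA : HasFDerivAt G A y₀ :=
    (hu.differentiableAt one_ne_zero).hasFDerivAt.prodMk (hv.differentiableAt one_ne_zero).hasFDerivAt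
  have hsurj : Function.Surjective A := by
    rintro ⟨a, b⟩
    refine ⟨(a / p y₀) • Wh y₀ + (b / q y₀) • Xh y₀, ?_⟩
    have h1 : fderiv ℝ u y₀ (Wh y₀) ≠ 0 := hup.ne'
    have h2 : fderiv ℝ v y₀ (Xh y₀) ≠ 0 := hvp.ne'
    ext
    · simp [A, p, hue.self_of_nhds, h1]
    · simp [A, q, hve.self_of_nhds, h2]
  have hinj : Function.Injective A :=
    (LinearMap.injective_iff_surjective_of_finrank_eq_finrank (f := (A : Plane →ₗ[ℝ] ℝ × ℝ))
      (by simp)).2 hsurj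
  let A' : Plane ≃L[ℝ] ℝ × ℝ := (LinearEquiv.ofBijective (A : Plane →ₗ[ℝ] ℝ × ℝ)
    ⟨hinj, hsurj⟩).toContinuousLinearEquiv
  have hGA' : HasFDerivAt G (A' : Plane →L[ℝ] ℝ × ℝ) y₀ := hGA
  let P := hG.toOpenPartialHomeomorph G hGA' one_ne_zero
  have hPs : y₀ ∈ P.source := hG.mem_toOpenPartialHomeomorph_source hGA' one_ne_zero
  let Ψ : OpenPartialHomeomorph M (ℝ × ℝ) := (chartAt Plane e).trans P
  have hΨ : ∀ x, Ψ x = (u (chartAt Plane e x), v (chartAt Plane e x)) := fun x => rfl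
  have hΨe : Ψ e = (0, 0) := by rw [hΨ, ← hy₀def, hu0, hv0]
  have hcc : ContinuousAt (chartAt Plane e) e := (chartAt Plane e).continuousAt hes
  have hΨs : e ∈ Ψ.source := by
    simp only [Ψ, OpenPartialHomeomorph.trans_source]
    exact ⟨hes, hPs⟩
  have hgood : ∀ᶠ x in 𝓝 e, x ∈ N ∧ x ∈ (chartAt Plane e).source ∧
      (fderiv ℝ u (chartAt Plane e x) (Xh (chartAt Plane e x)) = 0 ∧
        fderiv ℝ v (chartAt Plane e x) (Wh (chartAt Plane e x)) = 0) ∧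
      p (chartAt Plane e x) ∈ Icc lo hi ∧ q (chartAt Plane e x) ∈ Icc lo hi ∧
      ContDiffAt ℝ 1 u (chartAt Plane e x) ∧ ContDiffAt ℝ 1 v (chartAt Plane e x) := by
    filter_upwards [hN, (chartAt Plane e).open_source.mem_nhds hes, hcc.eventually hue,
      hcc.eventually hve, hcc.eventually hpb, hcc.eventually hqb,
      hcc.eventually (hu.eventually (by simp)), hcc.eventually (hv.eventually (by simp))]
      with x h1 h2 h3 h4 h5 h6 h7 h8
    exact ⟨h1, h2, ⟨h3, h4⟩, h5, h6, h7, h8⟩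
  obtain ⟨N', hN', hN'o, heN'⟩ := eventually_nhds_iff.1 hgood
  let Ψ' := Ψ.restrOpen N' hN'o
  have hΨ's : e ∈ Ψ'.source := by
    simp only [Ψ', OpenPartialHomeomorph.restrOpen_source]
    exact ⟨hΨs, heN'⟩
  have h0t : ((0, 0) : ℝ × ℝ) ∈ Ψ'.target := by
    rw [← hΨe]
    exact Ψ'.map_source hΨ's
  obtain ⟨κ, hκ, hball⟩ := Metric.isOpen_iff.1 Ψ'.open_target _ h0t
  have hsq : Ioo (-κ) κ ×ˢ Ioo (-κ) κ ⊆ Ψ'.target := by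
    refine Subset.trans ?_ hball
    rw [← ball_prod_same, Real.ball_eq_Ioo, zero_sub, zero_add]
  let ψ := (Ψ'.symm.restrOpen (Ioo (-κ) κ ×ˢ Ioo (-κ) κ) (isOpen_Ioo.prod isOpen_Ioo)).symm
  have hψt : ψ.target = Ioo (-κ) κ ×ˢ Ioo (-κ) κ := by
    simp only [ψ, OpenPartialHomeomorph.symm_target, OpenPartialHomeomorph.restrOpen_source,
      OpenPartialHomeomorph.symm_source]
    exact inter_eq_right.2 hsq
  have hψ : ∀ x, ψ x = (u (chartAt Plane e x), v (chartAt Plane e x)) := fun x => rfl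
  have hψsub : ψ.source ⊆ N' := by
    intro x hx
    have hx2 : x ∈ Ψ'.source := by
      have := ψ.map_source hx
      have hx3 := ψ.left_inv hx
      rw [hψt] at this
      have h5 := Ψ'.map_target (hsq this)
      have h6 : Ψ'.symm (ψ x) = x := hx3
      rwa [h6] at h5
    simp only [Ψ', OpenPartialHomeomorph.restrOpen_source] at hx2
    exact hx2.2
  have hψs : e ∈ ψ.source := by
    have h1 : ((0, 0) : ℝ × ℝ) ∈ ψ.target := by rw [hψt]; simp [hκ]
    have h2 := ψ.map_target h1
    have h3 : ψ.symm (0, 0) = e := by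
      have h4 := Ψ'.left_inv hΨ's
      have h5 : Ψ' e = (0, 0) := hΨe
      rw [h5] at h4
      exact h4
    rwa [h3] at h2
  refine ⟨⟨ψ, κ, hκ, hψt, hψs, hΨe, lo, hi, hlo, fun x => p (chartAt Plane e x),
    fun x => q (chartAt Plane e x), fun x hx => (hN' x (hψsub hx)).2.2.2.1,
    fun x hx => (hN' x (hψsub hx)).2.2.2.2.1, ?_⟩, fun x hx => (hN' x (hψsub hx)).1⟩
  intro γ t α β hγt hγ
  obtain ⟨-, hsrc, ⟨hu1, hv1⟩, -, -, hu2, hv2⟩ := hN' _ (hψsub hγt)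
  have h1 : HasDerivAt (fun s => chartAt Plane e (γ s))
      (chartDeriv e (γ t) (α • X (γ t) + β • W (γ t))) t := hasDerivAt_extChartAt_comp hsrc hγ
  rw [map_add, map_smul, map_smul, ← hXc _ hsrc, ← hWc _ hsrc] at h1
  constructor
  · have h2 := (hu2.differentiableAt one_ne_zero).hasFDerivAt.comp_hasDerivAt t h1
    refine h2.congr_deriv ?_
    rw [map_add, map_smul, map_smul, hu1]
    simp [p]
  · have h2 := (hv2.differentiableAt one_ne_zero).hasFDerivAt.comp_hasDerivAt t h1
    refine h2.congr_deriv ?_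
    rw [map_add, map_smul, map_smul, hv1]
    simp [q]

end Box

theorem le_of_hasDerivAt_nonneg {f f' : ℝ → ℝ} {a b : ℝ} (hab : a ≤ b)
    (h : ∀ s ∈ Icc a b, HasDerivAt f (f' s) s) (h0 : ∀ s ∈ Icc a b, 0 ≤ f' s) : f a ≤ f b := by
  refine monotoneOn_of_deriv_nonneg (convex_Icc a b)
    (fun s hs => (h s hs).continuousAt.continuousWithinAt)
    (fun s hs => (h s (interior_subset hs)).differentiableAt.differentiableWithinAt)
    (fun s hs => ?_) (left_mem_Icc.2 hab) (right_mem_Icc.2 hab) hab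
  rw [(h s (interior_subset hs)).deriv]
  exact h0 s (interior_subset hs)

theorem lt_of_hasDerivAt_pos {f f' : ℝ → ℝ} {a b : ℝ} (hab : a < b)
    (h : ∀ s ∈ Icc a b, HasDerivAt f (f' s) s) (h0 : ∀ s ∈ Icc a b, 0 < f' s) : f a < f b := by
  refine strictMonoOn_of_deriv_pos (convex_Icc a b)
    (fun s hs => (h s hs).continuousAt.continuousWithinAt)
    (fun s hs => ?_) (left_mem_Icc.2 hab.le) (right_mem_Icc.2 hab.le) hab
  rw [(h s (interior_subset hs)).deriv]
  exact h0 s (interior_subset hs)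

/-! ### Motion of trajectories inside a transverse box. -/

section Box

variable {M : Type*} [TopologicalSpace M] [ChartedSpace Plane M] [IsManifold (𝓡 2) ∞ M]
  {X W : (x : M) → TangentSpace (𝓡 2) x} {e : M}

namespace TransverseBox

theorem mem_target_iff (B : TransverseBox X W e) {z : ℝ × ℝ} :
    z ∈ B.ψ.target ↔ |z.1| < B.κ ∧ |z.2| < B.κ := by
  rw [B.target_eq, mem_prod, abs_lt, abs_lt]
  rfl

theorem abs_lt_of_mem (B : TransverseBox X W e) {x : M} (hx : x ∈ B.ψ.source) :
    |(B.ψ x).1| < B.κ ∧ |(B.ψ x).2| < B.κ := B.mem_target_iff.1 (B.ψ.map_source hx)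

/-- The box with the roles of the two fields exchanged. -/
def swap (B : TransverseBox X W e) : TransverseBox W X e where
  ψ := B.ψ.transHomeomorph (Homeomorph.prodComm ℝ ℝ)
  κ := B.κ
  κ_pos := B.κ_pos
  target_eq := by
    ext z
    simp only [OpenPartialHomeomorph.transHomeomorph_target, mem_preimage, B.target_eq]
    simp [and_comm]
  mem_source := B.mem_source
  map_center := by simp [B.map_center]
  lo := B.lo
  hi := B.hi
  lo_pos := B.lo_pos
  p := B.q
  q := B.p
  p_mem := B.q_mem
  q_mem := B.p_mem
  hasDerivAt := by
    intro γ t α β ht h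
    rw [add_comm] at h
    exact (B.hasDerivAt γ t β α ht h).symm

theorem swap_apply (B : TransverseBox X W e) (x : M) : B.swap.ψ x = ((B.ψ x).2, (B.ψ x).1) := rfl

/-- The concentric box of a smaller half-width. -/
def shrink (B : TransverseBox X W e) (κ' : ℝ) (h0 : 0 < κ') (h1 : κ' ≤ B.κ) :
    TransverseBox X W e where
  ψ := (B.ψ.symm.restrOpen (Ioo (-κ') κ' ×ˢ Ioo (-κ') κ') (isOpen_Ioo.prod isOpen_Ioo)).symm
  κ := κ'
  κ_pos := h0
  target_eq := by
    simp only [OpenPartialHomeomorph.symm_target, OpenPartialHomeomorph.restrOpen_source,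
      OpenPartialHomeomorph.symm_source, B.target_eq]
    exact inter_eq_right.2 (prod_mono (Ioo_subset_Ioo (by linarith) h1)
      (Ioo_subset_Ioo (by linarith) h1))
  mem_source := by
    refine ⟨B.mem_source, ?_⟩
    change B.ψ e ∈ Ioo (-κ') κ' ×ˢ Ioo (-κ') κ'
    rw [B.map_center]
    simp [h0]
  map_center := B.map_center
  lo := B.lo
  hi := B.hi
  lo_pos := B.lo_pos
  p := B.p
  q := B.q
  p_mem := fun x hx => B.p_mem x hx.1
  q_mem := fun x hx => B.q_mem x hx.1
  hasDerivAt := fun γ t α β ht h => B.hasDerivAt γ t α β ht.1 h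

theorem mem_shrink_source (B : TransverseBox X W e) {κ' : ℝ} (h0 : 0 < κ') (h1 : κ' ≤ B.κ) {x : M} :
    x ∈ (B.shrink κ' h0 h1).ψ.source ↔
      x ∈ B.ψ.source ∧ |(B.ψ x).1| < κ' ∧ |(B.ψ x).2| < κ' := by
  rw [abs_lt, abs_lt]
  exact Iff.rfl

theorem shrink_apply (B : TransverseBox X W e) {κ' : ℝ} (h0 : 0 < κ') (h1 : κ' ≤ B.κ) (x : M) :
    (B.shrink κ' h0 h1).ψ x = B.ψ x := rfl

/-- A convex part of a box that misses the frontier of `F` lies on one side of it. -/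
theorem side (B : TransverseBox X W e) {F : Set M} {C : Set (ℝ × ℝ)} (hC : Convex ℝ C)
    (h : ∀ x ∈ B.ψ.source, B.ψ x ∈ C → x ∉ frontier F) :
    (∀ x ∈ B.ψ.source, B.ψ x ∈ C → x ∈ interior F) ∨
      (∀ x ∈ B.ψ.source, B.ψ x ∈ C → x ∉ F) := by
  have hconv : Convex ℝ (B.ψ.target ∩ C) := by
    rw [B.target_eq]
    exact ((convex_Ioo _ _).prod (convex_Ioo _ _)).inter hC
  have hS : IsPreconnected (B.ψ.symm '' (B.ψ.target ∩ C)) :=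
    hconv.isPreconnected.image _ (B.ψ.continuousOn_symm.mono inter_subset_left)
  have himg : ∀ x ∈ B.ψ.source, B.ψ x ∈ C → x ∈ B.ψ.symm '' (B.ψ.target ∩ C) := fun x hx hxC =>
    ⟨B.ψ x, ⟨B.ψ.map_source hx, hxC⟩, B.ψ.left_inv hx⟩
  have hsub : B.ψ.symm '' (B.ψ.target ∩ C) ⊆ interior F ∪ (closure F)ᶜ := by
    rintro _ ⟨z, ⟨hz, hzC⟩, rfl⟩
    have h1 := h _ (B.ψ.map_target hz) (by rwa [B.ψ.right_inv hz])
    by_contra hcon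
    rw [mem_union, not_or, notMem_compl_iff] at hcon
    exact h1 ⟨hcon.2, hcon.1⟩
  rcases hS.subset_or_subset isOpen_interior isClosed_closure.isOpen_compl
    (disjoint_compl_right_iff_subset.2 (interior_subset.trans subset_closure)) hsub with h1 | h1
  · exact Or.inl fun x hx hxC => h1 (himg x hx hxC)
  · exact Or.inr fun x hx hxC hxF => h1 (himg x hx hxC) (subset_closure hxF)

theorem fst_sub_ge (B : TransverseBox X W e) {γ : ℝ → M} {α β a b : ℝ} (hab : a ≤ b)
    (hγ : ∀ t ∈ Icc a b, HasVelocity γ t (α • X (γ t) + β • W (γ t)))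
    (hs : ∀ t ∈ Icc a b, γ t ∈ B.ψ.source) (hβ : 0 ≤ β) :
    (B.ψ (γ a)).1 + β * B.lo * (b - a) ≤ (B.ψ (γ b)).1 := by
  have := le_of_hasDerivAt_nonneg (f := fun s => (B.ψ (γ s)).1 - β * B.lo * s)
    (f' := fun s => β * B.p (γ s) - β * B.lo * 1) hab
    (fun s hs' => ((B.hasDerivAt γ s α β (hs s hs') (hγ s hs')).1).sub
      ((hasDerivAt_id s).const_mul _))
    (fun s hs' => by
      have := mul_le_mul_of_nonneg_left (B.p_mem _ (hs s hs')).1 hβ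
      linarith)
  linarith

theorem fst_lt (B : TransverseBox X W e) {γ : ℝ → M} {α β a b : ℝ} (hab : a < b)
    (hγ : ∀ t ∈ Icc a b, HasVelocity γ t (α • X (γ t) + β • W (γ t)))
    (hs : ∀ t ∈ Icc a b, γ t ∈ B.ψ.source) (hβ : 0 < β) :
    (B.ψ (γ a)).1 < (B.ψ (γ b)).1 := by
  have h1 := B.fst_sub_ge hab.le hγ hs hβ.le
  have h2 : 0 < β * B.lo * (b - a) := mul_pos (mul_pos hβ B.lo_pos) (sub_pos.2 hab)
  linarith

theorem fst_eq (B : TransverseBox X W e) {γ : ℝ → M} {α a b : ℝ} (hab : a ≤ b)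
    (hγ : ∀ t ∈ Icc a b, HasVelocity γ t (α • X (γ t) + (0 : ℝ) • W (γ t)))
    (hs : ∀ t ∈ Icc a b, γ t ∈ B.ψ.source) :
    (B.ψ (γ b)).1 = (B.ψ (γ a)).1 := by
  refine le_antisymm ?_ ?_
  · have := le_of_hasDerivAt_nonneg (f := fun s => -(B.ψ (γ s)).1)
      (f' := fun s => -(0 * B.p (γ s))) hab
      (fun s hs' => ((B.hasDerivAt γ s α 0 (hs s hs') (hγ s hs')).1).neg) (fun s hs' => by simp)
    linarith
  · have := B.fst_sub_ge hab hγ hs le_rfl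
    linarith

theorem snd_lt (B : TransverseBox X W e) {γ : ℝ → M} {α β a b : ℝ} (hab : a < b)
    (hγ : ∀ t ∈ Icc a b, HasVelocity γ t (α • X (γ t) + β • W (γ t)))
    (hs : ∀ t ∈ Icc a b, γ t ∈ B.ψ.source) (hα : 0 < α) :
    (B.ψ (γ a)).2 < (B.ψ (γ b)).2 :=
  B.swap.fst_lt (α := β) (β := α) hab (fun t ht => by rw [add_comm]; exact hγ t ht) hs hα

theorem snd_eq (B : TransverseBox X W e) {γ : ℝ → M} {β a b : ℝ} (hab : a ≤ b)
    (hγ : ∀ t ∈ Icc a b, HasVelocity γ t ((0 : ℝ) • X (γ t) + β • W (γ t)))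
    (hs : ∀ t ∈ Icc a b, γ t ∈ B.ψ.source) :
    (B.ψ (γ b)).2 = (B.ψ (γ a)).2 :=
  B.swap.fst_eq (α := β) hab (fun t ht => by rw [add_comm]; exact hγ t ht) hs

/-- The slope of the trajectory is at most `α hi / (β lo)`, the greatest vertical speed over the
least horizontal one. -/
theorem snd_sub_le (B : TransverseBox X W e) {γ : ℝ → M} {α β a b : ℝ} (hab : a ≤ b)
    (hγ : ∀ t ∈ Icc a b, HasVelocity γ t (α • X (γ t) + β • W (γ t)))
    (hs : ∀ t ∈ Icc a b, γ t ∈ B.ψ.source) (hα : 0 ≤ α) (hβ : 0 < β) :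
    (B.ψ (γ b)).2 - (B.ψ (γ a)).2
      ≤ α * B.hi / (β * B.lo) * ((B.ψ (γ b)).1 - (B.ψ (γ a)).1) := by
  set Q := α * B.hi / (β * B.lo) with hQ
  have hlo := B.lo_pos
  have hhi : 0 < B.hi := hlo.trans_le ((B.p_mem _ B.mem_source).1.trans (B.p_mem _ B.mem_source).2)
  have hQ0 : 0 ≤ Q := by positivity
  have := le_of_hasDerivAt_nonneg (f := fun s => Q * (B.ψ (γ s)).1 - (B.ψ (γ s)).2)
    (f' := fun s => Q * (β * B.p (γ s)) - α * B.q (γ s)) hab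
    (fun s hs' => ((B.hasDerivAt γ s α β (hs s hs') (hγ s hs')).1.const_mul Q).sub
      (B.hasDerivAt γ s α β (hs s hs') (hγ s hs')).2)
    (fun s hs' => by
      have h1 := mul_le_mul_of_nonneg_left (B.p_mem _ (hs s hs')).1 hβ.le
      have h2 := mul_le_mul_of_nonneg_left (B.q_mem _ (hs s hs')).2 hα
      have h3 := mul_le_mul_of_nonneg_left h1 hQ0
      have h4 : Q * (β * B.lo) = α * B.hi := by rw [hQ]; field_simp
      linarith)
  linarith

/-- A trajectory with positive horizontal velocity reaches every vertical line of the box to its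
right that is so near that it cannot leave the box through the top before. -/
theorem reach [T2Space M] (B : TransverseBox X W e) {γ : ℝ → M} {α β u₁ : ℝ}
    (hγ : ∀ t, HasVelocity γ t (α • X (γ t) + β • W (γ t)))
    (hs : γ 0 ∈ B.ψ.source) (hα : 0 ≤ α) (hβ : 0 < β) (hu : (B.ψ (γ 0)).1 < u₁) (hu₁ : u₁ < B.κ)
    (hv : (B.ψ (γ 0)).2 + α * B.hi / (β * B.lo) * (u₁ - (B.ψ (γ 0)).1) < B.κ) :
    ∃ t > 0, (∀ s ∈ Icc 0 t, γ s ∈ B.ψ.source) ∧ (B.ψ (γ t)).1 = u₁ := by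
  have hc : Continuous γ := continuous_iff_continuousAt.2 fun t => (hγ t).continuousAt
  set Q := α * B.hi / (β * B.lo) with hQ
  set u₀ := (B.ψ (γ 0)).1 with hu₀
  set v₀ := (B.ψ (γ 0)).2 with hv₀
  have hlo := B.lo_pos
  have hhi : 0 < B.hi := hlo.trans_le ((B.p_mem _ B.mem_source).1.trans (B.p_mem _ B.mem_source).2)
  have hQ0 : 0 ≤ Q := by positivity
  -- As long as the trajectory is in the box and not past the line `u₁`, monotonicity and the slope
  -- bound keep it in this compact rectangle. It therefore cannot escape through the sides of the
  -- box, and its positive horizontal speed makes it reach the line in bounded time.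
  let C : Set (ℝ × ℝ) := Icc u₀ u₁ ×ˢ Icc v₀ (v₀ + Q * (u₁ - u₀))
  have hCt : C ⊆ B.ψ.target := by
    have h1 := B.abs_lt_of_mem hs
    rw [B.target_eq]
    exact prod_mono (Icc_subset_Ioo (abs_lt.1 h1.1).1 hu₁) (Icc_subset_Ioo (abs_lt.1 h1.2).1 hv)
  have hK : IsClosed (B.ψ.symm '' C) :=
    ((isCompact_Icc.prod isCompact_Icc).image_of_continuousOn
      (B.ψ.continuousOn_symm.mono hCt)).isClosed
  have hKs : B.ψ.symm '' C ⊆ B.ψ.source := by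
    rintro _ ⟨z, hz, rfl⟩
    exact B.ψ.map_target (hCt hz)
  let S : Set ℝ := {t | 0 ≤ t ∧ ∀ s ∈ Icc 0 t, γ s ∈ B.ψ.source ∧ (B.ψ (γ s)).1 ≤ u₁}
  have hSK : ∀ t ∈ S, γ t ∈ B.ψ.symm '' C := by
    intro t ht
    have h1 := B.fst_sub_ge ht.1 (fun s _ => hγ s) (fun s hs' => (ht.2 s hs').1) hβ.le
    have h2 := B.snd_sub_le ht.1 (fun s _ => hγ s) (fun s hs' => (ht.2 s hs').1) hα hβ
    have h3 := B.swap.fst_sub_ge (α := β) (β := α) ht.1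
      (fun s _ => by rw [add_comm]; exact hγ s) (fun s hs' => (ht.2 s hs').1) hα
    have h4 := (ht.2 t ⟨ht.1, le_rfl⟩).2
    have h5 : 0 ≤ β * B.lo * (t - 0) := by have := ht.1; simp only [sub_zero]; positivity
    have h6 : 0 ≤ α * B.swap.lo * (t - 0) := by
      have := ht.1
      have h7 : 0 < B.swap.lo := B.lo_pos
      simp only [sub_zero]; positivity
    simp only [swap_apply] at h3
    refine ⟨B.ψ (γ t), ⟨⟨by linarith, h4⟩, by linarith, ?_⟩,
      B.ψ.left_inv (ht.2 t ⟨ht.1, le_rfl⟩).1⟩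
    have h8 : Q * ((B.ψ (γ t)).1 - u₀) ≤ Q * (u₁ - u₀) :=
      mul_le_mul_of_nonneg_left (by linarith) hQ0
    linarith
  have hS0 : (0 : ℝ) ∈ S := ⟨le_rfl, fun s hs' => by
    have : s = 0 := le_antisymm hs'.2 hs'.1
    subst this
    exact ⟨hs, hu.le⟩⟩
  have hbdd : BddAbove S := by
    refine ⟨(u₁ - u₀) / (β * B.lo), fun t ht => ?_⟩
    have h1 := B.fst_sub_ge ht.1 (fun s _ => hγ s) (fun s hs' => (ht.2 s hs').1) hβ.le
    have h4 := (ht.2 t ⟨ht.1, le_rfl⟩).2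
    rw [le_div_iff₀ (by positivity)]
    linarith
  set T := sSup S with hT
  have hT0 : 0 ≤ T := le_csSup hbdd hS0
  have hlt : ∀ s ∈ Ico 0 T, s ∈ S := by
    intro s hs'
    obtain ⟨t, ht, hst⟩ := exists_lt_of_lt_csSup ⟨0, hS0⟩ hs'.2
    exact ⟨hs'.1, fun s' hs'' => ht.2 s' ⟨hs''.1, hs''.2.trans hst.le⟩⟩
  have hTK : γ T ∈ B.ψ.symm '' C := by
    rcases hT0.eq_or_lt with h0 | h0
    · rw [← h0]
      exact hSK 0 hS0
    · have h1 : T ∈ closure (Ico 0 T) := by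
        rw [closure_Ico h0.ne]
        exact right_mem_Icc.2 h0.le
      have h2 := hK.closure_subset_iff.2 (image_subset_iff.2 fun s hs' => hSK s (hlt s hs'))
      exact h2 (image_closure_subset_closure_image hc ⟨T, h1, rfl⟩)
  have hTs : γ T ∈ B.ψ.source := hKs hTK
  have hTu : (B.ψ (γ T)).1 ≤ u₁ := by
    obtain ⟨z, hz, hzT⟩ := hTK
    rw [← hzT, B.ψ.right_inv (hCt hz)]
    exact hz.1.2
  have hTS : T ∈ S := by
    refine ⟨hT0, fun s hs' => ?_⟩
    rcases hs'.2.eq_or_lt with h0 | h0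
    · rw [h0]
      exact ⟨hTs, hTu⟩
    · exact (hlt s ⟨hs'.1, h0⟩).2 s ⟨hs'.1, le_rfl⟩
  have hTeq : (B.ψ (γ T)).1 = u₁ := by
    by_contra hne
    have hlt' : (B.ψ (γ T)).1 < u₁ := lt_of_le_of_ne hTu hne
    have hcT : ContinuousAt (fun s => (B.ψ (γ s)).1) T :=
      (B.hasDerivAt γ T α β hTs (hγ T)).1.continuousAt
    have hev : ∀ᶠ s in 𝓝 T, γ s ∈ B.ψ.source ∧ (B.ψ (γ s)).1 ≤ u₁ := by
      filter_upwards [hc.continuousAt (B.ψ.open_source.mem_nhds hTs),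
        hcT.eventually (gt_mem_nhds hlt')] with s h1 h2
      exact ⟨h1, h2.le⟩
    obtain ⟨η, hη, hηb⟩ := Metric.eventually_nhds_iff_ball.1 hev
    have hmem : T + η / 2 ∈ S := by
      refine ⟨by linarith, fun s hs' => ?_⟩
      rcases le_or_gt s T with h1 | h1
      · exact hTS.2 s ⟨hs'.1, h1⟩
      · refine hηb s ?_
        rw [Metric.mem_ball, Real.dist_eq, abs_lt]
        constructor <;> linarith [hs'.2]
    have := le_csSup hbdd hmem
    linarith
  refine ⟨T, ?_, fun s hs' => (hTS.2 s hs').1, hTeq⟩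
  rcases hT0.eq_or_lt with h0 | h0
  · rw [← h0] at hTeq
    exact absurd hTeq hu.ne
  · exact h0

theorem exists_small (B : TransverseBox X W e) {N : Set M} (hN : N ∈ 𝓝 e) :
    ∃ κ₀, 0 < κ₀ ∧ κ₀ ≤ B.κ ∧
      ∀ x ∈ B.ψ.source, |(B.ψ x).1| < κ₀ → |(B.ψ x).2| < κ₀ → x ∈ N := by
  have h0 : ((0, 0) : ℝ × ℝ) ∈ B.ψ.target := by
    rw [← B.map_center]
    exact B.ψ.map_source B.mem_source
  have h1 : B.ψ.symm (0, 0) = e := by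
    rw [← B.map_center]
    exact B.ψ.left_inv B.mem_source
  have h2 : B.ψ.symm ⁻¹' N ∈ 𝓝 ((0, 0) : ℝ × ℝ) :=
    (B.ψ.continuousAt_symm h0) (by rwa [h1])
  obtain ⟨η, hη, hb⟩ := Metric.mem_nhds_iff.1 h2
  refine ⟨min η B.κ, lt_min hη B.κ_pos, min_le_right _ _, fun x hx hu hv => ?_⟩
  have h3 : B.ψ x ∈ Metric.ball ((0, 0) : ℝ × ℝ) η := by
    rw [← ball_prod_same, mem_prod, mem_ball_zero_iff, mem_ball_zero_iff]
    exact ⟨hu.trans_le (min_le_left _ _), hv.trans_le (min_le_left _ _)⟩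
  have h4 := hb h3
  rwa [mem_preimage, B.ψ.left_inv hx] at h4

/-- Near one of its points, an arc of trajectory of `W` is a horizontal segment. -/
theorem exists_arc_iff [T2Space M] (B : TransverseBox X W e) {γ : ℝ → M} {T t₀ : ℝ}
    (hγ : ∀ t, HasVelocity γ t ((0 : ℝ) • X (γ t) + (1 : ℝ) • W (γ t)))
    (hinj : InjOn γ (Icc 0 T)) (ht₀ : t₀ ∈ Icc 0 T) (he : γ t₀ = e) :
    ∃ κ₀, 0 < κ₀ ∧ κ₀ ≤ B.κ ∧ ∀ x ∈ B.ψ.source, |(B.ψ x).1| < κ₀ → |(B.ψ x).2| < κ₀ →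
      (x ∈ γ '' Icc 0 T ↔ (B.ψ x).2 = 0 ∧ (t₀ = 0 → 0 ≤ (B.ψ x).1) ∧
        (t₀ = T → (B.ψ x).1 ≤ 0)) := by
  have hc : Continuous γ := continuous_iff_continuousAt.2 fun t => (hγ t).continuousAt
  have h1 : ∀ᶠ t in 𝓝 t₀, γ t ∈ B.ψ.source ∧ (t₀ ≠ 0 → 0 < t) ∧ (t₀ ≠ T → t < T) := by
    refine (hc.continuousAt.eventually_mem (B.ψ.open_source.mem_nhds ?_)).and (Eventually.and ?_ ?_)
    · rw [he]; exact B.mem_source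
    · by_cases h : t₀ = 0
      · simp [h]
      · filter_upwards [lt_mem_nhds (lt_of_le_of_ne ht₀.1 (Ne.symm h))] with t ht _ using ht
    · by_cases h : t₀ = T
      · simp [h]
      · filter_upwards [gt_mem_nhds (lt_of_le_of_ne ht₀.2 h)] with t ht _ using ht
  obtain ⟨η', hη', hb⟩ := Metric.nhds_basis_closedBall.eventually_iff.1 h1
  obtain ⟨η, hη, rfl⟩ : ∃ η > 0, η = η' := ⟨η', hη', rfl⟩
  rw [Real.closedBall_eq_Icc] at hb
  have hψ0 : B.ψ (γ t₀) = (0, 0) := by rw [he, B.map_center]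
  have hsnd : ∀ t ∈ Icc (t₀ - η) (t₀ + η), (B.ψ (γ t)).2 = 0 := by
    intro t ht
    rcases le_total t₀ t with h | h
    · rw [B.snd_eq h (fun s _ => hγ s) (fun s hs => (hb ⟨by linarith [hs.1], hs.2.trans ht.2⟩).1), hψ0]
    · have := B.snd_eq h (fun s _ => hγ s) (fun s hs => (hb ⟨ht.1.trans hs.1, by linarith [hs.2]⟩).1)
      rw [← this, hψ0]
  have hfst : ∀ s t, t₀ - η ≤ s → s ≤ t → t ≤ t₀ + η →
      (B.ψ (γ s)).1 + B.lo * (t - s) ≤ (B.ψ (γ t)).1 := by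
    intro s t h1 h2 h3
    have := B.fst_sub_ge h2 (fun s _ => hγ s)
      (fun s' hs => (hb ⟨h1.trans hs.1, hs.2.trans h3⟩).1) zero_le_one
    rwa [one_mul] at this
  have hψc : ∀ t ∈ Icc (t₀ - η) (t₀ + η), ContinuousAt (fun t => (B.ψ (γ t)).1) t := fun t ht =>
    (B.hasDerivAt γ t 0 1 (hb ht).1 (hγ t)).1.continuousAt
  have hK : IsCompact (γ '' (Icc 0 T \ Ioo (t₀ - η) (t₀ + η))) :=
    (isCompact_Icc.diff isOpen_Ioo).image hc
  have heK : e ∉ γ '' (Icc 0 T \ Ioo (t₀ - η) (t₀ + η)) := by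
    rintro ⟨t, ht, hte⟩
    have : t = t₀ := hinj ht.1 ht₀ (hte.trans he.symm)
    subst this
    exact ht.2 ⟨by linarith, by linarith⟩
  obtain ⟨κ₁, hκ₁, hκ₁B, hκ₁K⟩ := B.exists_small (hK.isClosed.isOpen_compl.mem_nhds heK)
  -- Within `κ₁` of the centre only the part of the arc with times close to `t₀` is present; the
  -- horizontal speed is at least `lo`, so that part covers every abscissa smaller than `lo * η` in
  -- absolute value that the end points allow.
  refine ⟨min κ₁ (B.lo * η), lt_min hκ₁ (mul_pos B.lo_pos hη), (min_le_left _ _).trans hκ₁B,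
    fun x hx hu hv => ⟨?_, ?_⟩⟩
  · rintro ⟨t, ht, rfl⟩
    have hnot := hκ₁K _ hx (hu.trans_le (min_le_left _ _)) (hv.trans_le (min_le_left _ _))
    have htη : t ∈ Ioo (t₀ - η) (t₀ + η) := by
      by_contra hcon
      exact hnot ⟨t, ⟨ht, hcon⟩, rfl⟩
    refine ⟨hsnd t (Ioo_subset_Icc_self htη), fun h => ?_, fun h => ?_⟩
    · have h5 := hfst t₀ t (by linarith) (h ▸ ht.1) htη.2.le
      have h6 : 0 ≤ B.lo * (t - t₀) := mul_nonneg B.lo_pos.le (by rw [h]; linarith [ht.1])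
      rw [hψ0] at h5
      linarith
    · have h5 := hfst t t₀ htη.1.le (h ▸ ht.2) (by linarith)
      have h6 : 0 ≤ B.lo * (t₀ - t) := mul_nonneg B.lo_pos.le (by rw [h]; linarith [ht.2])
      rw [hψ0] at h5
      linarith
  · rintro ⟨hv0, h0, hT⟩
    have hu' := hu.trans_le (min_le_right _ _)
    rw [abs_lt] at hu'
    have key : ∃ t ∈ Icc 0 T, t ∈ Icc (t₀ - η) (t₀ + η) ∧ (B.ψ (γ t)).1 = (B.ψ x).1 := by
      rcases lt_trichotomy (B.ψ x).1 0 with h | h | h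
      · have h7 := hfst (t₀ - η) t₀ le_rfl (by linarith) (by linarith)
        rw [hψ0] at h7
        obtain ⟨t, ht, hte⟩ := intermediate_value_Icc (show t₀ - η ≤ t₀ by linarith)
          (f := fun t => (B.ψ (γ t)).1)
          (fun t ht => (hψc t ⟨ht.1, by linarith [ht.2]⟩).continuousWithinAt)
          (show (B.ψ x).1 ∈ Icc _ _ from ⟨by linarith, by rw [hψ0]; exact h.le⟩)
        have h8 : t ∈ Icc (t₀ - η) (t₀ + η) := ⟨ht.1, by linarith [ht.2]⟩
        exact ⟨t, ⟨((hb h8).2.1 fun h9 => by linarith [h0 h9]).le, ht.2.trans ht₀.2⟩, h8, hte⟩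
      · exact ⟨t₀, ht₀, ⟨by linarith, by linarith⟩, by rw [hψ0, h]⟩
      · have h7 := hfst t₀ (t₀ + η) (by linarith) (by linarith) le_rfl
        rw [hψ0] at h7
        obtain ⟨t, ht, hte⟩ := intermediate_value_Icc (show t₀ ≤ t₀ + η by linarith)
          (f := fun t => (B.ψ (γ t)).1)
          (fun t ht => (hψc t ⟨by linarith [ht.1], ht.2⟩).continuousWithinAt)
          (show (B.ψ x).1 ∈ Icc _ _ from ⟨by rw [hψ0]; exact h.le, by linarith⟩)
        have h8 : t ∈ Icc (t₀ - η) (t₀ + η) := ⟨by linarith [ht.1], ht.2⟩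
        exact ⟨t, ⟨ht₀.1.trans ht.1, ((hb h8).2.2 fun h9 => by linarith [hT h9]).le⟩, h8, hte⟩
    obtain ⟨t, ht, htη, hte⟩ := key
    exact ⟨t, ht, B.ψ.injOn (hb htη).1 hx (Prod.ext hte (by rw [hsnd t htη, hv0]))⟩

/-- The direction in which a trajectory of `X + ε W` with `0 ≤ ε` leaves a point of the box. -/
theorem eventually_cone (B : TransverseBox X W e) {γ : ℝ → M} {ε t₀ : ℝ}
    (hγ : ∀ t, HasVelocity γ t (X (γ t) + ε • W (γ t))) (hs : γ t₀ ∈ B.ψ.source) :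
    ∀ᶠ t in 𝓝[>] t₀, γ t ∈ B.ψ.source ∧ (B.ψ (γ t₀)).2 < (B.ψ (γ t)).2 ∧
      (ε = 0 → (B.ψ (γ t)).1 = (B.ψ (γ t₀)).1) ∧ (0 < ε → (B.ψ (γ t₀)).1 < (B.ψ (γ t)).1) := by
  have hγ' : ∀ t, HasVelocity γ t ((1 : ℝ) • X (γ t) + ε • W (γ t)) := fun t => by
    rw [one_smul]; exact hγ t
  have h1 : ∀ᶠ t in 𝓝 t₀, γ t ∈ B.ψ.source :=
    (hγ t₀).continuousAt.eventually_mem (B.ψ.open_source.mem_nhds hs)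
  obtain ⟨η, hη, hb⟩ := Metric.eventually_nhds_iff_ball.1 h1
  rw [Real.ball_eq_Ioo] at hb
  filter_upwards [Ioo_mem_nhdsGT (show t₀ < t₀ + η by linarith)] with t ht
  have h2 : ∀ s ∈ Icc t₀ t, γ s ∈ B.ψ.source := fun s hs =>
    hb s ⟨by linarith [hs.1], by linarith [hs.2, ht.2]⟩
  refine ⟨h2 t ⟨ht.1.le, le_rfl⟩, B.snd_lt ht.1 (fun s _ => hγ' s) h2 one_pos, ?_,
    B.fst_lt ht.1 (fun s _ => hγ' s) h2⟩
  rintro rfl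
  exact B.fst_eq ht.1.le (fun s _ => hγ' s) h2

/-- The direction from which a trajectory of `X + ε W` with `0 ≤ ε` comes to a point of the box. -/
theorem eventually_cone_left (B : TransverseBox X W e) {γ : ℝ → M} {ε t₀ : ℝ}
    (hγ : ∀ t, HasVelocity γ t (X (γ t) + ε • W (γ t))) (hs : γ t₀ ∈ B.ψ.source) :
    ∀ᶠ t in 𝓝[<] t₀, γ t ∈ B.ψ.source ∧ (B.ψ (γ t)).2 < (B.ψ (γ t₀)).2 ∧
      (ε = 0 → (B.ψ (γ t)).1 = (B.ψ (γ t₀)).1) ∧ (0 < ε → (B.ψ (γ t)).1 < (B.ψ (γ t₀)).1) := by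
  have hγ' : ∀ t, HasVelocity γ t ((1 : ℝ) • X (γ t) + ε • W (γ t)) := fun t => by
    rw [one_smul]; exact hγ t
  have h1 : ∀ᶠ t in 𝓝 t₀, γ t ∈ B.ψ.source :=
    (hγ t₀).continuousAt.eventually_mem (B.ψ.open_source.mem_nhds hs)
  obtain ⟨η, hη, hb⟩ := Metric.eventually_nhds_iff_ball.1 h1
  rw [Real.ball_eq_Ioo] at hb
  filter_upwards [Ioo_mem_nhdsLT (show t₀ - η < t₀ by linarith)] with t ht
  have h2 : ∀ s ∈ Icc t t₀, γ s ∈ B.ψ.source := fun s hs =>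
    hb s ⟨by linarith [hs.1, ht.1], by linarith [hs.2]⟩
  refine ⟨h2 t ⟨le_rfl, ht.2.le⟩, B.snd_lt ht.2 (fun s _ => hγ' s) h2 one_pos, ?_,
    B.fst_lt ht.2 (fun s _ => hγ' s) h2⟩
  rintro rfl
  exact (B.fst_eq ht.2.le (fun s _ => hγ' s) h2).symm

end TransverseBox
end Box

/-! ### Leaving an open set. -/

theorem exists_first_exit {M : Type*} [TopologicalSpace M] {γ : ℝ → M} (hγ : Continuous γ)
    {U : Set M} (hU : IsOpen U) (h : ∀ᶠ t in 𝓝[>] (0 : ℝ), γ t ∈ U) {t₁ : ℝ} (ht₁ : 0 < t₁)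
    (h₁ : γ t₁ ∉ U) :
    ∃ t₀ ∈ Ioc 0 t₁, γ t₀ ∉ U ∧ ∀ s ∈ Ioo 0 t₀, γ s ∈ U := by
  obtain ⟨η, hη, hηU⟩ := (mem_nhdsGT_iff_exists_Ioo_subset (a := (0 : ℝ))).1 h
  rw [mem_Ioi] at hη
  have hηt : η ≤ t₁ := by
    by_contra hcon
    exact h₁ (hηU ⟨ht₁, not_le.1 hcon⟩)
  have hS : IsCompact (Icc η t₁ ∩ γ ⁻¹' Uᶜ) :=
    isCompact_Icc.inter_right (hU.isClosed_compl.preimage hγ)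
  obtain ⟨t₀, ht₀⟩ := hS.exists_isLeast ⟨t₁, ⟨hηt, le_rfl⟩, h₁⟩
  refine ⟨t₀, ⟨hη.trans_le ht₀.1.1.1, ht₀.1.1.2⟩, ht₀.1.2, fun s hs => ?_⟩
  rcases lt_or_ge s η with h2 | h2
  · exact hηU ⟨hs.1, h2⟩
  · by_contra hcon
    exact absurd (ht₀.2 ⟨⟨h2, hs.2.le.trans ht₀.1.1.2⟩, hcon⟩) (not_le.2 hs.2)

/-- A trajectory cannot stay for all positive times in an open set with compact closure on which
some function increases along trajectories. -/
theorem exists_not_mem_of_monotone {M : Type*} [TopologicalSpace M] [T2Space M] {θ : ℝ → M → M}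
    (hθ : Continuous fun w : ℝ × M => θ w.1 w.2) (hadd : ∀ s t x, θ (s + t) x = θ s (θ t x))
    (h0 : ∀ x, θ 0 x = x) {F U : Set M} (hF : IsCompact F) (hU : IsOpen U) (hUF : U ⊆ F)
    {f : M → ℝ} (hf : ContinuousOn f U)
    (hmono : ∀ x s, 0 < s → (∀ t ∈ Icc 0 s, θ t x ∈ U) → f x < f (θ s x))
    (hleave : ∀ x ∈ F \ U, ∃ s, θ s x ∉ F \ U) (x : M) : ∃ t > 0, θ t x ∉ U := by
  by_contra! hcon
  have hev : ∀ᶠ t in atTop, θ t x ∈ F := by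
    filter_upwards [eventually_gt_atTop 0] with t ht using hUF (hcon t ht)
  obtain ⟨z, hzF, hz⟩ := hF.exists_mapClusterPt (le_principal_iff.2 (mem_map.2 hev))
  have hθs : ∀ s, Continuous (θ s) := fun s => hθ.comp (Continuous.prodMk_right s)
  have hinv : ∀ z s, MapClusterPt z atTop (fun t => θ t x) →
      MapClusterPt (θ s z) atTop (fun t => θ t x) := by
    intro z s hz
    have h1 := hz.continuousAt_comp (hθs s).continuousAt
    have h2 : (θ s ∘ fun t => θ t x) = (fun t => θ t x) ∘ fun t => s + t := by
      ext t
      exact (hadd s t x).symm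
    rw [h2] at h1
    exact h1.of_comp (tendsto_atTop_add_const_left _ s tendsto_id)
  -- The limit set is invariant and contained in `F`. A limit point outside `U` is moved by the flow
  -- off `F \ U`, so to a limit point in `U`.
  obtain ⟨z, hzU, hz⟩ : ∃ z ∈ U, MapClusterPt z atTop (fun t => θ t x) := by
    by_cases h : z ∈ U
    · exact ⟨z, h, hz⟩
    · obtain ⟨s, hs⟩ := hleave z ⟨hzF, h⟩
      have h2 := hinv z s hz
      have h3 : θ s z ∈ F := hF.isClosed.mem_of_mapClusterPt h2 hev
      exact ⟨_, not_not.1 fun h4 => hs ⟨h3, h4⟩, h2⟩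
  have hg : ∀ s t, 0 < s → s < t → f (θ s x) < f (θ t x) := by
    intro s t hs hst
    have h1 := hmono (θ s x) (t - s) (by linarith) (fun t' ht' => by
      rw [← hadd]; exact hcon _ (by linarith [ht'.1]))
    rwa [← hadd, sub_add_cancel] at h1
  have hle : ∀ z ∈ U, MapClusterPt z atTop (fun t => θ t x) → ∀ s > 0, f (θ s x) ≤ f z := by
    intro z hzU hz s hs
    have h1 := hz.continuousAt_comp (hf.continuousAt (hU.mem_nhds hzU))
    refine isClosed_Ici.mem_of_mapClusterPt h1 ?_
    filter_upwards [eventually_gt_atTop s] with t ht using (hg s t hs ht).le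
  have hge : ∀ z ∈ U, MapClusterPt z atTop (fun t => θ t x) → ∀ C, (∀ s > 0, f (θ s x) ≤ C) →
      f z ≤ C := by
    intro z hzU hz C hC
    have h1 := hz.continuousAt_comp (hf.continuousAt (hU.mem_nhds hzU))
    refine isClosed_Iic.mem_of_mapClusterPt h1 ?_
    filter_upwards [eventually_gt_atTop 0] with t ht using hC t ht
  have hc : Continuous fun t => θ t z := hθ.comp (Continuous.prodMk_left z)
  have hnear : ∀ᶠ t in 𝓝 (0 : ℝ), θ t z ∈ U :=
    hc.continuousAt.eventually_mem (hU.mem_nhds (by rwa [h0]))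
  obtain ⟨η, hη, hb⟩ := Metric.nhds_basis_closedBall.eventually_iff.1 hnear
  rw [Real.closedBall_eq_Icc, zero_sub, zero_add] at hb
  -- Along the orbit `f` increases to `f z`. The same limit is its value at the limit point `θ η z`,
  -- although `f` increases strictly from `z` to `θ η z`.
  have h1 := hmono z η hη (fun t ht => hb ⟨by linarith [ht.1], ht.2⟩)
  have h2 := hge _ (hb ⟨by linarith, le_rfl⟩) (hinv z η hz) (f z) (hle z hzU hz)
  linarith

/-- A compact set `F` whose boundary is made of an arc `A` of trajectory of `X`, on `[0, T]`, and an
arc `O` of trajectory of `W`, on `[0, L]`, that meet at their end points and at `A tb = O sb`; the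
interior carries coordinates `π`, which is constant along `X` and increases along `W`, and
`y`, which increases along `X`. -/
structure FigureEight {M : Type*} [TopologicalSpace M] [ChartedSpace Plane M]
    (X W : (x : M) → TangentSpace (𝓡 2) x) where
  F : Set M
  A : ℝ → M
  O : ℝ → M
  tb : ℝ
  T : ℝ
  sb : ℝ
  L : ℝ
  tb_pos : 0 < tb
  tb_lt : tb < T
  sb_pos : 0 < sb
  sb_lt : sb < L
  compact : IsCompact F
  velA : ∀ t, HasVelocity A t (X (A t))
  velO : ∀ s, HasVelocity O s (W (O s))
  injA : InjOn A (Icc 0 T)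
  injO : InjOn O (Icc 0 L)
  map_b : A tb = O sb
  map_a : A T = O 0
  map_c : A 0 = O L
  inter : ∀ t ∈ Icc 0 T, ∀ s ∈ Icc 0 L, A t = O s →
    t = 0 ∧ s = L ∨ t = tb ∧ s = sb ∨ t = T ∧ s = 0
  frontier_eq : frontier F = A '' Icc 0 T ∪ O '' Icc 0 L
  nonempty : (interior F).Nonempty
  box : ∀ e ∈ frontier F, Nonempty (TransverseBox X W e)
  π : M → ℝ
  y : M → ℝ
  π_cont : ContinuousOn π (interior F)
  y_cont : ContinuousOn y (interior F)
  πrate : M → ℝ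
  yrate : M → ℝ
  πrate_pos : ∀ x ∈ interior F, 0 < πrate x
  yrate_pos : ∀ x ∈ interior F, 0 < yrate x
  π_deriv : ∀ (γ : ℝ → M) (t ε : ℝ), γ t ∈ interior F →
    HasVelocity γ t (X (γ t) + ε • W (γ t)) → HasDerivAt (fun s => π (γ s)) (ε * πrate (γ t)) t
  y_deriv : ∀ (γ : ℝ → M) (t : ℝ), γ t ∈ interior F →
    HasVelocity γ t (X (γ t)) → HasDerivAt (fun s => y (γ s)) (yrate (γ t)) t

/-! ### The frontier of a figure eight in adapted coordinates. -/

section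

variable {M : Type*} [TopologicalSpace M] [ChartedSpace Plane M] [IsManifold (𝓡 2) ∞ M]
  {X W : (x : M) → TangentSpace (𝓡 2) x} {Z : ℝ → ℝ → M → M}

namespace IsFlowFamily

theorem velocity (hZ : IsFlowFamily X W Z) (ε : ℝ) (x : M) (t : ℝ) :
    HasVelocity (fun t => Z ε t x) t (X (Z ε t x) + ε • W (Z ε t x)) := hZ.curve ε x t

theorem continuous_time (hZ : IsFlowFamily X W Z) (ε : ℝ) (x : M) : Continuous fun t => Z ε t x :=
  hZ.cont.comp (by fun_prop : Continuous fun t : ℝ => ((ε, t, x) : ℝ × ℝ × M))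

theorem eq_of_velocity (hZ : IsFlowFamily X W Z) {γ : ℝ → M}
    (hγ : ∀ t, HasVelocity γ t (X (γ t))) (t : ℝ) : γ t = Z 0 t (γ 0) := by
  refine hZ.unique 0 γ (fun t => ?_) t
  have h := hγ t
  have h1 : X (γ t) + (0 : ℝ) • W (γ t) = X (γ t) := by simp
  change HasVelocity γ t (X (γ t) + (0 : ℝ) • W (γ t))
  rw [h1]
  exact h

theorem neg_apply (hZ : IsFlowFamily X W Z) (ε t : ℝ) (x : M) : Z ε (-t) (Z ε t x) = x := by
  rw [← hZ.add, neg_add_cancel, hZ.zero]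

end IsFlowFamily

namespace FigureEight

variable (E : FigureEight X W)

theorem velA' (t : ℝ) : HasVelocity E.A t ((1 : ℝ) • X (E.A t) + (0 : ℝ) • W (E.A t)) := by
  have h1 : (1 : ℝ) • X (E.A t) + (0 : ℝ) • W (E.A t) = X (E.A t) := by simp
  rw [h1]
  exact E.velA t

theorem velO' (t : ℝ) : HasVelocity E.O t ((0 : ℝ) • X (E.O t) + (1 : ℝ) • W (E.O t)) := by
  have h1 : (0 : ℝ) • X (E.O t) + (1 : ℝ) • W (E.O t) = W (E.O t) := by simp
  rw [h1]
  exact E.velO t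

theorem contA : Continuous E.A := continuous_iff_continuousAt.2 fun t => (E.velA t).continuousAt

theorem contO : Continuous E.O := continuous_iff_continuousAt.2 fun t => (E.velO t).continuousAt

theorem A_mem {t : ℝ} (ht : t ∈ Icc 0 E.T) : E.A t ∈ frontier E.F := by
  rw [E.frontier_eq]
  exact Or.inl ⟨t, ht, rfl⟩

theorem O_mem {s : ℝ} (hs : s ∈ Icc 0 E.L) : E.O s ∈ frontier E.F := by
  rw [E.frontier_eq]
  exact Or.inr ⟨s, hs, rfl⟩

theorem T_pos : 0 < E.T := E.tb_pos.trans E.tb_lt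

theorem L_pos : 0 < E.L := E.sb_pos.trans E.sb_lt

variable [T2Space M]

theorem isClosed : IsClosed E.F := E.compact.isClosed

theorem mem_frontier_iff {x : M} : x ∈ frontier E.F ↔ x ∈ E.F ∧ x ∉ interior E.F := by
  rw [E.isClosed.frontier_eq]
  exact Iff.rfl

/-- Boxes at a point of the orthogonal edge that is no corner. -/
theorem box_O {s : ℝ} (hs : s ∈ Ioo 0 E.L) (hsb : s ≠ E.sb) :
    ∃ B : TransverseBox X W (E.O s), ∀ x ∈ B.ψ.source, x ∈ frontier E.F ↔ (B.ψ x).2 = 0 := by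
  obtain ⟨B⟩ := E.box _ (E.O_mem (Ioo_subset_Icc_self hs))
  obtain ⟨κ₁, h1, h2, h3⟩ := B.exists_arc_iff E.velO' E.injO (Ioo_subset_Icc_self hs) rfl
  have hA : E.O s ∉ E.A '' Icc 0 E.T := by
    rintro ⟨t, ht, hts⟩
    rcases E.inter t ht s (Ioo_subset_Icc_self hs) hts with h | h | h
    · exact hs.2.ne h.2
    · exact hsb h.2
    · exact hs.1.ne' h.2
  obtain ⟨κ₂, h4, h5, h6⟩ :=
    B.exists_small ((isCompact_Icc.image E.contA).isClosed.isOpen_compl.mem_nhds hA)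
  refine ⟨B.shrink (min κ₁ κ₂) (lt_min h1 h4) ((min_le_left _ _).trans h2), fun x hx => ?_⟩
  rw [B.mem_shrink_source] at hx
  obtain ⟨hx, hu, hv⟩ := hx
  rw [B.shrink_apply, E.frontier_eq, mem_union,
    or_iff_right (h6 x hx (hu.trans_le (min_le_right _ _)) (hv.trans_le (min_le_right _ _))),
    h3 x hx (hu.trans_le (min_le_left _ _)) (hv.trans_le (min_le_left _ _))]
  exact ⟨fun h => h.1, fun h => ⟨h, fun h' => absurd h' hs.1.ne', fun h' => absurd h' hs.2.ne⟩⟩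

/-- Boxes at a point of the tangent edge that is no corner. -/
theorem box_A {t : ℝ} (ht : t ∈ Ioo 0 E.T) (htb : t ≠ E.tb) :
    ∃ B : TransverseBox X W (E.A t), ∀ x ∈ B.ψ.source, x ∈ frontier E.F ↔ (B.ψ x).1 = 0 := by
  obtain ⟨B⟩ := E.box _ (E.A_mem (Ioo_subset_Icc_self ht))
  obtain ⟨κ₁, h1, h2, h3⟩ := B.swap.exists_arc_iff
    (fun t => by rw [add_comm]; exact E.velA' t) E.injA (Ioo_subset_Icc_self ht) rfl
  have hO : E.A t ∉ E.O '' Icc 0 E.L := by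
    rintro ⟨s, hs, hts⟩
    rcases E.inter t (Ioo_subset_Icc_self ht) s hs hts.symm with h | h | h
    · exact ht.1.ne' h.1
    · exact htb h.1
    · exact ht.2.ne h.1
  obtain ⟨κ₂, h4, h5, h6⟩ :=
    B.exists_small ((isCompact_Icc.image E.contO).isClosed.isOpen_compl.mem_nhds hO)
  refine ⟨B.shrink (min κ₁ κ₂) (lt_min h1 h4) ((min_le_left _ _).trans h2), fun x hx => ?_⟩
  rw [B.mem_shrink_source] at hx
  obtain ⟨hx, hu, hv⟩ := hx
  rw [B.shrink_apply, E.frontier_eq, mem_union,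
    or_iff_left (h6 x hx (hu.trans_le (min_le_right _ _)) (hv.trans_le (min_le_right _ _))),
    h3 x hx (hv.trans_le (min_le_left _ _)) (hu.trans_le (min_le_left _ _)), B.swap_apply]
  exact ⟨fun h => h.1, fun h => ⟨h, fun h' => absurd h' ht.1.ne', fun h' => absurd h' ht.2.ne⟩⟩

/-- Both arcs pass through the point, one along each axis. An arc that begins or ends there
contributes half an axis only; at the vertex both axes occur in full. -/
theorem box_corner {t s : ℝ} (ht : t ∈ Icc 0 E.T) (hs : s ∈ Icc 0 E.L) (h : E.A t = E.O s) :
    ∃ B : TransverseBox X W (E.O s), ∀ x ∈ B.ψ.source, x ∈ frontier E.F ↔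
      ((B.ψ x).1 = 0 ∧ (t = 0 → 0 ≤ (B.ψ x).2) ∧ (t = E.T → (B.ψ x).2 ≤ 0)) ∨
      ((B.ψ x).2 = 0 ∧ (s = 0 → 0 ≤ (B.ψ x).1) ∧ (s = E.L → (B.ψ x).1 ≤ 0)) := by
  obtain ⟨B⟩ := E.box _ (E.O_mem hs)
  obtain ⟨κ₁, h1, h2, h3⟩ := B.exists_arc_iff E.velO' E.injO hs rfl
  obtain ⟨κ₂, h4, h5, h6⟩ := B.swap.exists_arc_iff
    (fun t => by rw [add_comm]; exact E.velA' t) E.injA ht h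
  refine ⟨B.shrink (min κ₁ κ₂) (lt_min h1 h4) ((min_le_left _ _).trans h2), fun x hx => ?_⟩
  rw [B.mem_shrink_source] at hx
  obtain ⟨hx, hu, hv⟩ := hx
  rw [B.shrink_apply, E.frontier_eq, mem_union,
    h6 x hx (hv.trans_le (min_le_right _ _)) (hu.trans_le (min_le_right _ _)),
    h3 x hx (hu.trans_le (min_le_left _ _)) (hv.trans_le (min_le_left _ _)), B.swap_apply]

theorem box_b : ∃ B : TransverseBox X W (E.O E.sb), ∀ x ∈ B.ψ.source,
    x ∈ frontier E.F ↔ (B.ψ x).1 = 0 ∨ (B.ψ x).2 = 0 := by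
  obtain ⟨B, hB⟩ := E.box_corner ⟨E.tb_pos.le, E.tb_lt.le⟩ ⟨E.sb_pos.le, E.sb_lt.le⟩ E.map_b
  refine ⟨B, fun x hx => ?_⟩
  rw [hB x hx]
  simp [E.tb_pos.ne', E.tb_lt.ne, E.sb_pos.ne', E.sb_lt.ne]

theorem box_a : ∃ B : TransverseBox X W (E.O 0), ∀ x ∈ B.ψ.source,
    x ∈ frontier E.F ↔ ((B.ψ x).1 = 0 ∧ (B.ψ x).2 ≤ 0) ∨ ((B.ψ x).2 = 0 ∧ 0 ≤ (B.ψ x).1) := by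
  obtain ⟨B, hB⟩ := E.box_corner ⟨E.T_pos.le, le_rfl⟩ ⟨le_rfl, E.L_pos.le⟩ E.map_a
  refine ⟨B, fun x hx => ?_⟩
  rw [hB x hx]
  simp [E.T_pos.ne', E.L_pos.ne]

theorem box_c : ∃ B : TransverseBox X W (E.O E.L), ∀ x ∈ B.ψ.source,
    x ∈ frontier E.F ↔ ((B.ψ x).1 = 0 ∧ 0 ≤ (B.ψ x).2) ∨ ((B.ψ x).2 = 0 ∧ (B.ψ x).1 ≤ 0) := by
  obtain ⟨B, hB⟩ := E.box_corner ⟨le_rfl, E.T_pos.le⟩ ⟨E.L_pos.le, le_rfl⟩ E.map_c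
  refine ⟨B, fun x hx => ?_⟩
  rw [hB x hx]
  simp [E.T_pos.ne, E.L_pos.ne']

end FigureEight
end

/-! ### Sides of the boundary arcs and the values of `π` above the orthogonal edge. -/

section

variable {M : Type*} [TopologicalSpace M] [ChartedSpace Plane M] [IsManifold (𝓡 2) ∞ M]
  {X W : (x : M) → TangentSpace (𝓡 2) x} {Z : ℝ → ℝ → M → M}

theorem TransverseBox.eventually_horizontal {e : M} (B : TransverseBox X W e) {γ : ℝ → M} {t₀ : ℝ}
    (hγ : ∀ t, HasVelocity γ t ((0 : ℝ) • X (γ t) + (1 : ℝ) • W (γ t))) (he : γ t₀ = e) :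
    ∀ᶠ t in 𝓝 t₀, γ t ∈ B.ψ.source ∧ (B.ψ (γ t)).2 = 0 ∧ (t₀ < t → 0 < (B.ψ (γ t)).1) ∧
      (t < t₀ → (B.ψ (γ t)).1 < 0) := by
  have h1 : ∀ᶠ t in 𝓝 t₀, γ t ∈ B.ψ.source :=
    (hγ t₀).continuousAt.eventually_mem (B.ψ.open_source.mem_nhds (he ▸ B.mem_source))
  have hψ0 : B.ψ (γ t₀) = (0, 0) := by rw [he, B.map_center]
  obtain ⟨η, hη, hb⟩ := Metric.eventually_nhds_iff_ball.1 h1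
  rw [Real.ball_eq_Ioo] at hb
  filter_upwards [Ioo_mem_nhds (show t₀ - η < t₀ by linarith) (show t₀ < t₀ + η by linarith)]
    with t ht
  refine ⟨hb t ht, ?_, fun h => ?_, fun h => ?_⟩
  · rcases le_total t₀ t with h | h
    · rw [B.snd_eq h (fun s _ => hγ s) (fun s hs => hb s ⟨by linarith [hs.1], by linarith [hs.2, ht.2]⟩),
        hψ0]
    · rw [← B.snd_eq h (fun s _ => hγ s)
        (fun s hs => hb s ⟨by linarith [hs.1, ht.1], by linarith [hs.2]⟩), hψ0]
  · have := B.fst_lt h (fun s _ => hγ s)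
      (fun s hs => hb s ⟨by linarith [hs.1], by linarith [hs.2, ht.2]⟩) one_pos
    rwa [hψ0] at this
  · have := B.fst_lt h (fun s _ => hγ s)
      (fun s hs => hb s ⟨by linarith [hs.1, ht.1], by linarith [hs.2]⟩) one_pos
    rwa [hψ0] at this

theorem TransverseBox.eventually_vertical {e : M} (B : TransverseBox X W e) {γ : ℝ → M} {t₀ : ℝ}
    (hγ : ∀ t, HasVelocity γ t ((1 : ℝ) • X (γ t) + (0 : ℝ) • W (γ t))) (he : γ t₀ = e) :
    ∀ᶠ t in 𝓝 t₀, γ t ∈ B.ψ.source ∧ (B.ψ (γ t)).1 = 0 ∧ (t₀ < t → 0 < (B.ψ (γ t)).2) ∧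
      (t < t₀ → (B.ψ (γ t)).2 < 0) :=
  B.swap.eventually_horizontal (fun t => by rw [add_comm]; exact hγ t) he

/-- Tube lemma: the time interval is compact and the flow is jointly continuous. -/
theorem IsFlowFamily.eventually_forall_mem (hZ : IsFlowFamily X W Z) {a b : ℝ} {N : Set M}
    (hN : IsOpen N) {ε₀ : ℝ} {x₀ : M} (h : ∀ t ∈ Icc a b, Z ε₀ t x₀ ∈ N) :
    ∀ᶠ q : ℝ × M in 𝓝 (ε₀, x₀), ∀ t ∈ Icc a b, Z q.1 t q.2 ∈ N := by
  refine isCompact_Icc.eventually_forall_of_forall_eventually fun t ht => ?_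
  have hc : Continuous fun w : (ℝ × M) × ℝ => Z w.1.1 w.2 w.1.2 :=
    hZ.cont.comp (by fun_prop : Continuous fun w : (ℝ × M) × ℝ => (w.1.1, w.2, w.1.2))
  exact hc.continuousAt.eventually_mem (hN.mem_nhds (h t ht))

theorem IsFlowFamily.vel_smul (hZ : IsFlowFamily X W Z) (ε : ℝ) (x : M) (t : ℝ) :
    HasVelocity (fun t => Z ε t x) t ((1 : ℝ) • X (Z ε t x) + ε • W (Z ε t x)) := by
  rw [one_smul]
  exact hZ.velocity ε x t

namespace FigureEight

variable (E : FigureEight X W)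

theorem π_eq (hZ : IsFlowFamily X W Z) {x : M} {a b : ℝ} (hab : a ≤ b)
    (h : ∀ t ∈ Icc a b, Z 0 t x ∈ interior E.F) : E.π (Z 0 b x) = E.π (Z 0 a x) := by
  have hd : ∀ t ∈ Icc a b, HasDerivAt (fun s => E.π (Z 0 s x)) 0 t := fun t ht =>
    (E.π_deriv _ t 0 (h t ht) (hZ.velocity 0 x t)).congr_deriv (zero_mul _)
  refine le_antisymm ?_ (le_of_hasDerivAt_nonneg hab hd fun _ _ => le_rfl)
  have := le_of_hasDerivAt_nonneg (f' := fun _ => -0) hab (fun t ht => (hd t ht).neg)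
    fun _ _ => by simp
  exact neg_le_neg_iff.1 this

theorem π_lt (hZ : IsFlowFamily X W Z) {x : M} {ε a b : ℝ} (hε : 0 < ε) (hab : a < b)
    (h : ∀ t ∈ Icc a b, Z ε t x ∈ interior E.F) : E.π (Z ε a x) < E.π (Z ε b x) :=
  lt_of_hasDerivAt_pos hab (fun t ht => E.π_deriv _ t ε (h t ht) (hZ.velocity ε x t))
    fun t ht => mul_pos hε (E.πrate_pos _ (h t ht))

theorem y_lt (hZ : IsFlowFamily X W Z) {x : M} {a b : ℝ} (hab : a < b)
    (h : ∀ t ∈ Icc a b, Z 0 t x ∈ interior E.F) : E.y (Z 0 a x) < E.y (Z 0 b x) := by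
  refine lt_of_hasDerivAt_pos hab (fun t ht => E.y_deriv (fun s => Z 0 s x) t (h t ht) ?_)
    fun t ht => E.yrate_pos _ (h t ht)
  have h2 := hZ.velocity 0 x t
  rw [zero_smul, add_zero] at h2
  exact h2

theorem A_eq (hZ : IsFlowFamily X W Z) (s t : ℝ) : E.A (s + t) = Z 0 s (E.A t) := by
  rw [hZ.eq_of_velocity E.velA, hZ.eq_of_velocity E.velA t, hZ.add]

/-- Under the hypothesis each point of `N` is in `F` or is a limit of points of the closed set `F`.
Then `N` would lie in `F`, which is impossible around a frontier point. -/
theorem not_dense [T2Space M] (hZ : IsFlowFamily X W Z) {e : M} (he : e ∈ frontier E.F) {N : Set M}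
    (hN : N ∈ 𝓝 e) {ε : ℝ} (h : ∀ x ∈ N, x ∈ E.F ∨ ∀ᶠ t in 𝓝[>] (0 : ℝ), Z ε t x ∈ E.F) : False := by
  refine (E.mem_frontier_iff.1 he).2 (mem_interior_iff_mem_nhds.2 (mem_of_superset hN fun x hx => ?_))
  rcases h x hx with h | h
  · exact h
  · have h1 : Tendsto (fun t => Z ε t x) (𝓝[>] 0) (𝓝 (Z ε 0 x)) :=
      ((hZ.continuous_time ε x).tendsto 0).mono_left nhdsWithin_le_nhds
    rw [hZ.zero] at h1
    exact E.isClosed.mem_of_tendsto h1 h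

/-- The flow of `X` moves the points of the horizontal axis into the upper half of the box, so with
both halves in the interior the whole box would lie in `F`. -/
theorem not_both_sides_O [T2Space M] (hZ : IsFlowFamily X W Z) {s : ℝ} (hs : s ∈ Icc 0 E.L)
    (B : TransverseBox X W (E.O s)) (h1 : ∀ x ∈ B.ψ.source, 0 < (B.ψ x).2 → x ∈ interior E.F)
    (h2 : ∀ x ∈ B.ψ.source, (B.ψ x).2 < 0 → x ∈ interior E.F) : False := by
  refine E.not_dense hZ (E.O_mem hs) (B.ψ.open_source.mem_nhds B.mem_source) (ε := 0)
    fun x hx => ?_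
  rcases lt_trichotomy (B.ψ x).2 0 with h | h | h
  · exact Or.inl (interior_subset (h2 x hx h))
  · right
    have h3 := B.eventually_cone (t₀ := 0) (hZ.velocity 0 x) (by rwa [hZ.zero])
    filter_upwards [h3] with t ht
    refine interior_subset (h1 _ ht.1 ?_)
    have := ht.2.1
    rwa [hZ.zero, h] at this
  · exact Or.inl (interior_subset (h1 x hx h))

/-- Here the axis is tangent to `X`, so `X + W` is used to move off it. -/
theorem not_both_sides_A [T2Space M] (hZ : IsFlowFamily X W Z) {t : ℝ} (ht : t ∈ Icc 0 E.T)
    (B : TransverseBox X W (E.A t)) (h1 : ∀ x ∈ B.ψ.source, 0 < (B.ψ x).1 → x ∈ interior E.F)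
    (h2 : ∀ x ∈ B.ψ.source, (B.ψ x).1 < 0 → x ∈ interior E.F) : False := by
  refine E.not_dense hZ (E.A_mem ht) (B.ψ.open_source.mem_nhds B.mem_source) (ε := 1)
    fun x hx => ?_
  rcases lt_trichotomy (B.ψ x).1 0 with h | h | h
  · exact Or.inl (interior_subset (h2 x hx h))
  · right
    have h3 := B.eventually_cone (t₀ := 0) (hZ.velocity 1 x) (by rwa [hZ.zero])
    filter_upwards [h3] with t ht
    refine interior_subset (h1 _ ht.1 ?_)
    have := ht.2.2.2 one_pos
    rwa [hZ.zero, h] at this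
  · exact Or.inl (interior_subset (h1 x hx h))

/-- If a curve starts into a convex part of a box missing the frontier, then this part is in the
interior iff the curve starts into the interior. -/
theorem into_iff {e : M} (B : TransverseBox X W e) {F : Set M} {C : Set (ℝ × ℝ)} (hC : Convex ℝ C)
    (hmiss : ∀ x ∈ B.ψ.source, B.ψ x ∈ C → x ∉ frontier F) {γ : ℝ → M} {l : Filter ℝ} [l.NeBot]
    (h : ∀ᶠ t in l, γ t ∈ B.ψ.source ∧ B.ψ (γ t) ∈ C) :
    (∀ᶠ t in l, γ t ∈ interior F) ↔ ∀ x ∈ B.ψ.source, B.ψ x ∈ C → x ∈ interior F := by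
  refine ⟨fun h1 => ?_, fun h1 => h.mono fun t ht => h1 _ ht.1 ht.2⟩
  rcases B.side hC hmiss with h2 | h2
  · exact h2
  · obtain ⟨t, ht, ht'⟩ := (h1.and h).exists
    exact absurd (interior_subset ht) (h2 _ ht'.1 ht'.2)

theorem convex_snd_pos : Convex ℝ {z : ℝ × ℝ | 0 < z.2} :=
  (convex_Ioi (0 : ℝ)).linear_preimage (LinearMap.snd ℝ ℝ ℝ)

theorem convex_snd_neg : Convex ℝ {z : ℝ × ℝ | z.2 < 0} :=
  (convex_Iio (0 : ℝ)).linear_preimage (LinearMap.snd ℝ ℝ ℝ)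

theorem convex_fst_pos : Convex ℝ {z : ℝ × ℝ | 0 < z.1} :=
  (convex_Ioi (0 : ℝ)).linear_preimage (LinearMap.fst ℝ ℝ ℝ)

theorem convex_fst_neg : Convex ℝ {z : ℝ × ℝ | z.1 < 0} :=
  (convex_Iio (0 : ℝ)).linear_preimage (LinearMap.fst ℝ ℝ ℝ)

/-- The trajectory of `X` starts from `x` into the interior. -/
def Up (Z : ℝ → ℝ → M → M) (x : M) : Prop := ∀ᶠ t in 𝓝[>] (0 : ℝ), Z 0 t x ∈ interior E.F

/-- The upper half of the box is connected and misses the frontier, so one trajectory entering it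
decides for all of it. -/
theorem up_iff (hZ : IsFlowFamily X W Z) {e : M} (B : TransverseBox X W e)
    (hB : ∀ x ∈ B.ψ.source, 0 < (B.ψ x).2 → x ∉ frontier E.F) {w : M} (hw : w ∈ B.ψ.source)
    (hw0 : (B.ψ w).2 = 0) :
    E.Up Z w ↔ ∀ x ∈ B.ψ.source, 0 < (B.ψ x).2 → x ∈ interior E.F := by
  refine into_iff B convex_snd_pos hB ?_
  filter_upwards [B.eventually_cone (t₀ := 0) (hZ.velocity 0 w) (by rwa [hZ.zero])] with t ht
  have := ht.2.1
  rw [hZ.zero, hw0] at this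
  exact ⟨ht.1, this⟩

variable [T2Space M]

theorem mem_frontier_of_exit {γ : ℝ → M} (hγ : Continuous γ) {a t₀ : ℝ} (ht₀ : a < t₀)
    (h : ∀ t ∈ Ioo a t₀, γ t ∈ interior E.F) (h' : γ t₀ ∉ interior E.F) : γ t₀ ∈ frontier E.F := by
  refine E.mem_frontier_iff.2 ⟨E.isClosed.mem_of_tendsto
    ((hγ.tendsto t₀).mono_left (nhdsWithin_le_nhds (s := Iio t₀))) ?_, h'⟩
  filter_upwards [Ioo_mem_nhdsLT ht₀] with t ht using interior_subset (h t ht)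

theorem exists_box_up {s : ℝ} (hs : s ∈ Ico 0 E.L) (hsb : s ≠ E.sb) :
    ∃ B : TransverseBox X W (E.O s), ∀ x ∈ B.ψ.source, 0 < (B.ψ x).2 → x ∉ frontier E.F := by
  rcases hs.1.eq_or_lt with h | h
  · subst h
    obtain ⟨B, hB⟩ := E.box_a
    refine ⟨B, fun x hx h1 h2 => ?_⟩
    rcases (hB x hx).1 h2 with h3 | h3
    · exact absurd h1 (not_lt.2 h3.2)
    · exact h1.ne' h3.1
  · obtain ⟨B, hB⟩ := E.box_O ⟨h, hs.2⟩ hsb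
    exact ⟨B, fun x hx h1 h2 => h1.ne' ((hB x hx).1 h2)⟩

/-- Within one box the answer is the same at all points of the edge; it is thus locally constant on
a connected set of parameters. -/
theorem up_congr (hZ : IsFlowFamily X W Z) {I : Set ℝ} (hI : IsPreconnected I)
    (hIL : I ⊆ Ico 0 E.L) (hIb : E.sb ∉ I) {s s' : ℝ} (hs : s ∈ I) (hs' : s' ∈ I) :
    E.Up Z (E.O s) ↔ E.Up Z (E.O s') := by
  refine hI.induction₂' (fun s s' => E.Up Z (E.O s) ↔ E.Up Z (E.O s')) (fun s hs => ?_)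
    (fun _ _ _ _ _ _ h h' => h.trans h') hs hs'
  obtain ⟨B, hB⟩ := E.exists_box_up (hIL hs) (fun h => hIb (h ▸ hs))
  have h1 := B.eventually_horizontal E.velO' rfl
  have h2 := E.up_iff hZ B hB B.mem_source (by rw [B.map_center])
  filter_upwards [h1.filter_mono nhdsWithin_le_nhds] with s' hs'
  have h3 := E.up_iff hZ B hB hs'.1 hs'.2.1
  exact ⟨h2.trans h3.symm, h3.trans h2.symm⟩

/-- Along the trajectory of `X` starting from `w` the value of `π` just above `w` is `l`. -/
def Level (Z : ℝ → ℝ → M → M) (w : M) (l : ℝ) : Prop :=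
  ∀ᶠ t in 𝓝[>] (0 : ℝ), E.π (Z 0 t w) = l

theorem Level.unique {E : FigureEight X W} {w : M} {l l' : ℝ} (h : E.Level Z w l)
    (h' : E.Level Z w l') : l = l' := by
  obtain ⟨t, ht, ht'⟩ := (h.and h').exists
  exact ht.symm.trans ht'

theorem level_of_forall_mem (hZ : IsFlowFamily X W Z) {w : M} {t : ℝ} (ht : 0 < t)
    (h : ∀ s ∈ Ioc 0 t, Z 0 s w ∈ interior E.F) : E.Level Z w (E.π (Z 0 t w)) := by
  filter_upwards [Ioc_mem_nhdsGT ht] with s hs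
  exact (E.π_eq hZ hs.2 fun s' hs' => h s' ⟨hs.1.trans_le hs'.1, hs'.2⟩).symm

theorem Up.exists_level {E : FigureEight X W} (hZ : IsFlowFamily X W Z) {w : M} (h : E.Up Z w) :
    ∃ l, E.Level Z w l := by
  obtain ⟨η, hη, hηU⟩ := (mem_nhdsGT_iff_exists_Ioc_subset (a := (0 : ℝ))).1 h
  exact ⟨_, E.level_of_forall_mem hZ hη fun s hs => hηU hs⟩

/-- The vertical segment from `w` to `x` is run through by a trajectory of `X` that stays in the
interior, and `π` is constant along it. -/
theorem level_of_box (hZ : IsFlowFamily X W Z) {e : M} (B : TransverseBox X W e)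
    (hB : ∀ x ∈ B.ψ.source, 0 < (B.ψ x).2 → x ∈ interior E.F) {w x : M} (hw : w ∈ B.ψ.source)
    (hw0 : (B.ψ w).2 = 0) (hx : x ∈ B.ψ.source) (hx0 : 0 < (B.ψ x).2)
    (hxw : (B.ψ x).1 = (B.ψ w).1) : E.Level Z w (E.π x) := by
  have hv : ∀ t, HasVelocity (fun t => Z 0 t w) t ((0 : ℝ) • W (Z 0 t w) + (1 : ℝ) • X (Z 0 t w)) :=
    fun t => by rw [add_comm]; exact hZ.vel_smul 0 w t
  obtain ⟨t, ht, hts, hte⟩ := B.swap.reach (u₁ := (B.ψ x).2) hv (by rwa [hZ.zero]) le_rfl one_pos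
    (by rw [hZ.zero, B.swap_apply, hw0]; exact hx0) (abs_lt.1 (B.abs_lt_of_mem hx).2).2
    (by
      rw [hZ.zero, B.swap_apply]
      have : (B.ψ w).1 < B.swap.κ := (abs_lt.1 (B.abs_lt_of_mem hw).1).2
      simpa using this)
  have h2 : (B.ψ (Z 0 t w)).1 = (B.ψ w).1 := by
    have := B.fst_eq ht.le (fun s _ => hZ.vel_smul 0 w s) hts
    rwa [hZ.zero] at this
  have h3 : Z 0 t w = x :=
    B.ψ.injOn (hts t ⟨ht.le, le_rfl⟩) hx (Prod.ext (h2.trans hxw.symm) hte)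
  rw [← h3]
  refine E.level_of_forall_mem hZ ht fun s hs => hB _ (hts s ⟨hs.1.le, hs.2⟩) ?_
  have := B.snd_lt hs.1 (fun s _ => hZ.vel_smul 0 w s)
    (fun s' hs' => hts s' ⟨hs'.1, hs'.2.trans hs.2⟩) one_pos
  rwa [hZ.zero, hw0] at this

end FigureEight
end

/-! ### The interior is not above the orthogonal edge between `a` and `b`. -/

section

variable {M : Type*} [TopologicalSpace M] [ChartedSpace Plane M] [IsManifold (𝓡 2) ∞ M]
  {X W : (x : M) → TangentSpace (𝓡 2) x} {Z : ℝ → ℝ → M → M}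

namespace FigureEight

variable (E : FigureEight X W) [T2Space M]

/-- From a point just above `O s` the flow of `X + W` moves to the right while `π` increases
strictly. The point reached is above some `O s'` with `s' < sb`, so no level is the greatest. -/
theorem exists_level_lt (hZ : IsFlowFamily X W Z) {s : ℝ} (hs : s ∈ Ico 0 E.sb)
    (hup : E.Up Z (E.O s)) {l : ℝ} (hl : E.Level Z (E.O s) l) :
    ∃ s' ∈ Ico 0 E.sb, ∃ l', l < l' ∧ E.Level Z (E.O s') l' := by
  obtain ⟨B, hB⟩ := E.exists_box_up ⟨hs.1, hs.2.trans E.sb_lt⟩ hs.2.ne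
  have hBU := (E.up_iff hZ B hB B.mem_source (by rw [B.map_center])).1 hup
  -- a point just above `O s`
  have hcone := B.eventually_cone (t₀ := 0) (hZ.velocity 0 (E.O s)) (by rw [hZ.zero]; exact B.mem_source)
  obtain ⟨t₀, ht₀, hlt⟩ := (hcone.and hl).exists
  rw [hZ.zero, B.map_center] at ht₀
  set x₀ := Z 0 t₀ (E.O s) with hx₀
  obtain ⟨hx₀s, hx₀v, hx₀u, -⟩ := ht₀
  replace hx₀u : (B.ψ x₀).1 = 0 := hx₀u rfl
  replace hx₀v : 0 < (B.ψ x₀).2 := hx₀v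
  -- a point of the orthogonal edge further to the right
  have hhor := B.eventually_horizontal E.velO' rfl
  obtain ⟨η, hη, hηb⟩ := Metric.nhds_basis_closedBall.eventually_iff.1 hhor
  rw [Real.closedBall_eq_Icc] at hηb
  obtain ⟨s₂, hs₂, hs₂'⟩ : ∃ s₂, s < s₂ ∧ s₂ < min E.sb (s + η) :=
    exists_between (lt_min hs.2 (by linarith))
  have hs₂b := hs₂'.trans_le (min_le_left _ _)
  have hs₂η := hs₂'.trans_le (min_le_right _ _)
  have hIcc : ∀ s' ∈ Icc s s₂, s' ∈ Icc (s - η) (s + η) := fun s' hs' =>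
    ⟨by linarith [hs'.1], by linarith [hs'.2]⟩
  have hu₂ : 0 < (B.ψ (E.O s₂)).1 := (hηb (hIcc s₂ ⟨hs₂.le, le_rfl⟩)).2.2.1 hs₂
  -- move to the right from `x₀`
  have hcone1 := B.eventually_cone (t₀ := 0) (hZ.velocity 1 x₀) (by rw [hZ.zero]; exact hx₀s)
  have hsmall : ∀ᶠ t in 𝓝[>] (0 : ℝ), (B.ψ (Z 1 t x₀)).1 < (B.ψ (E.O s₂)).1 := by
    have h1 := (B.hasDerivAt (fun t => Z 1 t x₀) 0 1 1 (by simp only [hZ.zero]; exact hx₀s)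
      (hZ.vel_smul 1 x₀ 0)).1.continuousAt
    refine (h1.eventually_lt_const ?_).filter_mono nhdsWithin_le_nhds
    simpa only [hZ.zero, hx₀u] using hu₂
  obtain ⟨t₁, ht₁, hall⟩ :=
    (mem_nhdsGT_iff_exists_Ioc_subset (a := (0 : ℝ))).1 (hcone1.and hsmall)
  rw [mem_Ioi] at ht₁
  set x₁ := Z 1 t₁ x₀ with hx₁
  have hx₁all := hall ⟨ht₁, le_rfl⟩
  have hmem : ∀ t ∈ Icc 0 t₁, Z 1 t x₀ ∈ interior E.F := by
    intro t ht
    rcases ht.1.eq_or_lt with h | h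
    · rw [← h, hZ.zero]
      exact hBU _ hx₀s hx₀v
    · have h3 := hall ⟨h, ht.2⟩
      refine hBU _ h3.1.1 ?_
      have h4 := h3.1.2.1
      rw [hZ.zero] at h4
      exact hx₀v.trans h4
  have hπ := E.π_lt hZ one_pos ht₁ hmem
  rw [hZ.zero] at hπ
  have hu₁ : 0 < (B.ψ x₁).1 := by
    have h4 := hx₁all.1.2.2.2 one_pos
    rwa [hZ.zero, hx₀u] at h4
  have hv₁ : 0 < (B.ψ x₁).2 := by
    have h4 := hx₁all.1.2.1
    rw [hZ.zero] at h4
    exact hx₀v.trans h4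
  obtain ⟨s', hs', hs'e⟩ := intermediate_value_Icc hs₂.le (f := fun s => (B.ψ (E.O s)).1)
    (fun s' hs' => ((B.hasDerivAt E.O s' 0 1 (hηb (hIcc s' hs')).1 (E.velO' s')).1
      ).continuousAt.continuousWithinAt)
    (show (B.ψ x₁).1 ∈ Icc _ _ from ⟨by rw [B.map_center]; exact hu₁.le, hx₁all.2.le⟩)
  have hs'' := hηb (hIcc s' hs')
  refine ⟨s', ⟨hs.1.trans hs'.1, hs'.2.trans_lt hs₂b⟩, E.π x₁, ?_,
    E.level_of_box hZ B hBU hs''.1 hs''.2.1 hx₁all.1.1 hv₁ hs'e.symm⟩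
  rw [← hlt]
  exact hπ

/-- Near `s` the level can be read at the fixed height `κ / 2` of a box, where it is `π` composed
with continuous maps. -/
theorem continuousWithinAt_level (hZ : IsFlowFamily X W Z) {lam : ℝ → ℝ}
    (hup : ∀ s ∈ Ico 0 E.sb, E.Up Z (E.O s))
    (hlam : ∀ s ∈ Ico 0 E.sb, E.Level Z (E.O s) (lam s)) :
    ContinuousOn lam (Ico 0 E.sb) := by
  intro s hs
  obtain ⟨B, hB⟩ := E.exists_box_up ⟨hs.1, hs.2.trans E.sb_lt⟩ hs.2.ne
  have hBU := (E.up_iff hZ B hB B.mem_source (by rw [B.map_center])).1 (hup s hs)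
  have hhor := B.eventually_horizontal E.velO' rfl
  have hκ := B.κ_pos
  have htar : ∀ s', E.O s' ∈ B.ψ.source → ((B.ψ (E.O s')).1, B.κ / 2) ∈ B.ψ.target := by
    intro s' hs'
    rw [B.mem_target_iff]
    refine ⟨(B.abs_lt_of_mem hs').1, ?_⟩
    simp only
    rw [abs_of_pos (by linarith)]
    linarith
  have hev : ∀ᶠ s' in 𝓝[Ico 0 E.sb] s,
      lam s' = E.π (B.ψ.symm ((B.ψ (E.O s')).1, B.κ / 2)) := by
    filter_upwards [hhor.filter_mono nhdsWithin_le_nhds, self_mem_nhdsWithin] with s' h1 h2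
    have h3 := htar s' h1.1
    refine (hlam s' h2).unique (E.level_of_box hZ B hBU h1.1 h1.2.1 (B.ψ.map_target h3) ?_ ?_)
    · rw [B.ψ.right_inv h3]
      exact half_pos hκ
    · rw [B.ψ.right_inv h3]
  have hs0 := hhor.self_of_nhds.1
  have h4 := htar s hs0
  have hmem : B.ψ.symm ((B.ψ (E.O s)).1, B.κ / 2) ∈ interior E.F := by
    refine hBU _ (B.ψ.map_target h4) ?_
    rw [B.ψ.right_inv h4]
    exact half_pos hκ
  have hcont : ContinuousAt (fun s' => E.π (B.ψ.symm ((B.ψ (E.O s')).1, B.κ / 2))) s := by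
    refine (E.π_cont.continuousAt (isOpen_interior.mem_nhds hmem)).comp_of_eq ?_ rfl
    refine (B.ψ.continuousAt_symm h4).comp_of_eq ?_ rfl
    exact (B.hasDerivAt E.O s 0 1 hs0 (E.velO' s)).1.continuousAt.prodMk continuousAt_const
  exact hcont.continuousWithinAt.congr_of_eventuallyEq hev (hev.self_of_nhdsWithin hs)

/-- The trajectory of `X` from `b` follows the tangent edge to `a` and then, since the interior is
above `a`, enters it. For `s` just below `sb` the trajectory of `O s` runs alongside and stays in
the interior, so its level is read at the end, close to the trajectory of `a`. -/
theorem level_tendsto (hZ : IsFlowFamily X W Z) {lam : ℝ → ℝ}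
    (hup : ∀ s ∈ Ico 0 E.sb, E.Up Z (E.O s))
    (hlam : ∀ s ∈ Ico 0 E.sb, E.Level Z (E.O s) (lam s)) :
    Tendsto lam (𝓝[<] E.sb) (𝓝 (lam 0)) := by
  have h0 : (0 : ℝ) ∈ Ico 0 E.sb := ⟨le_rfl, E.sb_pos⟩
  obtain ⟨η', hη', hη'U⟩ := (mem_nhdsGT_iff_exists_Ioc_subset (a := (0 : ℝ))).1
    ((hup 0 h0).and (hlam 0 h0))
  rw [mem_Ioi] at hη'
  set τ := E.T - E.tb with hτ
  have hτ0 : 0 < τ := sub_pos.2 E.tb_lt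
  have hz1 : ∀ t, Z 0 t (E.O E.sb) = E.A (t + E.tb) := fun t => by rw [E.A_eq hZ, E.map_b]
  have hz2 : ∀ t, Z 0 (t + τ) (E.O E.sb) = Z 0 t (E.O 0) := fun t => by
    rw [hZ.add, hz1, hτ, sub_add_cancel, E.map_a]
  obtain ⟨B, hB⟩ := E.box_b
  -- stay in the box at the vertex for a short time
  have hst : ∀ᶠ t in 𝓝 (0 : ℝ), Z 0 t (E.O E.sb) ∈ B.ψ.source :=
    (hZ.continuous_time 0 _).continuousAt.eventually_mem
      (B.ψ.open_source.mem_nhds (by rw [hZ.zero]; exact B.mem_source))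
  obtain ⟨η₁, hη₁, hη₁b⟩ := Metric.nhds_basis_closedBall.eventually_iff.1 hst
  rw [Real.closedBall_eq_Icc, zero_sub, zero_add] at hη₁b
  obtain ⟨η, hη, hηη₁⟩ : ∃ η > 0, η < η₁ := exists_between hη₁
  have hηb : ∀ t ∈ Icc 0 η, Z 0 t (E.O E.sb) ∈ B.ψ.source := fun t ht =>
    hη₁b ⟨by linarith [ht.1], by linarith [ht.2]⟩
  have hK : IsClosed (E.O '' Icc E.sb E.L) := (isCompact_Icc.image E.contO).isClosed
  -- After leaving `b`, the limiting trajectory is on the tangent edge up to `a` and then in the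
  -- interior, so it keeps away from the part of the orthogonal edge from `b` to `c`. By compactness
  -- nearby trajectories do too.
  have hzK : ∀ t ∈ Icc η (η' + τ), Z 0 t (E.O E.sb) ∈ (E.O '' Icc E.sb E.L)ᶜ := by
    rintro t ht ⟨s, hs, hst⟩
    have hs' : s ∈ Icc 0 E.L := ⟨E.sb_pos.le.trans hs.1, hs.2⟩
    rcases le_or_gt t τ with h | h
    · rw [hz1] at hst
      rcases E.inter (t + E.tb) ⟨by linarith [ht.1, E.tb_pos], by linarith⟩ s hs' hst.symm
        with h1 | h1 | h1
      · linarith [ht.1, E.tb_pos]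
      · linarith [ht.1]
      · linarith [hs.1, E.sb_pos]
    · have h1 := (hη'U (show t - τ ∈ Ioc 0 η' from ⟨by linarith, by linarith [ht.2]⟩)).1
      rw [← hz2, sub_add_cancel, ← hst] at h1
      exact (E.mem_frontier_iff.1 (E.O_mem hs')).2 h1
  have hcO : Tendsto (fun s => ((0 : ℝ), E.O s)) (𝓝 E.sb) (𝓝 (0, E.O E.sb)) :=
    (continuous_const.prodMk E.contO).continuousAt
  have hev : ∀ᶠ s in 𝓝[<] E.sb, lam s = E.π (Z 0 (η' + τ) (E.O s)) := by
    filter_upwards [(hcO.eventually (hZ.eventually_forall_mem B.ψ.open_source hηb)).filter_mono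
        nhdsWithin_le_nhds,
      (hcO.eventually (hZ.eventually_forall_mem hK.isOpen_compl hzK)).filter_mono
        nhdsWithin_le_nhds,
      (B.eventually_horizontal E.velO' rfl).filter_mono nhdsWithin_le_nhds,
      Ioo_mem_nhdsLT E.sb_pos] with s h1 h2 h3 hs
    have hs0 : s ∈ Ico 0 E.sb := ⟨hs.1.le, hs.2⟩
    refine (hlam s hs0).unique (E.level_of_forall_mem hZ (by linarith) fun t₁ ht₁ => ?_)
    by_contra hcon
    obtain ⟨t₀, ht₀, hex, hin⟩ := exists_first_exit (hZ.continuous_time 0 (E.O s)) isOpen_interior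
      (hup s hs0) ht₁.1 hcon
    set e := Z 0 t₀ (E.O s) with he
    have hefr : e ∈ frontier E.F :=
      E.mem_frontier_of_exit (hZ.continuous_time 0 (E.O s)) ht₀.1 hin hex
    -- While still in the box at `b`, the trajectory is in the open upper left quadrant, which
    -- contains no frontier point.
    have hηt₀ : η ≤ t₀ := by
      by_contra hlt
      rw [not_le] at hlt
      have h6 := h1 t₀ ⟨ht₀.1.le, hlt.le⟩
      have hsub : ∀ s' ∈ Icc 0 t₀, Z 0 s' (E.O s) ∈ B.ψ.source := fun s' hs' =>
        h1 s' ⟨hs'.1, hs'.2.trans hlt.le⟩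
      have h7 := B.snd_lt ht₀.1 (fun s' _ => hZ.vel_smul 0 (E.O s) s') hsub one_pos
      have h8 := B.fst_eq ht₀.1.le (fun s' _ => hZ.vel_smul 0 (E.O s) s') hsub
      rw [hZ.zero, h3.2.1] at h7
      rw [hZ.zero] at h8
      rcases (hB _ h6).1 hefr with h9 | h9
      · rw [h8] at h9
        exact (h3.2.2.2 hs.2).ne h9
      · exact h7.ne' h9
    have heK := h2 t₀ ⟨hηt₀, ht₀.2.trans ht₁.2⟩
    -- Following the tangent edge backwards from `e` would either lead to `O s`, which is not on it,
    -- or meet `c` at some time in `(0, t₀]`.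
    have heA : e ∉ E.A '' Icc 0 E.T := by
      rintro ⟨t', ht', hte⟩
      have h9 : E.A (t' - t₀) = E.O s := by
        rw [sub_eq_neg_add, E.A_eq hZ, hte, he, hZ.neg_apply]
      rcases le_or_gt t₀ t' with h10 | h10
      · rcases E.inter (t' - t₀) ⟨by linarith, by linarith [ht'.2, ht₀.1]⟩ s
          ⟨hs.1.le, hs.2.le.trans E.sb_lt.le⟩ h9 with h11 | h11 | h11
        · linarith [hs.2, E.sb_lt]
        · linarith [hs.2]
        · linarith [hs.1]
      · have h11 : Z 0 (t₀ - t') (E.O s) = E.A 0 := by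
          rw [← h9, ← E.A_eq hZ]
          congr 1
          ring
        rcases ht'.1.eq_or_lt with h12 | h12
        · refine heK ⟨E.L, ⟨E.sb_lt.le, le_rfl⟩, ?_⟩
          rw [← E.map_c]
          rw [← h12, sub_zero] at h11
          exact h11.symm
        · have h13 := hin (t₀ - t') ⟨by linarith, by linarith⟩
          rw [h11] at h13
          exact (E.mem_frontier_iff.1 (E.A_mem ⟨le_rfl, E.T_pos.le⟩)).2 h13
    have heO : e ∈ E.O '' Icc 0 E.L := by
      have := hefr
      rw [E.frontier_eq] at this
      exact this.resolve_left heA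
    obtain ⟨s', hs', hs'e⟩ := heO
    have hs'b : s' < E.sb := by
      by_contra hle
      exact heK ⟨s', ⟨not_lt.1 hle, hs'.2⟩, hs'e⟩
    have hs'0 : 0 < s' := by
      rcases hs'.1.eq_or_lt with h | h
      · exact absurd ⟨E.T, ⟨E.T_pos.le, le_rfl⟩, by rw [E.map_a, h, hs'e]⟩ heA
      · exact h
    obtain ⟨B', hB'⟩ := E.box_O ⟨hs'0, hs'b.trans E.sb_lt⟩ hs'b.ne
    have hsrc : e ∈ B'.ψ.source := hs'e ▸ B'.mem_source
    have hψe : B'.ψ e = (0, 0) := by rw [← hs'e, B'.map_center]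
    -- The remaining exit points have parameter in `(0, sb)`: the trajectory comes to `e` from below
    -- through the interior, and by assumption the interior is also above `e`.
    refine E.not_both_sides_O hZ hs' B' ((E.up_iff hZ B' (fun x hx h h' => h.ne' ((hB' x hx).1 h'))
      B'.mem_source (by rw [B'.map_center])).1 (hup s' ⟨hs'.1, hs'b⟩)) ?_
    refine (into_iff B' (l := 𝓝[<] t₀) (γ := fun t => Z 0 t (E.O s)) convex_snd_neg
      (fun x hx h h' => ne_of_lt h ((hB' x hx).1 h')) ?_).1 ?_
    · filter_upwards [B'.eventually_cone_left (t₀ := t₀) (hZ.velocity 0 (E.O s)) hsrc] with t ht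
      have := ht.2.1
      rw [← he, hψe] at this
      exact ⟨ht.1, this⟩
    · filter_upwards [Ioo_mem_nhdsLT ht₀.1] with t ht using hin t ht
  have hval : E.π (Z 0 (η' + τ) (E.O E.sb)) = lam 0 := by
    rw [hz2]
    exact (hη'U ⟨hη', le_rfl⟩).2
  have hmem : Z 0 (η' + τ) (E.O E.sb) ∈ interior E.F := by
    rw [hz2]
    exact (hη'U ⟨hη', le_rfl⟩).1
  have hcont : ContinuousAt (fun s => E.π (Z 0 (η' + τ) (E.O s))) E.sb := by
    refine (E.π_cont.continuousAt (isOpen_interior.mem_nhds hmem)).comp_of_eq ?_ rfl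
    have h5 := E.contO
    exact (hZ.cont.comp (by fun_prop : Continuous fun s : ℝ => ((0 : ℝ), η' + τ, E.O s))).continuousAt
  have h6 := hcont.tendsto
  rw [hval] at h6
  exact (h6.mono_left nhdsWithin_le_nhds).congr' (hev.mono fun s hs => hs.symm)

/-- The interior does not lie above the first part of the orthogonal edge. -/
theorem not_up (hZ : IsFlowFamily X W Z) {s : ℝ} (hs : s ∈ Ico 0 E.sb) : ¬ E.Up Z (E.O s) := by
  intro hup
  have hall : ∀ s' ∈ Ico 0 E.sb, E.Up Z (E.O s') := fun s' hs' =>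
    (E.up_congr hZ isPreconnected_Ico (Ico_subset_Ico_right E.sb_lt.le) (fun h => h.2.ne rfl) hs hs').1
      hup
  have hex : ∀ s', ∃ l, s' ∈ Ico 0 E.sb → E.Level Z (E.O s') l := by
    intro s'
    by_cases h : s' ∈ Ico 0 E.sb
    · obtain ⟨l, hl⟩ := (hall s' h).exists_level hZ
      exact ⟨l, fun _ => hl⟩
    · exact ⟨0, fun h' => absurd h' h⟩
  choose lam hlam using hex
  have hc := E.continuousWithinAt_level hZ hall hlam
  have ht := E.level_tendsto hZ hall hlam
  have hle : ∃ s' ∈ Ico 0 E.sb, ∀ s'' ∈ Ico 0 E.sb, lam s'' ≤ lam s' := by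
    -- Giving `lam` the value `lam 0` at `sb` closes `[0, sb)` into a circle, on which the maximum
    -- is attained; a maximum at `sb` is one at `0`.
    have hc2 : ContinuousOn (Function.update lam E.sb (lam 0)) (Icc 0 E.sb) := by
      have hd : Icc 0 E.sb \ {E.sb} = Ico 0 E.sb := Icc_sdiff_right
      rw [continuousOn_update_iff, hd]
      refine ⟨hc, fun _ => ht.mono_left (nhdsWithin_mono _ fun s' hs' => hs'.2)⟩
    obtain ⟨m, hm, hmax⟩ := isCompact_Icc.exists_isMaxOn ⟨0, le_rfl, E.sb_pos.le⟩ hc2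
    have hval : ∀ s' ∈ Ico 0 E.sb, Function.update lam E.sb (lam 0) s' = lam s' := fun s' hs' =>
      Function.update_of_ne hs'.2.ne _ _
    rcases hm.2.eq_or_lt with h | h
    · refine ⟨0, ⟨le_rfl, E.sb_pos⟩, fun s'' hs'' => ?_⟩
      have := hmax (Ico_subset_Icc_self hs'')
      simp only [mem_ofPred_eq] at this
      rwa [hval s'' hs'', h, Function.update_self] at this
    · refine ⟨m, ⟨hm.1, h⟩, fun s'' hs'' => ?_⟩
      have := hmax (Ico_subset_Icc_self hs'')
      simp only [mem_ofPred_eq] at this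
      rwa [hval s'' hs'', hval m ⟨hm.1, h⟩] at this
  obtain ⟨s', hs', hmax⟩ := hle
  obtain ⟨s'', hs'', l', hl', hlev⟩ := E.exists_level_lt hZ hs' (hall s' hs') (hlam s' hs')
  have := (hlam s'' hs'').unique hlev
  linarith [hmax s'' hs'']

end FigureEight
end

/-! ### Position of the interior along the other boundary arcs. -/

section

variable {M : Type*} [TopologicalSpace M] [ChartedSpace Plane M] [IsManifold (𝓡 2) ∞ M]
  {X W : (x : M) → TangentSpace (𝓡 2) x} {Z : ℝ → ℝ → M → M}

theorem TransverseBox.exists_mem {e : M} (B : TransverseBox X W e) {u v : ℝ} (hu : |u| < B.κ)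
    (hv : |v| < B.κ) : ∃ x ∈ B.ψ.source, B.ψ x = (u, v) := by
  have h : ((u, v) : ℝ × ℝ) ∈ B.ψ.target := B.mem_target_iff.2 ⟨hu, hv⟩
  exact ⟨_, B.ψ.map_target h, B.ψ.right_inv h⟩

namespace FigureEight

variable (E : FigureEight X W) [T2Space M]

theorem frontier_cases {e : M} (he : e ∈ frontier E.F) :
    (∃ s ∈ Ioo 0 E.sb, E.O s = e) ∨ (∃ s ∈ Ioo E.sb E.L, E.O s = e) ∨
      (∃ t ∈ Ioo 0 E.tb, E.A t = e) ∨ (∃ t ∈ Ioo E.tb E.T, E.A t = e) ∨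
      E.O 0 = e ∨ E.O E.sb = e ∨ E.O E.L = e := by
  rw [E.frontier_eq] at he
  rcases he with ⟨t, ht, rfl⟩ | ⟨s, hs, rfl⟩
  · rcases ht.1.eq_or_lt with h | h
    · subst h
      simp [E.map_c]
    rcases ht.2.eq_or_lt with h' | h'
    · subst h'
      simp [E.map_a]
    rcases lt_trichotomy t E.tb with h'' | h'' | h''
    · exact Or.inr (Or.inr (Or.inl ⟨t, ⟨h, h''⟩, rfl⟩))
    · subst h''
      simp [E.map_b]
    · exact Or.inr (Or.inr (Or.inr (Or.inl ⟨t, ⟨h'', h'⟩, rfl⟩)))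
  · rcases hs.1.eq_or_lt with h | h
    · subst h
      simp
    rcases hs.2.eq_or_lt with h' | h'
    · subst h'
      simp
    rcases lt_trichotomy s E.sb with h'' | h'' | h''
    · exact Or.inl ⟨s, ⟨h, h''⟩, rfl⟩
    · subst h''
      simp
    · exact Or.inr (Or.inl ⟨s, ⟨h'', h'⟩, rfl⟩)

theorem exists_box_axes {e : M} (he : e ∈ frontier E.F) :
    ∃ B : TransverseBox X W e, ∀ x ∈ B.ψ.source, x ∈ frontier E.F →
      (B.ψ x).1 = 0 ∨ (B.ψ x).2 = 0 := by
  rcases E.frontier_cases he with ⟨s, hs, rfl⟩ | ⟨s, hs, rfl⟩ | ⟨t, ht, rfl⟩ | ⟨t, ht, rfl⟩ |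
    rfl | rfl | rfl
  · obtain ⟨B, hB⟩ := E.box_O ⟨hs.1, hs.2.trans E.sb_lt⟩ hs.2.ne
    exact ⟨B, fun x hx h => Or.inr ((hB x hx).1 h)⟩
  · obtain ⟨B, hB⟩ := E.box_O ⟨E.sb_pos.trans hs.1, hs.2⟩ hs.1.ne'
    exact ⟨B, fun x hx h => Or.inr ((hB x hx).1 h)⟩
  · obtain ⟨B, hB⟩ := E.box_A ⟨ht.1, ht.2.trans E.tb_lt⟩ ht.2.ne
    exact ⟨B, fun x hx h => Or.inl ((hB x hx).1 h)⟩
  · obtain ⟨B, hB⟩ := E.box_A ⟨E.tb_pos.trans ht.1, ht.2⟩ ht.1.ne'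
    exact ⟨B, fun x hx h => Or.inl ((hB x hx).1 h)⟩
  · obtain ⟨B, hB⟩ := E.box_a
    exact ⟨B, fun x hx h => ((hB x hx).1 h).imp And.left And.left⟩
  · obtain ⟨B, hB⟩ := E.box_b
    exact ⟨B, fun x hx h => (hB x hx).1 h⟩
  · obtain ⟨B, hB⟩ := E.box_c
    exact ⟨B, fun x hx h => ((hB x hx).1 h).imp And.left And.left⟩

theorem mem_diff_iff {x : M} : x ∈ E.F \ interior E.F ↔ x ∈ frontier E.F :=
  E.mem_frontier_iff.symm

/-- `π` increases strictly along the trajectory in the interior. At a frontier point both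
coordinates increase, so the trajectory leaves the axes and with them the frontier; limit points on
the frontier are therefore harmless. -/
theorem exists_exit (hZ : IsFlowFamily X W Z) {ε : ℝ} (hε : 0 < ε) (x : M) :
    ∃ t > 0, Z ε t x ∉ interior E.F := by
  refine exists_not_mem_of_monotone (θ := Z ε) (F := E.F) (f := E.π)
    (hZ.cont.comp (by fun_prop : Continuous fun w : ℝ × M => (ε, w.1, w.2)))
    (hZ.add ε) (hZ.zero ε) E.compact isOpen_interior interior_subset E.π_cont ?_ ?_ x
  · intro x s hs h
    have := E.π_lt hZ hε hs h
    rwa [hZ.zero] at this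
  · intro x hx
    rw [mem_diff_iff] at hx
    obtain ⟨B, hB⟩ := E.exists_box_axes hx
    obtain ⟨s, hs⟩ := (B.eventually_cone (t₀ := 0) (hZ.velocity ε x)
      (by rw [hZ.zero]; exact B.mem_source)).exists
    rw [hZ.zero, B.map_center] at hs
    refine ⟨s, fun h => ?_⟩
    rw [mem_diff_iff] at h
    rcases hB _ hs.1 h with h1 | h1
    · exact (hs.2.2.2 hε).ne' h1
    · exact hs.2.1.ne' h1

/-- Here `-y` increases along reversed trajectories of `X`. -/
theorem exists_backward_exit (hZ : IsFlowFamily X W Z) (x : M) :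
    ∃ t > 0, Z 0 (-t) x ∉ interior E.F := by
  have hcontZ : Continuous fun w : ℝ × M => Z 0 (-w.1) w.2 :=
    hZ.cont.comp (by fun_prop : Continuous fun w : ℝ × M => ((0 : ℝ), -w.1, w.2))
  have hfrom : ∀ e, (∃ B : TransverseBox X W e, ∀ x ∈ B.ψ.source, (B.ψ x).1 = 0 →
      (B.ψ x).2 < 0 → x ∉ frontier E.F) → ∃ t, Z 0 t e ∉ frontier E.F := by
    rintro e ⟨B, hB⟩
    obtain ⟨s, hs⟩ := (B.eventually_cone_left (t₀ := 0) (hZ.velocity 0 e)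
      (by rw [hZ.zero]; exact B.mem_source)).exists
    rw [hZ.zero, B.map_center] at hs
    exact ⟨s, hB _ hs.1 (hs.2.2.1 rfl) hs.2.1⟩
  have hc : ∃ t, Z 0 t (E.A 0) ∉ frontier E.F := by
    rw [E.map_c]
    refine hfrom _ ?_
    obtain ⟨B, hB⟩ := E.box_c
    refine ⟨B, fun x hx _ h1 h2 => ?_⟩
    rcases (hB x hx).1 h2 with h3 | h3
    · exact absurd h1 (not_lt.2 h3.2)
    · exact h1.ne h3.1
  refine exists_not_mem_of_monotone (θ := fun t => Z 0 (-t)) (F := E.F) (f := fun x => -E.y x)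
    hcontZ (fun s t x => by rw [neg_add, hZ.add]) (fun x => by rw [neg_zero, hZ.zero])
    E.compact isOpen_interior interior_subset E.y_cont.neg ?_ ?_ x
  · intro x s hs h
    have := E.y_lt hZ (x := x) (a := -s) (b := 0) (by linarith) (fun t ht => by
      have := h (-t) ⟨by linarith [ht.2], by linarith [ht.1]⟩
      simpa using this)
    rw [hZ.zero] at this
    simpa using this
  · intro x hx
    rw [mem_diff_iff] at hx
    suffices h : ∃ t, Z 0 t x ∉ frontier E.F by
      obtain ⟨t, ht⟩ := h
      exact ⟨-t, by rw [neg_neg, mem_diff_iff]; exact ht⟩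
    -- The tangent edge is itself a trajectory, so its points leave the frontier only beyond an end:
    -- going back past `c` leads below `c`, where there is no frontier.
    have hA : ∀ t, x = E.A t → ∃ t, Z 0 t x ∉ frontier E.F := by
      rintro t rfl
      obtain ⟨t', ht'⟩ := hc
      refine ⟨t' - t, ?_⟩
      rwa [← E.A_eq hZ, sub_add_cancel, ← add_zero t', E.A_eq hZ]
    have hO : ∀ s ∈ Ioo 0 E.L, s ≠ E.sb → x = E.O s → ∃ t, Z 0 t x ∉ frontier E.F := by
      rintro s hs hsb rfl
      refine hfrom _ ?_
      obtain ⟨B, hB⟩ := E.box_O hs hsb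
      exact ⟨B, fun x hx _ h1 h2 => h1.ne ((hB x hx).1 h2)⟩
    rcases E.frontier_cases hx with ⟨s, hs, h⟩ | ⟨s, hs, h⟩ | ⟨t, ht, h⟩ | ⟨t, ht, h⟩ | h | h | h
    · exact hO s ⟨hs.1, hs.2.trans E.sb_lt⟩ hs.2.ne h.symm
    · exact hO s ⟨E.sb_pos.trans hs.1, hs.2⟩ hs.1.ne' h.symm
    · exact hA t h.symm
    · exact hA t h.symm
    · exact hA E.T (by rw [E.map_a, h])
    · exact hA E.tb (by rw [E.map_b, h])
    · exact hA 0 (by rw [E.map_c, h])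

/-- The interior lies above the last part of the orthogonal edge. -/
theorem up_right (hZ : IsFlowFamily X W Z) {s : ℝ} (hs : s ∈ Ioo E.sb E.L) : E.Up Z (E.O s) := by
  obtain ⟨x, hx⟩ := E.nonempty
  obtain ⟨t₁, ht₁, hexit⟩ := E.exists_backward_exit hZ x
  have hc : Continuous fun t => Z 0 (-t) x := (hZ.continuous_time 0 x).comp continuous_neg
  have hnear : ∀ᶠ t in 𝓝[>] (0 : ℝ), Z 0 (-t) x ∈ interior E.F :=
    (hc.continuousAt.eventually_mem (isOpen_interior.mem_nhds
      (by rwa [neg_zero, hZ.zero]))).filter_mono nhdsWithin_le_nhds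
  obtain ⟨t₀, ht₀, hex, hin⟩ := exists_first_exit hc isOpen_interior hnear ht₁ hexit
  have hfr := E.mem_frontier_of_exit hc ht₀.1 hin hex
  set e := Z 0 (-t₀) x with he
  have hup : E.Up Z e := by
    filter_upwards [Ioo_mem_nhdsGT ht₀.1] with t ht
    have := hin (t₀ - t) ⟨by linarith [ht.2], by linarith [ht.1]⟩
    rwa [neg_sub, sub_eq_add_neg, hZ.add] at this
  -- A trajectory starting on the tangent edge before its end continues along the frontier, so it
  -- does not start into the interior. This also rules out `b` and `c`; `a` is left to `not_up`.
  have hA : ∀ t ∈ Ico 0 E.T, e ≠ E.A t := by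
    intro t ht h
    obtain ⟨τ, hτ, hτ'⟩ := (hup.and (Ioo_mem_nhdsGT (sub_pos.2 ht.2))).exists
    rw [h, ← E.A_eq hZ] at hτ
    exact (E.mem_frontier_iff.1 (E.A_mem ⟨by linarith [hτ'.1, ht.1], by linarith [hτ'.2]⟩)).2 hτ
  have hO : ∀ s ∈ Ico 0 E.sb, E.O s ≠ e := fun s hs h => E.not_up hZ hs (h ▸ hup)
  rcases E.frontier_cases hfr with ⟨s', hs', h⟩ | ⟨s', hs', h⟩ | ⟨t, ht, h⟩ | ⟨t, ht, h⟩ | h | h | h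
  · exact absurd h (hO s' ⟨hs'.1.le, hs'.2⟩)
  · rw [← h] at hup
    exact (E.up_congr hZ isPreconnected_Ioo (fun s hs => ⟨E.sb_pos.le.trans hs.1.le, hs.2⟩)
      (fun h => h.1.ne rfl) hs' hs).1 hup
  · exact absurd h.symm (hA t ⟨ht.1.le, ht.2.trans E.tb_lt⟩)
  · exact absurd h.symm (hA t ⟨E.tb_pos.le.trans ht.1.le, ht.2⟩)
  · exact absurd h (hO 0 ⟨le_rfl, E.sb_pos⟩)
  · exact absurd (h.symm.trans E.map_b.symm) (hA _ ⟨E.tb_pos.le, E.tb_lt⟩)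
  · exact absurd (h.symm.trans E.map_c.symm) (hA _ ⟨le_rfl, E.T_pos⟩)

theorem above_out (hZ : IsFlowFamily X W Z) {s : ℝ} (hs : s ∈ Ico 0 E.sb)
    (B : TransverseBox X W (E.O s))
    (hB : ∀ x ∈ B.ψ.source, 0 < (B.ψ x).2 → x ∉ frontier E.F) :
    ∀ x ∈ B.ψ.source, 0 < (B.ψ x).2 → x ∉ E.F := by
  rcases B.side convex_snd_pos hB with h | h
  · exact absurd ((E.up_iff hZ B hB B.mem_source (by rw [B.map_center])).2 h) (E.not_up hZ hs)
  · exact h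

/-- Trajectories of `X` from points of the orthogonal edge just beyond `b` enter this quadrant and,
by `up_right`, the interior. -/
theorem quadrant_b (hZ : IsFlowFamily X W Z) (B : TransverseBox X W (E.O E.sb))
    (hB : ∀ x ∈ B.ψ.source, x ∈ frontier E.F ↔ (B.ψ x).1 = 0 ∨ (B.ψ x).2 = 0) :
    ∀ x ∈ B.ψ.source, 0 < (B.ψ x).1 → 0 < (B.ψ x).2 → x ∈ interior E.F := by
  obtain ⟨s, hs, hs'⟩ := (((B.eventually_horizontal E.velO' rfl).filter_mono
    nhdsWithin_le_nhds).and (Ioo_mem_nhdsGT E.sb_lt)).exists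
  have h1 := (into_iff B (convex_fst_pos.inter convex_snd_pos)
    (fun x hx h h' => ((hB x hx).1 h').elim (fun h2 => h.1.ne' h2) fun h2 => h.2.ne' h2) ?_).1
    (E.up_right hZ hs')
  · exact fun x hx hu hv => h1 x hx ⟨hu, hv⟩
  · filter_upwards [B.eventually_cone (t₀ := 0) (hZ.velocity 0 (E.O s))
      (by rw [hZ.zero]; exact hs.1)] with t ht
    rw [hZ.zero] at ht
    refine ⟨ht.1, ?_, ?_⟩
    · rw [mem_ofPred_eq, ht.2.2.1 rfl]
      exact hs.2.2.1 hs'.1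
    · have := ht.2.1
      rwa [hs.2.1] at this

/-- The trajectory of `X + W` starts from `x` into the interior. -/
def Right (Z : ℝ → ℝ → M → M) (x : M) : Prop := ∀ᶠ t in 𝓝[>] (0 : ℝ), Z 1 t x ∈ interior E.F

theorem right_iff (hZ : IsFlowFamily X W Z) {e : M} (B : TransverseBox X W e)
    (hB : ∀ x ∈ B.ψ.source, 0 < (B.ψ x).1 → x ∉ frontier E.F) {w : M} (hw : w ∈ B.ψ.source)
    (hw0 : (B.ψ w).1 = 0) :
    E.Right Z w ↔ ∀ x ∈ B.ψ.source, 0 < (B.ψ x).1 → x ∈ interior E.F := by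
  refine into_iff B convex_fst_pos hB ?_
  filter_upwards [B.eventually_cone (t₀ := 0) (hZ.velocity 1 w) (by rwa [hZ.zero])] with t ht
  have := ht.2.2.2 one_pos
  rw [hZ.zero, hw0] at this
  exact ⟨ht.1, this⟩

theorem right_congr (hZ : IsFlowFamily X W Z) {I : Set ℝ} (hI : IsPreconnected I)
    (hIL : I ⊆ Ioo 0 E.T) (hIb : E.tb ∉ I) {t t' : ℝ} (ht : t ∈ I) (ht' : t' ∈ I) :
    E.Right Z (E.A t) ↔ E.Right Z (E.A t') := by
  refine hI.induction₂' (fun t t' => E.Right Z (E.A t) ↔ E.Right Z (E.A t')) (fun t ht => ?_)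
    (fun _ _ _ _ _ _ h h' => h.trans h') ht ht'
  obtain ⟨B, hB⟩ := E.box_A (hIL ht) (fun h => hIb (h ▸ ht))
  have hB' : ∀ x ∈ B.ψ.source, 0 < (B.ψ x).1 → x ∉ frontier E.F :=
    fun x hx h h' => h.ne' ((hB x hx).1 h')
  have h1 := B.eventually_vertical E.velA' rfl
  have h2 := E.right_iff hZ B hB' B.mem_source (by rw [B.map_center])
  filter_upwards [h1.filter_mono nhdsWithin_le_nhds] with t' ht'
  have h3 := E.right_iff hZ B hB' ht'.1 ht'.2.1
  exact ⟨h2.trans h3.symm, h3.trans h2.symm⟩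

/-- Just after `b` the right side of the tangent edge is the upper right quadrant at `b`; local
constancy carries this along the edge up to `a`. -/
theorem right_of_mem (hZ : IsFlowFamily X W Z) {t : ℝ} (ht : t ∈ Ioo E.tb E.T) :
    E.Right Z (E.A t) := by
  obtain ⟨B, hB⟩ := E.box_b
  obtain ⟨t', ht', ht'I⟩ := (((B.eventually_vertical E.velA' E.map_b).filter_mono
    nhdsWithin_le_nhds).and (Ioo_mem_nhdsGT E.tb_lt)).exists
  refine (E.right_congr hZ isPreconnected_Ioo (fun t ht => ⟨E.tb_pos.trans ht.1, ht.2⟩)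
    (fun h => h.1.ne rfl) ht'I ht).1 ?_
  filter_upwards [B.eventually_cone (t₀ := 0) (hZ.velocity 1 (E.A t'))
    (by rw [hZ.zero]; exact ht'.1)] with τ hτ
  rw [hZ.zero, ht'.2.1] at hτ
  exact E.quadrant_b hZ B hB _ hτ.1 (hτ.2.2.2 one_pos) ((ht'.2.2.1 ht'I.1).trans hτ.2.1)

/-- Just before `b` the right side is the lower right quadrant at `b`. Were it in the interior, the
interior would be on both sides of the orthogonal edge beyond `b`. -/
theorem not_right_of_mem (hZ : IsFlowFamily X W Z) {t : ℝ} (ht : t ∈ Ioo 0 E.tb) :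
    ¬ E.Right Z (E.A t) := by
  intro hR
  obtain ⟨B, hB⟩ := E.box_b
  obtain ⟨t', ht', ht'I⟩ := (((B.eventually_vertical E.velA' E.map_b).filter_mono
    nhdsWithin_le_nhds).and (Ioo_mem_nhdsLT E.tb_pos)).exists
  replace hR := (E.right_congr hZ isPreconnected_Ioo (fun t ht => ⟨ht.1, ht.2.trans E.tb_lt⟩)
    (fun h => h.2.ne rfl) ht ht'I).1 hR
  -- the lower right quadrant at the vertex would be in the interior
  have hQ := (into_iff B (convex_fst_pos.inter convex_snd_neg)
    (fun x hx h h' => ((hB x hx).1 h').elim (fun h2 => h.1.ne' h2)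
      fun h2 => (show (B.ψ x).2 < 0 from h.2).ne h2) ?_).1 hR
  · obtain ⟨s, hs, hsI⟩ := (((B.eventually_horizontal E.velO' rfl).filter_mono
      nhdsWithin_le_nhds).and (Ioo_mem_nhdsGT E.sb_lt)).exists
    have hsL : s ∈ Ioo 0 E.L := ⟨E.sb_pos.trans hsI.1, hsI.2⟩
    obtain ⟨B', hB'⟩ := E.box_O hsL hsI.1.ne'
    refine E.not_both_sides_O hZ (Ioo_subset_Icc_self hsL) B' ((E.up_iff hZ B'
      (fun x hx h h' => h.ne' ((hB' x hx).1 h')) B'.mem_source (by rw [B'.map_center])).1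
      (E.up_right hZ hsI)) ?_
    refine (into_iff B' (l := 𝓝[<] (0 : ℝ)) (γ := fun t => Z 0 t (E.O s)) convex_snd_neg
      (fun x hx h h' => ne_of_lt h ((hB' x hx).1 h')) ?_).1 ?_
    · filter_upwards [B'.eventually_cone_left (t₀ := 0) (hZ.velocity 0 (E.O s))
        (by rw [hZ.zero]; exact B'.mem_source)] with t ht
      have := ht.2.1
      rw [hZ.zero, B'.map_center] at this
      exact ⟨ht.1, this⟩
    · filter_upwards [B.eventually_cone_left (t₀ := 0) (hZ.velocity 0 (E.O s))
        (by rw [hZ.zero]; exact hs.1)] with t ht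
      rw [hZ.zero, hs.2.1] at ht
      refine hQ _ ht.1 ⟨?_, ht.2.1⟩
      rw [mem_ofPred_eq, ht.2.2.1 rfl]
      exact hs.2.2.1 hsI.1
  · have hcont := (B.hasDerivAt (fun t => Z 1 t (E.A t')) 0 1 1
      (by simp only [hZ.zero]; exact ht'.1) (hZ.vel_smul 1 (E.A t') 0)).2.continuousAt
    have hneg : ∀ᶠ τ in 𝓝 (0 : ℝ), (B.ψ (Z 1 τ (E.A t'))).2 < 0 :=
      hcont.eventually_lt_const (by simpa only [hZ.zero] using ht'.2.2.2 ht'I.2)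
    filter_upwards [B.eventually_cone (t₀ := 0) (hZ.velocity 1 (E.A t'))
      (by rw [hZ.zero]; exact ht'.1), hneg.filter_mono nhdsWithin_le_nhds] with τ hτ hτ'
    rw [hZ.zero, ht'.2.1] at hτ
    exact ⟨hτ.1, hτ.2.2.2 one_pos, hτ'⟩

end FigureEight
end

/-! ### Exit points, and a trajectory that returns to the vertex. -/

section

variable {M : Type*} [TopologicalSpace M] [ChartedSpace Plane M] [IsManifold (𝓡 2) ∞ M]
  {X W : (x : M) → TangentSpace (𝓡 2) x} {Z : ℝ → ℝ → M → M}

namespace FigureEight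

variable (E : FigureEight X W) [T2Space M]

theorem right_out (hZ : IsFlowFamily X W Z) {e w : M} (B : TransverseBox X W e)
    (hB : ∀ x ∈ B.ψ.source, 0 < (B.ψ x).1 → x ∉ frontier E.F) (hw : w ∈ B.ψ.source)
    (hw0 : (B.ψ w).1 = 0) (hR : ¬ E.Right Z w) : ∀ x ∈ B.ψ.source, 0 < (B.ψ x).1 → x ∉ E.F := by
  rcases B.side convex_fst_pos hB with h | h
  · exact absurd ((E.right_iff hZ B hB hw hw0).2 h) hR
  · exact h

/-- The places where a trajectory of `X + ε W` can leave the interior. -/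
theorem exit_cases (hZ : IsFlowFamily X W Z) {ε : ℝ} (hε : 0 < ε) {x : M} {t₀ : ℝ} (ht₀ : 0 < t₀)
    (hin : ∀ t ∈ Ioo 0 t₀, Z ε t x ∈ interior E.F) (hex : Z ε t₀ x ∉ interior E.F) :
    Z ε t₀ x = E.O E.sb ∨ (∀ᶠ t in 𝓝[>] t₀, Z ε t x ∉ E.F) ∧
      ((∃ s ∈ Ioo 0 E.sb, E.O s = Z ε t₀ x) ∨ ∃ t ∈ Ioo 0 E.tb, E.A t = Z ε t₀ x) := by
  have hfr := E.mem_frontier_of_exit (hZ.continuous_time ε x) ht₀ hin hex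
  obtain ⟨e, he⟩ : ∃ e, e = Z ε t₀ x := ⟨_, rfl⟩
  rw [← he] at hfr ⊢
  have hin' : ∀ᶠ t in 𝓝[<] t₀, Z ε t x ∈ interior E.F := by
    filter_upwards [Ioo_mem_nhdsLT ht₀] with t ht using hin t ht
  have hbelow : ∀ B : TransverseBox X W e,
      (∀ x ∈ B.ψ.source, (B.ψ x).2 < 0 → x ∉ frontier E.F) →
      ∀ x ∈ B.ψ.source, (B.ψ x).2 < 0 → x ∈ interior E.F := by
    intro B hB
    refine (into_iff B convex_snd_neg hB ?_).1 hin'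
    filter_upwards [B.eventually_cone_left (t₀ := t₀) (hZ.velocity ε x)
      (he ▸ B.mem_source)] with t ht
    rw [← he, B.map_center] at ht
    exact ⟨ht.1, ht.2.1⟩
  have hleft : ∀ B : TransverseBox X W e,
      (∀ x ∈ B.ψ.source, (B.ψ x).1 < 0 → x ∉ frontier E.F) →
      ∀ x ∈ B.ψ.source, (B.ψ x).1 < 0 → x ∈ interior E.F := by
    intro B hB
    refine (into_iff B convex_fst_neg hB ?_).1 hin'
    filter_upwards [B.eventually_cone_left (t₀ := t₀) (hZ.velocity ε x)
      (he ▸ B.mem_source)] with t ht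
    rw [← he, B.map_center] at ht
    exact ⟨ht.1, ht.2.2.2 hε⟩
  have hafter : ∀ B : TransverseBox X W e, (∀ x ∈ B.ψ.source, 0 < (B.ψ x).1 → 0 < (B.ψ x).2 →
      x ∉ E.F) → ∀ᶠ t in 𝓝[>] t₀, Z ε t x ∉ E.F := by
    intro B hB
    filter_upwards [B.eventually_cone (t₀ := t₀) (hZ.velocity ε x)
      (he ▸ B.mem_source)] with t ht
    rw [← he, B.map_center] at ht
    exact hB _ ht.1 (ht.2.2.2 hε) ht.2.1
  have hκ : ∀ B : TransverseBox X W e, |B.κ / 2| < B.κ ∧ |-(B.κ / 2)| < B.κ := by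
    intro B
    have := B.κ_pos
    rw [abs_neg, abs_of_pos (by linarith)]
    constructor <;> linarith
  rcases E.frontier_cases hfr with ⟨s, hs, rfl⟩ | ⟨s, hs, rfl⟩ | ⟨t, ht, rfl⟩ | ⟨t, ht, rfl⟩ |
    rfl | rfl | rfl
  · right
    obtain ⟨B, hB⟩ := E.box_O ⟨hs.1, hs.2.trans E.sb_lt⟩ hs.2.ne
    have := E.above_out hZ ⟨hs.1.le, hs.2⟩ B (fun x hx h h' => h.ne' ((hB x hx).1 h'))
    exact ⟨hafter B fun x hx _ h => this x hx h, Or.inl ⟨s, hs, rfl⟩⟩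
  · exfalso
    have hsL : s ∈ Ioo 0 E.L := ⟨E.sb_pos.trans hs.1, hs.2⟩
    obtain ⟨B, hB⟩ := E.box_O hsL hs.1.ne'
    exact E.not_both_sides_O hZ (Ioo_subset_Icc_self hsL) B ((E.up_iff hZ B
      (fun x hx h h' => h.ne' ((hB x hx).1 h')) B.mem_source (by rw [B.map_center])).1
      (E.up_right hZ hs)) (hbelow B fun x hx h h' => h.ne ((hB x hx).1 h'))
  · right
    obtain ⟨B, hB⟩ := E.box_A ⟨ht.1, ht.2.trans E.tb_lt⟩ ht.2.ne
    have := E.right_out hZ B (fun x hx h h' => h.ne' ((hB x hx).1 h')) B.mem_source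
      (by rw [B.map_center]) (E.not_right_of_mem hZ ht)
    exact ⟨hafter B fun x hx h _ => this x hx h, Or.inr ⟨t, ht, rfl⟩⟩
  · exfalso
    have htT : t ∈ Ioo 0 E.T := ⟨E.tb_pos.trans ht.1, ht.2⟩
    obtain ⟨B, hB⟩ := E.box_A htT ht.1.ne'
    exact E.not_both_sides_A hZ (Ioo_subset_Icc_self htT) B ((E.right_iff hZ B
      (fun x hx h h' => h.ne' ((hB x hx).1 h')) B.mem_source (by rw [B.map_center])).1
      (E.right_of_mem hZ ht)) (hleft B fun x hx h h' => h.ne ((hB x hx).1 h'))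
  · exfalso
    -- At `a` the half above is outside `F`, and the trajectory would come from the left half
    -- through the interior; the upper left quadrant would be in both.
    obtain ⟨B, hB⟩ := E.box_a
    have h1 := E.above_out hZ ⟨le_rfl, E.sb_pos⟩ B (fun x hx h h' =>
      ((hB x hx).1 h').elim (fun h2 => absurd h (not_lt.2 h2.2)) fun h2 => h.ne' h2.1)
    have h2 := hleft B (fun x hx h h' =>
      ((hB x hx).1 h').elim (fun h2 => h.ne h2.1) fun h2 => absurd h (not_lt.2 h2.2))
    obtain ⟨x', hx', hxe⟩ := B.exists_mem (hκ B).2 (hκ B).1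
    have := B.κ_pos
    exact h1 x' hx' (by rw [hxe]; exact half_pos this)
      (interior_subset (h2 x' hx' (by rw [hxe]; exact neg_lt_zero.2 (half_pos this))))
  · exact Or.inl rfl
  · exfalso
    -- At `c` the right half is outside `F` and the lower half would be in the interior; they share
    -- the lower right quadrant.
    obtain ⟨B, hB⟩ := E.box_c
    obtain ⟨t, ht, htI⟩ := (((B.eventually_vertical E.velA' E.map_c).filter_mono
      nhdsWithin_le_nhds).and (Ioo_mem_nhdsGT E.tb_pos)).exists
    have h1 := E.right_out hZ B (fun x hx h h' =>
      ((hB x hx).1 h').elim (fun h2 => h.ne' h2.1) fun h2 => absurd h (not_lt.2 h2.2)) ht.1 ht.2.1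
      (E.not_right_of_mem hZ htI)
    have h2 := hbelow B (fun x hx h h' =>
      ((hB x hx).1 h').elim (fun h2 => absurd h (not_lt.2 h2.2)) fun h2 => h.ne h2.1)
    obtain ⟨x', hx', hxe⟩ := B.exists_mem (hκ B).1 (hκ B).2
    have := B.κ_pos
    exact h1 x' hx' (by rw [hxe]; exact half_pos this)
      (interior_subset (h2 x' hx' (by rw [hxe]; exact neg_lt_zero.2 (half_pos this))))

/-- The trajectories starting at the vertex enter the interior, uniformly in `ε`. -/
theorem exists_uniform_entry (hZ : IsFlowFamily X W Z) (δ : ℝ) :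
    ∃ η > 0, ∀ ε ∈ Ioc 0 δ, ∀ t ∈ Ioc 0 η, Z ε t (E.O E.sb) ∈ interior E.F := by
  obtain ⟨B, hB⟩ := E.box_b
  have hQ := E.quadrant_b hZ B hB
  -- The value `ε = 0` is included for compactness only; entry into the open quadrant needs `0 < ε`.
  have h1 : ∀ᶠ t in 𝓝 (0 : ℝ), ∀ ε ∈ Icc 0 δ, Z ε t (E.O E.sb) ∈ B.ψ.source := by
    refine isCompact_Icc.eventually_forall_of_forall_eventually fun ε _ => ?_
    have hc : Continuous fun w : ℝ × ℝ => Z w.2 w.1 (E.O E.sb) :=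
      hZ.cont.comp (by fun_prop : Continuous fun w : ℝ × ℝ => (w.2, w.1, E.O E.sb))
    exact hc.continuousAt.eventually_mem (B.ψ.open_source.mem_nhds
      (by simp only [hZ.zero]; exact B.mem_source))
  obtain ⟨η, hη, hb⟩ := Metric.nhds_basis_closedBall.eventually_iff.1 h1
  rw [Real.closedBall_eq_Icc, zero_sub, zero_add] at hb
  refine ⟨η, hη, fun ε hε t ht => ?_⟩
  have hs : ∀ s ∈ Icc 0 t, Z ε s (E.O E.sb) ∈ B.ψ.source := fun s hs =>
    hb ⟨by linarith [hs.1], hs.2.trans ht.2⟩ ε ⟨hε.1.le, hε.2⟩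
  have hu := B.fst_lt ht.1 (fun s _ => hZ.vel_smul ε (E.O E.sb) s) hs hε.1
  have hv := B.snd_lt ht.1 (fun s _ => hZ.vel_smul ε (E.O E.sb) s) hs one_pos
  rw [hZ.zero, B.map_center] at hu hv
  exact hQ _ (hs t ⟨ht.1.le, le_rfl⟩) hu hv

/-- If the trajectory of `X + δ W` starting at the vertex leaves the interior through the tangent
edge, then a trajectory of `X + ε W` with `0 < ε ≤ δ` returns to the vertex. -/
theorem exists_closed (hZ : IsFlowFamily X W Z) {δ t₁ : ℝ} (hδ : 0 < δ) (ht₁ : 0 < t₁)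
    (hout : Z δ t₁ (E.O E.sb) ∉ interior E.F)
    (hO : ∀ t ∈ Ioc 0 t₁, Z δ t (E.O E.sb) ∉ E.O '' Icc 0 E.L) :
    ∃ ε ∈ Ioc 0 δ, ∃ t > 0, Z ε t (E.O E.sb) = E.O E.sb := by
  by_contra! hno
  -- A common lower bound `η` for the exit times is needed because `b` belongs to both `K₁` and
  -- `K₂`: frontier pieces are avoided on `[η, t₂]` only.
  obtain ⟨η, hη, hηU⟩ := E.exists_uniform_entry hZ δ
  have hexit : ∀ ε, ∃ t₀, ε ∈ Ioc 0 δ → 0 < t₀ ∧ Z ε t₀ (E.O E.sb) ∉ interior E.F ∧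
      ∀ t ∈ Ioo 0 t₀, Z ε t (E.O E.sb) ∈ interior E.F := by
    intro ε
    by_cases hε : ε ∈ Ioc 0 δ
    · obtain ⟨t, ht, htx⟩ := E.exists_exit hZ hε.1 (E.O E.sb)
      obtain ⟨t₀, ht₀, h⟩ := exists_first_exit (hZ.continuous_time ε (E.O E.sb)) isOpen_interior
        (by filter_upwards [Ioc_mem_nhdsGT hη] with t ht using hηU ε hε t ht) ht htx
      exact ⟨t₀, fun _ => ⟨ht₀.1, h⟩⟩
    · exact ⟨0, fun h => absurd h hε⟩
  choose te hte using hexit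
  set K₁ : Set M := E.A '' Icc 0 E.tb with hK₁
  set K₂ : Set M := E.O '' Icc 0 E.L with hK₂
  have hK₁c : IsClosed K₁ := (isCompact_Icc.image E.contA).isClosed
  have hK₂c : IsClosed K₂ := (isCompact_Icc.image E.contO).isClosed
  have hK₁f : K₁ ⊆ frontier E.F := by
    rintro _ ⟨t, ht, rfl⟩
    exact E.A_mem ⟨ht.1, ht.2.trans E.tb_lt.le⟩
  have hK₂f : K₂ ⊆ frontier E.F := by
    rintro _ ⟨s, hs, rfl⟩
    exact E.O_mem hs
  have hηte : ∀ ε ∈ Ioc 0 δ, η < te ε := by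
    intro ε hε
    by_contra hcon
    exact (hte ε hε).2.1 (hηU ε hε _ ⟨(hte ε hε).1, not_lt.1 hcon⟩)
  -- As `b` is never an exit point, an exit is on exactly one of the two closed sets `K₁`, `K₂`, and
  -- the trajectory is outside `F` immediately afterwards.
  have hcases : ∀ ε ∈ Ioc 0 δ, (∀ᶠ t in 𝓝[>] (te ε), Z ε t (E.O E.sb) ∉ E.F) ∧
      (Z ε (te ε) (E.O E.sb) ∈ K₁ ↔ Z ε (te ε) (E.O E.sb) ∉ K₂) := by
    intro ε hε
    obtain ⟨h1, h2, h3⟩ := hte ε hε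
    rcases E.exit_cases hZ hε.1 h1 h3 h2 with h | ⟨h, h'⟩
    · exact absurd h (hno ε hε _ h1)
    · refine ⟨h, ?_⟩
      rcases h' with ⟨s, hs, hse⟩ | ⟨t, ht, hte⟩
      · have hsL : s ∈ Icc 0 E.L := ⟨hs.1.le, hs.2.le.trans E.sb_lt.le⟩
        refine ⟨?_, fun h4 => absurd ⟨s, hsL, hse⟩ h4⟩
        rintro ⟨t, ht, htx⟩
        rcases E.inter t ⟨ht.1, ht.2.trans E.tb_lt.le⟩ s hsL (htx.trans hse.symm) with h5 | h5 | h5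
        · linarith [hs.2, E.sb_lt]
        · linarith [hs.2]
        · linarith [hs.1]
      · refine ⟨?_, fun _ => ⟨t, ⟨ht.1.le, ht.2.le⟩, hte⟩⟩
        rintro - ⟨s, hs, hse⟩
        rcases E.inter t ⟨ht.1.le, ht.2.le.trans E.tb_lt.le⟩ s hs (hte.trans hse.symm)
          with h5 | h5 | h5
        · linarith [ht.1]
        · linarith [ht.2]
        · linarith [ht.2, E.tb_lt]
  have hcε : ∀ ε₀ : ℝ, Tendsto (fun ε : ℝ => (ε, E.O E.sb)) (𝓝 ε₀) (𝓝 (ε₀, E.O E.sb)) := fun ε₀ =>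
    (continuous_id.prodMk continuous_const).continuousAt
  -- Being outside `F` at `t₂` bounds the exit time of nearby trajectories, and missing `K` on the
  -- compact interval `[η, t₂]` persists. Nothing is asked of an exit at `ε₀` itself, so `ε₀ = 0` is
  -- allowed.
  have hpersist : ∀ K : Set M, IsClosed K → ∀ ε₀ t₂, η ≤ t₂ → Z ε₀ t₂ (E.O E.sb) ∉ E.F →
      (∀ t ∈ Icc η t₂, Z ε₀ t (E.O E.sb) ∈ Kᶜ) →
      ∀ᶠ ε in 𝓝 ε₀, ε ∈ Ioc 0 δ → Z ε (te ε) (E.O E.sb) ∉ K := by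
    intro K hK ε₀ t₂ ht₂ hF h
    have h1 := (hcε ε₀).eventually (hZ.eventually_forall_mem hK.isOpen_compl h)
    have h2 := (hcε ε₀).eventually (hZ.eventually_forall_mem (a := t₂) (b := t₂)
      E.isClosed.isOpen_compl (fun t ht => by
        have : t = t₂ := le_antisymm ht.2 ht.1
        rw [this]
        exact hF))
    filter_upwards [h1, h2] with ε h1 h2 hε
    refine h1 _ ⟨(hηte ε hε).le, ?_⟩
    by_contra hcon
    exact h2 t₂ ⟨le_rfl, le_rfl⟩
      (interior_subset ((hte ε hε).2.2 t₂ ⟨hη.trans_le ht₂, not_le.1 hcon⟩))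
  have hopen : ∀ K : Set M, IsClosed K → K ⊆ frontier E.F → ∀ ε₀ ∈ Ioc 0 δ,
      Z ε₀ (te ε₀) (E.O E.sb) ∉ K → ∀ᶠ ε in 𝓝 ε₀, ε ∈ Ioc 0 δ → Z ε (te ε) (E.O E.sb) ∉ K := by
    intro K hK hKf ε₀ hε₀ hne
    have h1 : ∀ᶠ t in 𝓝[>] (te ε₀), Z ε₀ t (E.O E.sb) ∈ Kᶜ :=
      ((hZ.continuous_time ε₀ (E.O E.sb)).continuousAt.eventually_mem
        (hK.isOpen_compl.mem_nhds hne)).filter_mono nhdsWithin_le_nhds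
    obtain ⟨t₂, ht₂, ht₂b⟩ := (mem_nhdsGT_iff_exists_Ioc_subset).1 ((hcases ε₀ hε₀).1.and h1)
    rw [mem_Ioi] at ht₂
    refine hpersist K hK ε₀ t₂ ((hηte ε₀ hε₀).le.trans ht₂.le) (ht₂b ⟨ht₂, le_rfl⟩).1 ?_
    intro t ht
    rcases lt_trichotomy t (te ε₀) with h | h | h
    · intro h3
      exact (E.mem_frontier_iff.1 (hKf h3)).2 ((hte ε₀ hε₀).2.2 t ⟨hη.trans_le ht.1, h⟩)
    · rw [h]
      exact hne
    · exact (ht₂b ⟨h, ht.2⟩).2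
  -- Both "not on `K₁`" and "not on `K₂`" are open conditions and they are complementary, so the
  -- type of exit is constant on the connected set `(0, δ]`.
  have hconst : ∀ ε ∈ Ioc 0 δ, ∀ ε' ∈ Ioc 0 δ,
      Z ε (te ε) (E.O E.sb) ∈ K₁ ↔ Z ε' (te ε') (E.O E.sb) ∈ K₁ := by
    intro ε hε ε' hε'
    refine isPreconnected_Ioc.induction₂' (fun ε ε' =>
      (Z ε (te ε) (E.O E.sb) ∈ K₁ ↔ Z ε' (te ε') (E.O E.sb) ∈ K₁)) (fun ε hε => ?_)
      (fun _ _ _ _ _ _ h h' => h.trans h') hε hε'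
    by_cases h : Z ε (te ε) (E.O E.sb) ∈ K₁
    · have h1 := ((hcases ε hε).2).1 h
      filter_upwards [(hopen K₂ hK₂c hK₂f ε hε h1).filter_mono nhdsWithin_le_nhds,
        self_mem_nhdsWithin] with ε' h2 h3
      have h4 := (hcases ε' h3).2.2 (h2 h3)
      exact ⟨iff_of_true h h4, iff_of_true h4 h⟩
    · filter_upwards [(hopen K₁ hK₁c hK₁f ε hε h).filter_mono nhdsWithin_le_nhds,
        self_mem_nhdsWithin] with ε' h2 h3
      have h4 := h2 h3
      exact ⟨iff_of_false h h4, iff_of_false h4 h⟩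
  -- for `ε = δ` the exit is on the tangent edge
  have hδmem : δ ∈ Ioc 0 δ := ⟨hδ, le_rfl⟩
  have hδK : Z δ (te δ) (E.O E.sb) ∈ K₁ := by
    refine (hcases δ hδmem).2.2 (hO _ ⟨(hte δ hδmem).1, ?_⟩)
    by_contra hcon
    exact hout ((hte δ hδmem).2.2 t₁ ⟨ht₁, not_le.1 hcon⟩)
  -- for small `ε` it is on the orthogonal edge
  have hzero : ∀ᶠ ε in 𝓝 (0 : ℝ), ε ∈ Ioc 0 δ → Z ε (te ε) (E.O E.sb) ∉ K₁ := by
    obtain ⟨B, hB⟩ := E.box_a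
    have h1 := E.above_out hZ ⟨le_rfl, E.sb_pos⟩ B (fun x hx h h' =>
      ((hB x hx).1 h').elim (fun h2 => absurd h (not_lt.2 h2.2)) fun h2 => h.ne' h2.1)
    have h2 : ∀ᶠ t in 𝓝[>] (0 : ℝ), Z 0 t (E.O 0) ∉ E.F := by
      filter_upwards [B.eventually_cone (t₀ := 0) (hZ.velocity 0 (E.O 0))
        (by rw [hZ.zero]; exact B.mem_source)] with t ht
      rw [hZ.zero, B.map_center] at ht
      exact h1 _ ht.1 ht.2.1
    obtain ⟨η', hη', hη'b⟩ := (mem_nhdsGT_iff_exists_Ioc_subset (a := (0 : ℝ))).1 h2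
    rw [mem_Ioi] at hη'
    set τ := E.T - E.tb with hτ
    have hτ0 : 0 < τ := sub_pos.2 E.tb_lt
    have hz1 : ∀ t, Z 0 t (E.O E.sb) = E.A (t + E.tb) := fun t => by rw [E.A_eq hZ, E.map_b]
    have hz2 : ∀ t, Z 0 (t + τ) (E.O E.sb) = Z 0 t (E.O 0) := fun t => by
      rw [hZ.add, hz1, hτ, sub_add_cancel, E.map_a]
    have hFout : ∀ t ∈ Ioc 0 η', Z 0 (t + τ) (E.O E.sb) ∉ E.F := fun t ht => by
      rw [hz2]
      exact hη'b ht
    -- Otherwise the trajectories with `0 < ε ≤ δ` would be in the interior at time `η' + τ`, and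
    -- letting `ε` tend to `0` would put a point known to be outside into the closed set `F`.
    have hητ : η ≤ η' + τ := by
      by_contra hcon
      rw [not_le] at hcon
      refine hFout η' ⟨hη', le_rfl⟩ ?_
      have hlim : Tendsto (fun ε => Z ε (η' + τ) (E.O E.sb)) (𝓝[>] 0)
          (𝓝 (Z 0 (η' + τ) (E.O E.sb))) :=
        ((hZ.cont.comp (by fun_prop : Continuous fun ε : ℝ => (ε, η' + τ, E.O E.sb))).tendsto 0
          ).mono_left nhdsWithin_le_nhds
      refine E.isClosed.mem_of_tendsto hlim ?_
      filter_upwards [Ioc_mem_nhdsGT hδ] with ε hε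
      exact interior_subset (hηU ε hε _ ⟨by linarith, hcon.le⟩)
    refine hpersist K₁ hK₁c 0 (η' + τ) hητ (hFout η' ⟨hη', le_rfl⟩) ?_
    intro t ht hmem
    rcases le_or_gt t τ with h | h
    · obtain ⟨t', ht', hte⟩ := hmem
      rw [hz1] at hte
      have := E.injA ⟨ht'.1, ht'.2.trans E.tb_lt.le⟩
        ⟨by linarith [ht.1, E.tb_pos], by linarith⟩ hte
      linarith [ht'.2, ht.1]
    · refine hFout (t - τ) ⟨by linarith, by linarith [ht.2]⟩ ?_
      rw [sub_add_cancel]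
      exact (E.mem_frontier_iff.1 (hK₁f hmem)).1
  obtain ⟨ε, hε, hεI⟩ := ((hzero.filter_mono (nhdsWithin_le_nhds (s := Ioi 0))).and
    (Ioc_mem_nhdsGT hδ)).exists
  exact hε hεI ((hconst δ hδmem ε hεI).1 hδK)

/-- A box containing the orthogonal edge and small with respect to `δ` forces the trajectory of
`X + δ W` starting at the vertex to meet the tangent edge first. -/
theorem exists_crossing (hZ : IsFlowFamily X W Z) {p : M} (B : TransverseBox X W p) {δ : ℝ}
    (hδ : 0 < δ) (hO : ∀ s ∈ Icc 0 E.L, E.O s ∈ B.ψ.source)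
    (hsmall : ∀ s ∈ Icc 0 E.L, (B.ψ (E.O s)).2 < B.κ / 2 ∧
      1 * B.hi / (δ * B.lo) * (2 * |(B.ψ (E.O s)).1|) < B.κ / 2) :
    ∃ t₁ > 0, Z δ t₁ (E.O E.sb) ∉ interior E.F ∧
      ∀ t ∈ Ioc 0 t₁, Z δ t (E.O E.sb) ∉ E.O '' Icc 0 E.L := by
  have hsbI : E.sb ∈ Icc 0 E.L := ⟨E.sb_pos.le, E.sb_lt.le⟩
  have hLI : E.L ∈ Icc 0 E.L := ⟨E.L_pos.le, le_rfl⟩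
  set Q := 1 * B.hi / (δ * B.lo) with hQ
  have hlo := B.lo_pos
  have hhi : 0 < B.hi := hlo.trans_le ((B.p_mem _ B.mem_source).1.trans (B.p_mem _ B.mem_source).2)
  have hQ0 : 0 ≤ Q := by positivity
  have hv : ∀ s ∈ Icc 0 E.L, (B.ψ (E.O s)).2 = (B.ψ (E.O E.sb)).2 := by
    intro s hs
    have h1 : ∀ s ∈ Icc 0 E.L, (B.ψ (E.O s)).2 = (B.ψ (E.O 0)).2 := fun s hs =>
      B.snd_eq hs.1 (fun s _ => E.velO' s) (fun s' hs' => hO s' ⟨hs'.1, hs'.2.trans hs.2⟩)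
    rw [h1 s hs, h1 _ hsbI]
  have hu : (B.ψ (E.O E.sb)).1 < (B.ψ (E.O E.L)).1 :=
    B.fst_lt E.sb_lt (fun s _ => E.velO' s) (fun s' hs' => hO s' ⟨hsbI.1.trans hs'.1, hs'.2⟩) one_pos
  have hκ := B.κ_pos
  have hdist : (B.ψ (E.O E.L)).1 - (B.ψ (E.O E.sb)).1
      ≤ 2 * max |(B.ψ (E.O E.L)).1| |(B.ψ (E.O E.sb)).1| := by
    have h1 := le_abs_self (B.ψ (E.O E.L)).1
    have h2 := neg_abs_le (B.ψ (E.O E.sb)).1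
    have h3 := le_max_left |(B.ψ (E.O E.L)).1| |(B.ψ (E.O E.sb)).1|
    have h4 := le_max_right |(B.ψ (E.O E.L)).1| |(B.ψ (E.O E.sb)).1|
    linarith
  have hbound : Q * ((B.ψ (E.O E.L)).1 - (B.ψ (E.O E.sb)).1) < B.κ / 2 := by
    refine (mul_le_mul_of_nonneg_left hdist hQ0).trans_lt ?_
    rcases max_choice |(B.ψ (E.O E.L)).1| |(B.ψ (E.O E.sb)).1| with h | h
    · rw [h]
      exact (hsmall _ hLI).2
    · rw [h]
      exact (hsmall _ hsbI).2
  -- The trajectory reaches the vertical line through `c`: the edge is so short that the slope bound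
  -- lets it climb less than `κ / 2` on the way. Climbing strictly, it does not meet the horizontal
  -- orthogonal edge again.
  obtain ⟨t₁, ht₁, hsrc, hu₁⟩ := B.reach (u₁ := (B.ψ (E.O E.L)).1) (hZ.vel_smul δ (E.O E.sb))
    (by rw [hZ.zero]; exact hO _ hsbI) zero_le_one hδ (by rwa [hZ.zero])
    (abs_lt.1 (B.abs_lt_of_mem (hO _ hLI)).1).2
    (by
      rw [hZ.zero]
      linarith [(hsmall _ hsbI).1])
  have hv₁ : ∀ t ∈ Ioc 0 t₁, (B.ψ (E.O E.sb)).2 < (B.ψ (Z δ t (E.O E.sb))).2 := by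
    intro t ht
    have := B.snd_lt ht.1 (fun s _ => hZ.vel_smul δ (E.O E.sb) s)
      (fun s hs => hsrc s ⟨hs.1, hs.2.trans ht.2⟩) one_pos
    rwa [hZ.zero] at this
  refine ⟨t₁, ht₁, ?_, ?_⟩
  · have hx₁ := hsrc t₁ ⟨ht₁.le, le_rfl⟩
    obtain ⟨t₂, ht₂, hsrc₂, hv₂⟩ := B.swap.reach (γ := E.A) (α := 0) (β := 1)
      (u₁ := (B.ψ (Z δ t₁ (E.O E.sb))).2)
      (fun t => by rw [add_comm]; exact E.velA' t) (by rw [E.map_c]; exact hO _ hLI) le_rfl one_pos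
      (by
        rw [E.map_c, B.swap_apply, hv _ hLI]
        exact hv₁ t₁ ⟨ht₁, le_rfl⟩)
      (abs_lt.1 (B.abs_lt_of_mem hx₁).2).2
      (by
        rw [E.map_c, B.swap_apply]
        have : (B.ψ (E.O E.L)).1 < B.swap.κ := (abs_lt.1 (B.abs_lt_of_mem (hO _ hLI)).1).2
        simpa using this)
    have hfst : (B.ψ (E.A t₂)).1 = (B.ψ (E.O E.L)).1 := by
      rw [← E.map_c]
      exact B.fst_eq ht₂.le (fun s _ => E.velA' s) hsrc₂
    have heq : E.A t₂ = Z δ t₁ (E.O E.sb) :=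
      B.ψ.injOn (hsrc₂ t₂ ⟨ht₂.le, le_rfl⟩) hx₁ (Prod.ext (hfst.trans hu₁.symm) hv₂)
    have ht₂b : t₂ ≤ E.tb := by
      by_contra hcon
      rw [not_le] at hcon
      have h1 := B.snd_lt E.tb_pos (fun s _ => E.velA' s)
        (fun s hs => hsrc₂ s ⟨hs.1, hs.2.trans hcon.le⟩) one_pos
      rw [E.map_c, E.map_b, hv _ hLI] at h1
      exact lt_irrefl _ h1
    rw [← heq]
    exact (E.mem_frontier_iff.1 (E.A_mem ⟨ht₂.le, ht₂b.trans E.tb_lt.le⟩)).2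
  · rintro t ht ⟨s, hs, hst⟩
    have h1 := hv₁ t ht
    rw [← hst, hv s hs] at h1
    exact lt_irrefl _ h1

end FigureEight
end

/-! ### The field `X^⊥` is of class `C^r`. -/

/-- The coordinates of the vector orthogonal to a given vector for a scalar product of the plane. -/
theorem perp_coordinates {E F H a b c d σ : ℝ} (hpos : ∀ x y : ℝ, (x ≠ 0 ∨ y ≠ 0) →
      0 < E * x * x + 2 * F * x * y + H * y * y)
    (hnorm : E * a * a + 2 * F * a * b + H * b * b = E * c * c + 2 * F * c * d + H * d * d)
    (horth : E * a * c + F * (a * d + b * c) + H * b * d = 0)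
    (hσ : σ = 1 ∨ σ = -1) (hdet : 0 < σ * (a * d - b * c)) :
    c = σ * (√(E * H - F * F))⁻¹ * (-(F * a + H * b)) ∧
      d = σ * (√(E * H - F * F))⁻¹ * (E * a + F * b) := by
  have hE : 0 < E := by simpa using hpos 1 0 (Or.inl one_ne_zero)
  have hD : 0 < E * H - F * F := by
    have h := hpos (-F) E (Or.inr hE.ne')
    have h2 : E * -F * -F + 2 * F * -F * E + H * E * E = E * (E * H - F * F) := by ring
    rw [h2] at h
    exact pos_of_mul_pos_right h hE.le
  have hab : a ≠ 0 ∨ b ≠ 0 := by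
    by_contra hcon
    push Not at hcon
    rw [hcon.1, hcon.2] at hdet
    simp at hdet
  have hq := hpos a b hab
  set q := E * a * a + 2 * F * a * b + H * b * b with hqdef
  set Δ := a * d - b * c with hΔ
  have hσ2 : σ * σ = 1 := by rcases hσ with rfl | rfl <;> norm_num
  -- Orthogonality and the value `Δ` of the determinant form a linear system for `(c, d)` whose
  -- determinant is `q`, the squared length of `(a, b)`.
  have hc : c * q = -(Δ * (F * a + H * b)) := by
    rw [hqdef, hΔ]
    linear_combination (a) * horth
  have hd : d * q = Δ * (E * a + F * b) := by
    rw [hqdef, hΔ]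
    linear_combination (b) * horth
  have hsq : q * q = Δ * Δ * (E * H - F * F) := by
    have h1 : (E * (c * q) * (c * q) + 2 * F * (c * q) * (d * q) + H * (d * q) * (d * q)) =
        q * (q * q) := by
      have : E * (c * q) * (c * q) + 2 * F * (c * q) * (d * q) + H * (d * q) * (d * q)
        = (E * c * c + 2 * F * c * d + H * d * d) * (q * q) := by ring
      rw [this, ← hnorm]
    rw [hc, hd] at h1
    have h2 : E * -(Δ * (F * a + H * b)) * -(Δ * (F * a + H * b)) +
        2 * F * -(Δ * (F * a + H * b)) * (Δ * (E * a + F * b)) +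
        H * (Δ * (E * a + F * b)) * (Δ * (E * a + F * b))
        = q * (Δ * Δ * (E * H - F * F)) := by rw [hqdef]; ring
    rw [h2] at h1
    exact (mul_left_cancel₀ hq.ne' h1).symm
  -- Equality of lengths determines `Δ` up to sign, and the orientation `σ` determines the sign.
  have hroot : q = σ * Δ * √(E * H - F * F) := by
    refine (sq_eq_sq₀ hq.le (mul_nonneg hdet.le (Real.sqrt_nonneg _))).1 ?_
    rw [mul_pow, Real.sq_sqrt hD.le]
    calc q ^ 2 = Δ * Δ * (E * H - F * F) := by rw [sq, hsq]
      _ = (σ * σ) * (Δ * Δ * (E * H - F * F)) := by rw [hσ2, one_mul]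
      _ = _ := by ring
  have hs : 0 < √(E * H - F * F) := Real.sqrt_pos.2 hD
  have hfac : σ * (√(E * H - F * F))⁻¹ * q = Δ := by
    rw [hroot]
    calc σ * (√(E * H - F * F))⁻¹ * (σ * Δ * √(E * H - F * F))
        = (σ * σ) * Δ * ((√(E * H - F * F))⁻¹ * √(E * H - F * F)) := by ring
      _ = Δ := by rw [hσ2, inv_mul_cancel₀ hs.ne']; ring
  constructor
  · refine mul_right_cancel₀ hq.ne' ?_
    rw [hc, ← hfac]
    ring
  · refine mul_right_cancel₀ hq.ne' ?_
    rw [hd, ← hfac]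
    ring

section

variable {M : Type*} [TopologicalSpace M] [ChartedSpace Plane M] [IsManifold (𝓡 2) ∞ M]

/-- Trivializations of the tangent bundle preserve or reverse the orientation locally. -/
theorem SurfaceOrientation.exists_sign (o : SurfaceOrientation M) (x₀ : M) :
    ∃ σ : ℝ, (σ = 1 ∨ σ = -1) ∧ ∀ᶠ x in 𝓝 x₀,
      ∀ hx : x ∈ (trivializationAt Plane (fun x : M => TangentSpace (𝓡 2) x) x₀).baseSet,
      ∀ v w : TangentSpace (𝓡 2) x, o.IsPositiveBasis x v w →
      0 < σ * (((trivializationAt Plane (fun x : M => TangentSpace (𝓡 2) x)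
          x₀).continuousLinearEquivAt ℝ x hx v) 0 *
          ((trivializationAt Plane (fun x : M => TangentSpace (𝓡 2) x)
            x₀).continuousLinearEquivAt ℝ x hx w) 1 -
        ((trivializationAt Plane (fun x : M => TangentSpace (𝓡 2) x)
          x₀).continuousLinearEquivAt ℝ x hx v) 1 *
          ((trivializationAt Plane (fun x : M => TangentSpace (𝓡 2) x)
            x₀).continuousLinearEquivAt ℝ x hx w) 0) := by
  obtain ⟨o', ho'⟩ := o.locally_const x₀
  let bs := (EuclideanSpace.basisFun (Fin 2) ℝ).toBasis
  have hdet : ∀ b : Module.Basis (Fin 2) ℝ Plane, bs.det b = b 0 0 * b 1 1 - b 0 1 * b 1 0 := by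
    intro b
    rw [Module.Basis.det_apply, Matrix.det_fin_two]
    simp [Module.Basis.toMatrix_apply, bs]
    ring
  have key : ∀ x, ∀ hx : x ∈ (trivializationAt Plane (fun x : M => TangentSpace (𝓡 2) x) x₀).baseSet,
      Orientation.map (Fin 2) ((trivializationAt Plane (fun x : M => TangentSpace (𝓡 2) x)
        x₀).continuousLinearEquivAt ℝ x hx).toLinearEquiv (o.at_point x) = o' →
      ∀ v w : TangentSpace (𝓡 2) x, o.IsPositiveBasis x v w →
      ∃ b : Module.Basis (Fin 2) ℝ Plane, b.orientation = o' ∧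
        b 0 = (trivializationAt Plane (fun x : M => TangentSpace (𝓡 2) x)
          x₀).continuousLinearEquivAt ℝ x hx v ∧
        b 1 = (trivializationAt Plane (fun x : M => TangentSpace (𝓡 2) x)
          x₀).continuousLinearEquivAt ℝ x hx w := by
    rintro x hx ho v w ⟨b, rfl, rfl, hb⟩
    refine ⟨b.map ((trivializationAt Plane (fun x : M => TangentSpace (𝓡 2) x)
        x₀).continuousLinearEquivAt ℝ x hx).toLinearEquiv, ?_, ?_, ?_⟩
    · rw [Module.Basis.orientation_map, hb, ho]
    · rw [Module.Basis.map_apply]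
      rfl
    · rw [Module.Basis.map_apply]
      rfl
  by_cases hor : bs.orientation = o'
  · refine ⟨1, Or.inl rfl, ?_⟩
    filter_upwards [ho'] with x hx hxb v w hvw
    obtain ⟨b, hb, hb0, hb1⟩ := key x hxb (hx hxb) v w hvw
    have h1 := (bs.orientation_eq_iff_det_pos b).1 (hor.trans hb.symm)
    rw [hdet] at h1
    rw [one_mul, ← hb0, ← hb1]
    exact h1
  · refine ⟨-1, Or.inr rfl, ?_⟩
    filter_upwards [ho'] with x hx hxb v w hvw
    obtain ⟨b, hb, hb0, hb1⟩ := key x hxb (hx hxb) v w hvw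
    have h1 : ¬ 0 < bs.det b := fun h =>
      hor (((bs.orientation_eq_iff_det_pos b).2 h).trans hb)
    have h2 : bs.det b ≠ 0 := (bs.isUnit_det b).ne_zero
    have h3 : bs.det b < 0 := lt_of_le_of_ne (not_lt.1 h1) h2
    rw [hdet] at h3
    rw [← hb0, ← hb1]
    linarith

theorem IsPerp.eq_zero {g : SurfaceMetric M} {o : SurfaceOrientation M}
    {X Xp : (x : M) → TangentSpace (𝓡 2) x} (h : IsPerp g o X Xp) {x : M} (hx : X x = 0) :
    Xp x = 0 := by
  by_contra hne
  have h1 := (h x).1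
  have h2 := g.pos x (Xp x) hne
  rw [← h1, hx] at h2
  simp at h2

theorem IsPerp.linearIndependent {g : SurfaceMetric M} {o : SurfaceOrientation M}
    {X Xp : (x : M) → TangentSpace (𝓡 2) x} (h : IsPerp g o X Xp) {x : M} (hx : X x ≠ 0) :
    LinearIndependent ℝ ![X x, Xp x] := by
  obtain ⟨b, hb0, hb1, -⟩ := ((h x).2 hx).2
  have h1 := b.linearIndependent
  have h2 : (⇑b : Fin 2 → TangentSpace (𝓡 2) x) = ![X x, Xp x] := by
    funext i
    fin_cases i
    · exact hb0
    · exact hb1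
  rwa [h2] at h1

/-- The field `X^⊥` is of the same class as `X`. -/
theorem IsPerp.contMDiff {g : SurfaceMetric M} {o : SurfaceOrientation M} {r : ℕ∞}
    {X : VField r M} {Xp : (x : M) → TangentSpace (𝓡 2) x} (h : IsPerp g o (fun x => X x) Xp) :
    ContMDiff (𝓡 2) ((𝓡 2).prod 𝓘(ℝ, Plane)) r
      (fun x => Bundle.TotalSpace.mk' Plane (E := fun x : M => TangentSpace (𝓡 2) x) x (Xp x)) := by
  have := isManifold_coe (M := M) r
  have := contMDiffVectorBundle_tangent (M := M) r
  intro x₀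
  set e := trivializationAt Plane (fun x : M => TangentSpace (𝓡 2) x) x₀ with he
  have hx₀ : x₀ ∈ e.baseSet := mem_baseSet_trivializationAt Plane _ x₀
  let bs := (EuclideanSpace.basisFun (Fin 2) ℝ).toBasis
  let s : Fin 2 → (x : M) → TangentSpace (𝓡 2) x := e.localFrame bs
  have hs : ∀ i, ContMDiffAt (𝓡 2) ((𝓡 2).prod 𝓘(ℝ, Plane)) r
      (fun x => Bundle.TotalSpace.mk' Plane (E := fun x : M => TangentSpace (𝓡 2) x) x (s i x)) x₀ :=
    fun i => contMDiffAt_localFrame_of_mem (r : ℕ∞ω) e bs i hx₀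
  have hg : ContMDiffAt (𝓡 2) ((𝓡 2).prod 𝓘(ℝ, Plane →L[ℝ] Plane →L[ℝ] ℝ)) r
      (fun x => Bundle.TotalSpace.mk' (Plane →L[ℝ] Plane →L[ℝ] ℝ)
        (E := fun x : M => TangentSpace (𝓡 2) x →L[ℝ] TangentSpace (𝓡 2) x →L[ℝ] ℝ)
        x (g.inner x)) x₀ := (g.contMDiff x₀).of_le (by exact_mod_cast le_top)
  let G : Fin 2 → Fin 2 → M → ℝ := fun i j x => g.inner x (s i x) (s j x)
  have hG : ∀ i j, ContMDiffAt (𝓡 2) 𝓘(ℝ, ℝ) r (G i j) x₀ := by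
    intro i j
    have h1 : ContMDiffAt (𝓡 2) ((𝓡 2).prod 𝓘(ℝ, ℝ)) r
        (fun x => Bundle.TotalSpace.mk' ℝ (E := Bundle.Trivial M ℝ) x (g.inner x (s i x) (s j x)))
        x₀ := by
      apply ContMDiffAt.clm_bundle_apply₂ (F₁ := Plane) (F₂ := Plane)
      · exact hg
      · exact hs i
      · exact hs j
    simp only [Bundle.contMDiffAt_totalSpace] at h1
    exact h1.2
  have hL : ∀ x (hx : x ∈ e.baseSet) i, e.continuousLinearEquivAt ℝ x hx (s i x) = bs i := by
    intro x hx i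
    have : s i x = (e.continuousLinearEquivAt ℝ x hx).symm (bs i) := by
      simp only [s]
      rw [e.localFrame_apply_of_mem_baseSet bs hx]
      rfl
    rw [this, ContinuousLinearEquiv.apply_symm_apply]
  have hdecomp : ∀ x (hx : x ∈ e.baseSet) (v : TangentSpace (𝓡 2) x),
      v = (e.continuousLinearEquivAt ℝ x hx v) 0 • s 0 x
        + (e.continuousLinearEquivAt ℝ x hx v) 1 • s 1 x := by
    intro x hx v
    apply (e.continuousLinearEquivAt ℝ x hx).injective
    rw [map_add, map_smul, map_smul, hL, hL]
    have := bs.sum_repr (e.continuousLinearEquivAt ℝ x hx v)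
    rw [Fin.sum_univ_two] at this
    exact this.symm
  have hinner : ∀ x (v w : TangentSpace (𝓡 2) x) (a b c d : ℝ), v = a • s 0 x + b • s 1 x →
      w = c • s 0 x + d • s 1 x →
      g.inner x v w = G 0 0 x * a * c + G 0 1 x * (a * d + b * c) + G 1 1 x * b * d := by
    rintro x v w a b c d rfl rfl
    have : g.inner x (s 1 x) (s 0 x) = g.inner x (s 0 x) (s 1 x) := g.symm x _ _
    simp only [map_add, map_smul, add_apply, smul_apply,
      smul_eq_mul, this, G]
    ring
  have hpos : ∀ x (_ : x ∈ e.baseSet) (a b : ℝ), (a ≠ 0 ∨ b ≠ 0) →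
      0 < G 0 0 x * a * a + 2 * G 0 1 x * a * b + G 1 1 x * b * b := by
    intro x hx a b hab
    have hne : a • s 0 x + b • s 1 x ≠ 0 := by
      intro h0
      have h1 : a • bs 0 + b • bs 1 = 0 := by
        rw [← hL x hx, ← hL x hx, ← map_smul, ← map_smul, ← map_add, h0]
        exact (e.continuousLinearEquivAt ℝ x hx).map_zero
      have h2 : a = 0 := by simpa [bs] using congrArg (fun z : Plane => z 0) h1
      have h3 : b = 0 := by simpa [bs] using congrArg (fun z : Plane => z 1) h1
      tauto
    have h1 := g.pos x _ hne
    rw [hinner x _ _ a b a b rfl rfl] at h1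
    linarith
  have hX : ContMDiffAt (𝓡 2) 𝓘(ℝ, Plane) r
      (fun x => (e ⟨x, X x⟩).2) x₀ := (Bundle.contMDiffAt_section x₀).1 (X.contMDiff x₀)
  have hcoord : ∀ i, ContMDiffAt (𝓡 2) 𝓘(ℝ, ℝ) r (fun x => (e ⟨x, X x⟩).2 i) x₀ := fun i =>
    (EuclideanSpace.proj (𝕜 := ℝ) i).contDiff.contMDiff.contMDiffAt.comp x₀ hX
  obtain ⟨σ, hσ, hev⟩ := o.exists_sign x₀
  let k : M → ℝ := fun x => σ * (√(G 0 0 x * G 1 1 x - G 0 1 x * G 0 1 x))⁻¹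
  have hDpos : ∀ x ∈ e.baseSet, 0 < G 0 0 x * G 1 1 x - G 0 1 x * G 0 1 x := by
    intro x hx
    have hE : 0 < G 0 0 x := by simpa using hpos x hx 1 0 (Or.inl one_ne_zero)
    have h := hpos x hx (-G 0 1 x) (G 0 0 x) (Or.inr hE.ne')
    have h2 : G 0 0 x * -G 0 1 x * -G 0 1 x + 2 * G 0 1 x * -G 0 1 x * G 0 0 x
        + G 1 1 x * G 0 0 x * G 0 0 x = G 0 0 x * (G 0 0 x * G 1 1 x - G 0 1 x * G 0 1 x) := by ring
    rw [h2] at h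
    exact pos_of_mul_pos_right h hE.le
  have hk : ContMDiffAt (𝓡 2) 𝓘(ℝ, ℝ) r k x₀ := by
    have h1 : ContMDiffAt (𝓡 2) 𝓘(ℝ, ℝ) r
        (fun x => G 0 0 x * G 1 1 x - G 0 1 x * G 0 1 x) x₀ :=
      ((hG 0 0).mul (hG 1 1)).sub ((hG 0 1).mul (hG 0 1))
    have h2 : ContDiffAt ℝ r (fun z : ℝ => σ * (√z)⁻¹)
        (G 0 0 x₀ * G 1 1 x₀ - G 0 1 x₀ * G 0 1 x₀) := by
      have hp := hDpos x₀ hx₀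
      exact contDiffAt_const.mul ((Real.contDiffAt_sqrt hp.ne').inv (Real.sqrt_pos.2 hp).ne')
    exact ContMDiffAt.comp (g := fun z : ℝ => σ * (√z)⁻¹) x₀ h2.contMDiffAt h1
  rw [Bundle.contMDiffAt_section]
  let f : M → Plane := fun x =>
    (k x * (-(G 0 1 x * (e ⟨x, X x⟩).2 0 + G 1 1 x * (e ⟨x, X x⟩).2 1))) • bs 0
      + (k x * (G 0 0 x * (e ⟨x, X x⟩).2 0 + G 0 1 x * (e ⟨x, X x⟩).2 1)) • bs 1
  have hf : ContMDiffAt (𝓡 2) 𝓘(ℝ, Plane) r f x₀ := by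
    refine ContMDiffAt.add (ContMDiffAt.smul (hk.mul ?_) contMDiffAt_const)
      (ContMDiffAt.smul (hk.mul ?_) contMDiffAt_const)
    · exact (((hG 0 1).mul (hcoord 0)).add ((hG 1 1).mul (hcoord 1))).neg
    · exact ((hG 0 0).mul (hcoord 0)).add ((hG 0 1).mul (hcoord 1))
  refine hf.congr_of_eventuallyEq ?_
  filter_upwards [hev, e.open_baseSet.mem_nhds hx₀] with x hx hxb
  have hLa : ∀ v : TangentSpace (𝓡 2) x, (e ⟨x, v⟩).2 = e.continuousLinearEquivAt ℝ x hxb v :=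
    fun v => rfl
  change (e ⟨x, Xp x⟩).2 = f x
  simp only [f]
  rw [hLa, hLa]
  have hrep : ∀ v : Plane, v = v 0 • bs 0 + v 1 • bs 1 := by
    intro v
    have := bs.sum_repr v
    rw [Fin.sum_univ_two] at this
    exact this.symm
  -- The formula is linear in `X`, so it also gives the value `0` of `X^⊥` at singularities, where
  -- the orientation condition says nothing.
  by_cases hX0 : X x = 0
  · have h1 : Xp x = 0 := h.eq_zero hX0
    rw [h1, hX0, map_zero]
    simp
  · obtain ⟨horth, hposb⟩ := (h x).2 hX0
    have hnorm := (h x).1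
    rw [hinner x _ _ _ _ _ _ (hdecomp x hxb (X x)) (hdecomp x hxb (X x)),
      hinner x _ _ _ _ _ _ (hdecomp x hxb (Xp x)) (hdecomp x hxb (Xp x))] at hnorm
    rw [hinner x _ _ _ _ _ _ (hdecomp x hxb (X x)) (hdecomp x hxb (Xp x))] at horth
    obtain ⟨h1, h2⟩ := perp_coordinates (hpos x hxb) (by linarith) horth hσ
      (hx hxb _ _ hposb)
    rw [hrep (e.continuousLinearEquivAt ℝ x hxb (Xp x))]
    exact congrArg₂ (fun c d : ℝ => c • bs 0 + d • bs 1) h1 h2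

end

/-! ### From figure-eight flow boxes to figure eights with coordinates. -/

theorem IsPreconnected.pos_or_neg {α : Type*} [TopologicalSpace α] {s : Set α}
    (hs : IsPreconnected s) {f : α → ℝ} (hf : ContinuousOn f s) (h0 : ∀ x ∈ s, f x ≠ 0) :
    (∀ x ∈ s, 0 < f x) ∨ ∀ x ∈ s, f x < 0 := by
  by_contra! hcon
  obtain ⟨⟨x, hx, hfx⟩, ⟨y, hy, hfy⟩⟩ := hcon
  obtain ⟨z, hz, hfz⟩ := hs.intermediate_value hx hy hf ⟨hfx, hfy⟩
  exact h0 z hz hfz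

section

variable {M : Type*} [TopologicalSpace M] [ChartedSpace Plane M] [IsManifold (𝓡 2) ∞ M]

theorem hasDerivAt_comp_of_hasVelocity {f : M → ℝ × ℝ} {γ : ℝ → M} {t : ℝ}
    {v : TangentSpace (𝓡 2) (γ t)} {D : TangentSpace (𝓡 2) (γ t) →L[ℝ] ℝ × ℝ}
    (hf : HasMFDerivAt (𝓡 2) 𝓘(ℝ, ℝ × ℝ) f (γ t) D) (h : HasVelocity γ t v) :
    HasDerivAt (fun s => f (γ s)) (D v) t := by
  let A : ℝ →L[ℝ] ℝ × ℝ := D.comp ((1 : ℝ →L[ℝ] ℝ).smulRight v)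
  have h2 : HasFDerivAt (fun s => f (γ s)) A t := (HasMFDerivAt.comp t hf h).hasFDerivAt
  refine h2.hasDerivAt.congr_deriv ?_
  change D ((1 : ℝ) • v) = D v
  rw [one_smul]

/-- The derivative of a `C^1` map along a continuous vector field is continuous. -/
theorem continuousAt_mfderiv_apply {r : ℕ∞} (W : VField r M) {f : M → ℝ × ℝ} {x₀ : M}
    {U : Set M} (hU : U ∈ 𝓝 x₀) (hf : ∀ x ∈ U, ContMDiffAt (𝓡 2) 𝓘(ℝ, ℝ × ℝ) 1 f x)
    {D : (x : M) → TangentSpace (𝓡 2) x →L[ℝ] ℝ × ℝ}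
    (hD : ∀ x ∈ U, HasMFDerivAt (𝓡 2) 𝓘(ℝ, ℝ × ℝ) f x (D x)) :
    ContinuousAt (fun x => D x (W x)) x₀ := by
  have := isManifold_one (M := M)
  set c := extChartAt (𝓡 2) x₀ with hc
  have hx₀ : x₀ ∈ (chartAt Plane x₀).source := mem_chart_source Plane x₀
  let h : Plane → ℝ × ℝ := fun y => f (c.symm y)
  have hy₀ : c x₀ ∈ c.target := mem_extChartAt_target (I := 𝓡 2) x₀
  have hh : ∀ x ∈ U, x ∈ (chartAt Plane x₀).source → ContDiffAt ℝ 1 h (c x) := by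
    intro x hx hxs
    have hcs : ContMDiffAt 𝓘(ℝ, Plane) (𝓡 2) 1 c.symm (c x) :=
      (contMDiffOn_extChartAt_symm (I := 𝓡 2) x₀).contMDiffAt
        ((isOpen_extChartAt_target (I := 𝓡 2) x₀).mem_nhds (c.map_source (by simpa [hc] using hxs)))
    have h1 : ContMDiffAt (𝓡 2) 𝓘(ℝ, ℝ × ℝ) 1 f (c.symm (c x)) := by
      rw [c.left_inv (by simpa [hc] using hxs)]
      exact hf x hx
    exact (ContMDiffAt.comp (c x) h1 hcs).contDiffAt
  have hformula : ∀ x ∈ interior U, x ∈ (chartAt Plane x₀).source →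
      D x (W x) = fderiv ℝ h (c x) (localRep (fun x => W x) x₀ (c x)) := by
    intro x hx hxs
    rw [localRep_extChartAt _ hxs, chartDeriv_eq_mfderiv hxs]
    have h1 := (mdifferentiableAt_extChartAt (I := 𝓡 2) hxs).hasMFDerivAt
    have h2 := ((hh x (interior_subset hx) hxs).differentiableAt
      one_ne_zero).hasFDerivAt.hasMFDerivAt
    have h3 := HasMFDerivAt.comp x h2 h1
    have h4 : HasMFDerivAt (𝓡 2) 𝓘(ℝ, ℝ × ℝ) (h ∘ c) x (D x) := by
      refine (hD x (interior_subset hx)).congr_of_eventuallyEq ?_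
      filter_upwards [(chartAt Plane x₀).open_source.mem_nhds hxs] with x' hx'
      simp only [Function.comp, h]
      rw [c.left_inv (by simpa [hc] using hx')]
    have h5 := hasMFDerivAt_unique h4 h3
    rw [h5]
    rfl
  have hcont : ContinuousAt
      (fun x => fderiv ℝ h (c x) (localRep (fun x => W x) x₀ (c x))) x₀ := by
    have hcc : ContinuousAt c x₀ := continuousAt_extChartAt (I := 𝓡 2) x₀
    have h1 : ContinuousAt (fderiv ℝ h) (c x₀) :=
      ((hh x₀ (mem_of_mem_nhds hU) hx₀).fderiv_right (m := 0) (by simp)).continuousAt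
    have h2 : ContinuousAt (localRep (fun x => W x) x₀) (c x₀) :=
      (W.contDiffAt_localRep hy₀).continuousAt
    exact (h1.comp hcc).clm_apply (h2.comp hcc)
  refine hcont.congr ?_
  filter_upwards [interior_mem_nhds.2 hU, (chartAt Plane x₀).open_source.mem_nhds hx₀] with x h1 h2
  exact (hformula x h1 h2).symm

/-- Coordinates on a flow box: `π` is constant along `X` and increases along `W`, and `y` increases
along `X`. -/
theorem IsFlowBox.exists_coordinates {r : ℕ∞} (hr : 1 ≤ r) {X W : VField r M} {U : Set M}
    (h : IsFlowBox r (fun x => X x) U)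
    (hind : ∀ x, X x ≠ 0 → LinearIndependent ℝ ![X x, W x]) :
    U.Nonempty ∧ ∃ π y πrate yrate : M → ℝ, ContinuousOn π U ∧ ContinuousOn y U ∧
      (∀ x ∈ U, 0 < πrate x) ∧ (∀ x ∈ U, 0 < yrate x) ∧
      (∀ (γ : ℝ → M) (t ε : ℝ), γ t ∈ U → HasVelocity γ t (X (γ t) + ε • W (γ t)) →
        HasDerivAt (fun s => π (γ s)) (ε * πrate (γ t)) t) ∧
      (∀ (γ : ℝ → M) (t : ℝ), γ t ∈ U → HasVelocity γ t (X (γ t)) →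
        HasDerivAt (fun s => y (γ s)) (yrate (γ t)) t) := by
  have hr' : (1 : ℕ∞ω) ≤ (r : ℕ∞ω) := by exact_mod_cast hr
  have hr0 : (r : ℕ∞ω) ≠ 0 := (zero_lt_one.trans_le hr').ne'
  obtain ⟨φ, hsrc, htgt, hφ, hφs, hX⟩ := h
  subst htgt
  have hmd : φ.MDifferentiable 𝓘(ℝ, ℝ × ℝ) (𝓡 2) :=
    ⟨hφ.mdifferentiableOn hr0, hφs.mdifferentiableOn hr0⟩
  have hne : φ.target.Nonempty := by
    have : ((1 / 2, 1 / 2) : ℝ × ℝ) ∈ φ.source := by rw [hsrc]; norm_num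
    exact ⟨_, φ.map_source this⟩
  have hconn : IsPreconnected φ.target := by
    rw [← φ.image_source_eq_target]
    refine IsPreconnected.image ?_ _ φ.continuousOn
    rw [hsrc]
    exact isPreconnected_Ioo.prod isPreconnected_Ioo
  let D : (x : M) → TangentSpace (𝓡 2) x →L[ℝ] ℝ × ℝ := fun x =>
    mfderiv (𝓡 2) 𝓘(ℝ, ℝ × ℝ) φ.symm x
  have hD : ∀ x ∈ φ.target, HasMFDerivAt (𝓡 2) 𝓘(ℝ, ℝ × ℝ) φ.symm x (D x) := fun x hx =>
    (hmd.mdifferentiableAt_symm hx).hasMFDerivAt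
  have hDX : ∀ x ∈ φ.target, ∃ k : ℝ, 0 < k ∧ D x (X x) = (0, k) := by
    intro x hx
    obtain ⟨k, hk, hkX⟩ := hX _ (φ.map_target hx)
    have h1 : (D (φ (φ.symm x))) (mfderiv 𝓘(ℝ, ℝ × ℝ) (𝓡 2) φ (φ.symm x) ((0, 1) : ℝ × ℝ))
        = ((0, 1) : ℝ × ℝ) :=
      congrArg (fun A : ℝ × ℝ →L[ℝ] ℝ × ℝ => A (0, 1)) (hmd.symm_comp_deriv (φ.map_target hx))
    rw [hkX, map_smul, φ.right_inv hx] at h1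
    refine ⟨k⁻¹, inv_pos.2 hk, ?_⟩
    have h2 : D x (X x) = k⁻¹ • (k • D x (X x)) := by
      rw [smul_smul, inv_mul_cancel₀ hk.ne', one_smul]
    rw [h2, h1]
    simp
  have hinj : ∀ x ∈ φ.target, Function.Injective (D x) := fun x hx =>
    hmd.symm.mfderiv_injective hx
  have hX0 : ∀ x ∈ φ.target, X x ≠ 0 := by
    intro x hx h0
    obtain ⟨k, hk, hkX⟩ := hDX x hx
    rw [h0, map_zero] at hkX
    exact hk.ne (congrArg Prod.snd hkX)
  let w : M → ℝ := fun x => (D x (W x)).1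
  -- In the square `X` is vertical; if `W` were vertical too, the fields would be dependent.
  have hw0 : ∀ x ∈ φ.target, w x ≠ 0 := by
    intro x hx h0
    obtain ⟨k, hk, hkX⟩ := hDX x hx
    have h1 : D x (W x) = ((D x (W x)).2 / k) • D x (X x) := by
      rw [hkX]
      ext
      · simpa using h0
      · simp [hk.ne']
    rw [← map_smul] at h1
    have h2 := hinj x hx h1
    have h3 := hind x (hX0 x hx)
    rw [LinearIndependent.pair_iff] at h3
    have h4 := h3 (-((D x (W x)).2 / k)) 1 (by rw [one_smul, neg_smul, ← h2, neg_add_cancel])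
    exact one_ne_zero h4.2
  have hwc : ContinuousOn w φ.target := by
    intro x hx
    have h1 := continuousAt_mfderiv_apply W (f := φ.symm) (D := D) (φ.open_target.mem_nhds hx)
      (fun x' hx' => (hφs.contMDiffAt (φ.open_target.mem_nhds hx')).of_le hr') hD
    exact (continuous_fst.continuousAt.comp h1).continuousWithinAt
  -- The flow box may reverse the direction of `W`, but in the same way everywhere, since its domain
  -- is connected; `σ` corrects this.
  obtain ⟨σ, hσ⟩ : ∃ σ : ℝ, ∀ x ∈ φ.target, 0 < σ * w x := by
    rcases hconn.pos_or_neg hwc hw0 with h | h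
    · exact ⟨1, fun x hx => by rw [one_mul]; exact h x hx⟩
    · exact ⟨-1, fun x hx => by linarith [h x hx]⟩
  refine ⟨hne, fun x => σ * (φ.symm x).1, fun x => (φ.symm x).2, fun x => σ * w x,
    fun x => (D x (X x)).2, continuousOn_const.mul (continuous_fst.comp_continuousOn φ.continuousOn_symm),
    continuous_snd.comp_continuousOn φ.continuousOn_symm, hσ, fun x hx => ?_, ?_, ?_⟩
  · obtain ⟨k, hk, hkX⟩ := hDX x hx
    exact hk.trans_eq (congrArg Prod.snd hkX).symm
  · intro γ t ε ht hγ
    have h1 := hasDerivAt_comp_of_hasVelocity (hD _ ht) hγ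
    have h2 := ((ContinuousLinearMap.fst ℝ ℝ ℝ).hasFDerivAt.comp_hasDerivAt t h1).const_mul σ
    refine h2.congr_deriv ?_
    obtain ⟨k, -, hkX⟩ := hDX _ ht
    rw [map_add, map_smul, hkX]
    simp [w]
    ring
  · intro γ t ht hγ
    have h1 := hasDerivAt_comp_of_hasVelocity (hD _ ht) hγ
    exact (ContinuousLinearMap.snd ℝ ℝ ℝ).hasFDerivAt.comp_hasDerivAt t h1

variable [T2Space M]

/-- A curve through a zero of the field is constant, by uniqueness, and so not injective. -/
theorem ne_zero_of_injOn {r : ℕ∞} (hr : 1 ≤ r) (V : VField r M) {γ : ℝ → M} {T : ℝ} (hT : 0 < T)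
    (hγ : IsMIntegralCurve γ (fun x => V x)) (hinj : InjOn γ (Icc 0 T)) (t : ℝ) : V (γ t) ≠ 0 := by
  intro h0
  have := isManifold_one (M := M)
  have hconst : IsMIntegralCurve (fun _ : ℝ => γ t) (fun x => V x) := by
    intro s
    have h1 : (1 : ℝ →L[ℝ] ℝ).smulRight (V (γ t)) = 0 := by
      rw [h0]
      ext
      simp
    rw [h1]
    exact hasMFDerivAt_const (γ t) s
  have heq := isMIntegralCurve_Ioo_eq_of_contMDiff_boundaryless (t₀ := t)
    (VField.contMDiff_one hr V) hγ hconst rfl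
  have h1 : γ 0 = γ T := by rw [congrFun heq 0, congrFun heq T]
  exact hT.ne (hinj ⟨le_rfl, hT.le⟩ ⟨hT.le, le_rfl⟩ h1)

/-- Since `X` vanishes nowhere on the two arcs, boxes exist along the whole frontier. The parameters
of the intersection points are determined by injectivity of the arcs, and `b ≠ a`, `b ≠ c` make the
inequalities strict. -/
theorem exists_figureEight {r : ℕ∞} (hr : 1 ≤ r) {X W : VField r M}
    (hind : ∀ x, X x ≠ 0 → LinearIndependent ℝ ![X x, W x]) (hzero : ∀ x, X x = 0 → W x = 0)
    {F A O : Set M} {a b c : M} (hF : IsCompact F) (hU : IsFlowBox r (fun x => X x) (interior F))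
    (hA : IsTrajectoryArc (fun x => X x) A c a) (hO : IsTrajectoryArc (fun x => W x) O a c)
    (hfr : frontier F = A ∪ O) (hinter : A ∩ O = {a, b, c}) (hba : b ≠ a) (hbc : b ≠ c) :
    ∃ E : FigureEight (fun x => X x) (fun x => W x), E.O '' Icc 0 E.L = O := by
  obtain ⟨γA, T, hT, hγA, hA0, hAT, hAinj, rfl⟩ := hA
  obtain ⟨γO, L, hL, hγO, hO0, hOL, hOinj, rfl⟩ := hO
  obtain ⟨hne, π, y, πrate, yrate, h1, h2, h3, h4, h5, h6⟩ := hU.exists_coordinates hr hind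
  have hb : b ∈ γA '' Icc 0 T ∩ γO '' Icc 0 L := by rw [hinter]; simp
  obtain ⟨⟨tb, htb, htbe⟩, ⟨sb, hsb, hsbe⟩⟩ := hb
  have h0T : (0 : ℝ) ∈ Icc 0 T := ⟨le_rfl, hT.le⟩
  have hTT : T ∈ Icc 0 T := ⟨hT.le, le_rfl⟩
  have h0L : (0 : ℝ) ∈ Icc 0 L := ⟨le_rfl, hL.le⟩
  have hLL : L ∈ Icc 0 L := ⟨hL.le, le_rfl⟩
  refine ⟨⟨F, γA, γO, tb, T, sb, L, ?_, ?_, ?_, ?_, hF, hγA, hγO, hAinj, hOinj, htbe.trans hsbe.symm,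
    hAT.trans hO0.symm, hA0.trans hOL.symm, ?_, hfr, hne, ?_, π, y, h1, h2, πrate, yrate, h3, h4, h5,
    h6⟩, rfl⟩
  · refine lt_of_le_of_ne htb.1 fun h => hbc ?_
    rw [← htbe, ← h, hA0]
  · refine lt_of_le_of_ne htb.2 fun h => hba ?_
    rw [← htbe, h, hAT]
  · refine lt_of_le_of_ne hsb.1 fun h => hba ?_
    rw [← hsbe, ← h, hO0]
  · refine lt_of_le_of_ne hsb.2 fun h => hbc ?_
    rw [← hsbe, h, hOL]
  · intro t ht s hs hts
    have h7 : γA t ∈ γA '' Icc 0 T ∩ γO '' Icc 0 L := ⟨⟨t, ht, rfl⟩, ⟨s, hs, hts.symm⟩⟩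
    rw [hinter] at h7
    rcases h7 with h8 | h8 | h8
    · exact Or.inr (Or.inr ⟨hAinj ht hTT (h8.trans hAT.symm),
        hOinj hs h0L (hts.symm.trans (h8.trans hO0.symm))⟩)
    · exact Or.inr (Or.inl ⟨hAinj ht htb (h8.trans htbe.symm),
        hOinj hs hsb (hts.symm.trans (h8.trans hsbe.symm))⟩)
    · exact Or.inl ⟨hAinj ht h0T (h8.trans hA0.symm),
        hOinj hs hLL (hts.symm.trans (h8.trans hOL.symm))⟩
  · intro e he
    have hXe : X e ≠ 0 := by
      rw [hfr] at he
      rcases he with ⟨t, -, rfl⟩ | ⟨s, -, rfl⟩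
      · exact ne_zero_of_injOn hr X hT hγA hAinj t
      · exact fun h => ne_zero_of_injOn hr W hL hγO hOinj s (hzero _ h)
    obtain ⟨B, -⟩ := exists_transverseBox hr X W (hind e hXe) univ_mem
    exact ⟨B⟩

end

/-! ### Families of vector fields in the `C^r` topology. -/

/-- The slice is `g` preceded by a translation and the linear inclusion of the second factor. -/
theorem iteratedFDeriv_slice_right {P E F : Type*} [NormedAddCommGroup P] [NormedSpace ℝ P]
    [NormedAddCommGroup E] [NormedSpace ℝ E] [NormedAddCommGroup F] [NormedSpace ℝ F]
    {g : P × E → F} {q : P} {y : E} {k : ℕ} (h : ContDiffAt ℝ k g (q, y)) :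
    iteratedFDeriv ℝ k (fun y => g (q, y)) y =
      (iteratedFDeriv ℝ k g (q, y)).compContinuousLinearMap
        fun _ => ContinuousLinearMap.inr ℝ P E := by
  let g' : P × E → F := fun w => g ((q, 0) + w)
  let j := ContinuousLinearMap.inr ℝ P E
  have hj : ((q, 0) : P × E) + j y = (q, y) := by simp [j]
  have hg' : ContDiffAt ℝ k g' (j y) := by
    have h' : ContDiffAt ℝ k g ((q, 0) + j y) := by rwa [hj]
    exact h'.comp _ (contDiffAt_const.add contDiffAt_id)
  obtain ⟨u, huo, hyu, hu⟩ := hg'.contDiffWithinAt (s := univ).contDiffOn' le_rfl (by simp)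
  rw [insert_eq_of_mem (mem_univ _), univ_inter] at hu
  have hpo : IsOpen (j ⁻¹' u) := huo.preimage j.continuous
  have h1 := j.iteratedFDerivWithin_comp_right hu huo.uniqueDiffOn hpo.uniqueDiffOn hyu
    (i := k) le_rfl
  rw [iteratedFDerivWithin_of_isOpen k hpo hyu, iteratedFDerivWithin_of_isOpen k huo hyu,
    iteratedFDeriv_comp_add_left, hj] at h1
  have h2 : g' ∘ j = fun y => g (q, y) := by
    funext z
    simp [g', j]
  rw [h2] at h1
  exact h1

section Family

variable {M : Type*} [TopologicalSpace M] [ChartedSpace Plane M] [IsManifold (𝓡 2) ∞ M]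

/-- A family of vector fields depending on a parameter in such a way that its local representatives
are jointly of class `C^r` is continuous for the `C^r` topology. -/
theorem eventually_mem_of_contDiffAt_localRep {P : Type*} [NormedAddCommGroup P] [NormedSpace ℝ P]
    {r : ℕ∞} {X : VField r M} {Y : P → (x : M) → TangentSpace (𝓡 2) x} {N : Set P}
    (hN : N ∈ 𝓝 0) (h0 : ∀ x, Y 0 x = X x)
    (hY : ∀ q ∈ N, ∀ x₀ : M, ∀ y ∈ (extChartAt (𝓡 2) x₀).target,
      ContDiffAt ℝ r (fun w : P × Plane => localRep (Y w.1) x₀ w.2) (q, y))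
    {𝒱 : Set (VField r M)} (h𝒱 : 𝒱 ∈ 𝓝 X) :
    ∀ᶠ q in 𝓝 (0 : P), ∃ Z ∈ 𝒱, ∀ x, Z x = Y q x := by
  classical
  -- Outside `N` smoothness is not known; the value `X` there is arbitrary.
  let 𝒴 : P → VField r M := fun q => if hq : q ∈ N then
    ⟨Y q, fun x => contMDiffAt_section_of_localRep (by
      have h1 := hY q hq x _ (mem_extChartAt_target (I := 𝓡 2) x)
      exact h1.comp (f := fun y => (q, y)) _ (contDiffAt_const.prodMk contDiffAt_id))⟩ else X
  have h𝒴 : ∀ q ∈ N, ∀ x, 𝒴 q x = Y q x := by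
    intro q hq x
    simp only [𝒴, dif_pos hq]
    rfl
  have h𝒴' : ∀ q ∈ N, (fun x => 𝒴 q x) = Y q := fun q hq => funext (h𝒴 q hq)
  have h0N : (0 : P) ∈ N := mem_of_mem_nhds hN
  have hX : (fun x => X x) = Y 0 := funext fun x => (h0 x).symm
  suffices ht : Tendsto 𝒴 (𝓝 0) (𝓝 X) by
    filter_upwards [ht h𝒱, hN] with q hq hqN
    exact ⟨𝒴 q, hq, h𝒴 q hqN⟩
  change Tendsto 𝒴 (𝓝 0) (@nhds _ (⨅ (x₀ : M) (k : ℕ) (_ : (k : ℕ∞) ≤ r), _) X)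
  simp only [nhds_iInf, nhds_induced, tendsto_iInf, tendsto_comap_iff]
  intro x₀ k hk
  rw [UniformOnFun.tendsto_iff_tendstoUniformlyOn]
  rintro K ⟨hK, hKt⟩
  have hk' : (k : ℕ∞ω) ≤ (r : ℕ∞ω) := by exact_mod_cast hk
  let g : P × Plane → Plane := fun w => localRep (Y w.1) x₀ w.2
  let D : P × Plane → ContinuousMultilinearMap ℝ (fun _ : Fin k => Plane) Plane :=
    fun w => (iteratedFDeriv ℝ k g w).compContinuousLinearMap
      fun _ => ContinuousLinearMap.inr ℝ P Plane
  have hD : ∀ q ∈ N, ∀ y ∈ (extChartAt (𝓡 2) x₀).target,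
      iteratedFDeriv ℝ k (localRep (Y q) x₀) y = D (q, y) := fun q hq y hy =>
    iteratedFDeriv_slice_right (g := g) ((hY q hq x₀ y hy).of_le hk')
  have hDc : ∀ y ∈ (extChartAt (𝓡 2) x₀).target, ContinuousAt D (0, y) := by
    intro y hy
    have h1 : ContinuousAt (iteratedFDeriv ℝ k g) (0, y) :=
      (hY 0 h0N x₀ y hy).continuousAt_iteratedFDeriv hk'
    exact (ContinuousMultilinearMap.compContinuousLinearMapL (F := Plane)
      (fun _ : Fin k => ContinuousLinearMap.inr ℝ P Plane)).continuous.continuousAt.comp h1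
  rw [Metric.tendstoUniformlyOn_iff]
  intro η hη
  -- Joint continuity of the derivatives and compactness of `K` give uniform convergence on `K`.
  have key : ∀ᶠ q in 𝓝 (0 : P), ∀ y ∈ K, dist (D (0, y)) (D (q, y)) < η := by
    refine hK.eventually_forall_of_forall_eventually
      (P := fun q y => dist (D (0, y)) (D (q, y)) < η) fun y hy => ?_
    have h1 : ContinuousAt (fun w : P × Plane => D (0, w.2)) (0, y) :=
      ContinuousAt.comp (g := D) (f := fun w : P × Plane => ((0 : P), w.2)) (x := ((0 : P), y))
        (hDc y (hKt hy)) (by fun_prop)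
    have h2 := (h1.dist (hDc y (hKt hy)))
    have h3 : (fun w : P × Plane => dist (D (0, w.2)) (D w)) (0, y) < η := by simpa using hη
    exact h2.eventually_lt continuousAt_const h3
  filter_upwards [key, hN] with q hq hqN y hy
  have h1 := hq y hy
  rw [← hD q hqN y (hKt hy), ← hD 0 h0N y (hKt hy), ← h𝒴' q hqN, ← hX] at h1
  exact h1

end Family

/-! ### Pullback of fields under small displacements. -/

/-- The displacement `y ↦ y + χ y • v` of the plane, cut off by `χ`. -/
def displace (χ : Plane → ℝ) (v y : Plane) : Plane := y + χ y • v

/-- What has to be added to the field `a + ε • b` in order to obtain its pullback under the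
displacement `displace χ v`, where `q = (ε, v)`. -/
def pullbackCorrection (χ : Plane → ℝ) (a b : Plane → Plane) (q : ℝ × Plane) (y : Plane) : Plane :=
  (a (displace χ q.2 y) + q.1 • b (displace χ q.2 y)) -
    (fderiv ℝ χ y (a (displace χ q.2 y) + q.1 • b (displace χ q.2 y)) /
      (1 + fderiv ℝ χ y q.2)) • q.2 - (a y + q.1 • b y)

theorem displace_of_notMem_tsupport {χ : Plane → ℝ} {y : Plane} (hy : y ∉ tsupport χ) (v : Plane) :
    displace χ v y = y := by
  simp [displace, image_eq_zero_of_notMem_tsupport hy]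

theorem pullbackCorrection_of_notMem_tsupport {χ : Plane → ℝ} {y : Plane} (hy : y ∉ tsupport χ)
    (a b : Plane → Plane) (q : ℝ × Plane) : pullbackCorrection χ a b q y = 0 := by
  simp [pullbackCorrection, displace_of_notMem_tsupport hy,
    (HasFDerivAt.of_notMem_tsupport (𝕜 := ℝ) hy).fderiv]

theorem pullbackCorrection_zero (χ : Plane → ℝ) (a b : Plane → Plane) (y : Plane) :
    pullbackCorrection χ a b 0 y = 0 := by
  simp [pullbackCorrection, displace]

theorem contDiffAt_displace {χ : Plane → ℝ} (hχ : ContDiff ℝ ∞ χ) {r : ℕ∞}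
    (w : (ℝ × Plane) × Plane) :
    ContDiffAt ℝ r (fun w : (ℝ × Plane) × Plane => displace χ w.1.2 w.2) w := by
  have h : ContDiff ℝ r χ := hχ.of_le (by exact_mod_cast le_top)
  have h1 : ContDiff ℝ r (fun w : (ℝ × Plane) × Plane => displace χ w.1.2 w.2) :=
    contDiff_snd.add ((h.comp contDiff_snd).smul (contDiff_snd.comp contDiff_fst))
  exact h1.contDiffAt

theorem contDiffAt_pullbackCorrection {χ : Plane → ℝ} (hχ : ContDiff ℝ ∞ χ) {r : ℕ∞}
    {a b : Plane → Plane} {q : ℝ × Plane} {y : Plane}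
    (hay : ContDiffAt ℝ r a y) (hby : ContDiffAt ℝ r b y)
    (haH : ContDiffAt ℝ r a (displace χ q.2 y)) (hbH : ContDiffAt ℝ r b (displace χ q.2 y))
    (hne : 1 + fderiv ℝ χ y q.2 ≠ 0) :
    ContDiffAt ℝ r (fun w : (ℝ × Plane) × Plane => pullbackCorrection χ a b w.1 w.2) (q, y) := by
  have hd : ContDiff ℝ r (fderiv ℝ χ) := hχ.fderiv_right (by
    have : ((r : ℕ∞ω) + 1) ≤ ((⊤ : ℕ∞) : ℕ∞ω) := by
      cases r with
      | top => simp
      | coe r => exact_mod_cast le_top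
    exact this)
  have h1 : ContDiffAt ℝ r (fun w : (ℝ × Plane) × Plane => w.1.1) (q, y) :=
    (contDiff_fst.comp contDiff_fst).contDiffAt
  have h2 : ContDiffAt ℝ r (fun w : (ℝ × Plane) × Plane => w.1.2) (q, y) :=
    (contDiff_snd.comp contDiff_fst).contDiffAt
  have h3 : ContDiffAt ℝ r (fun w : (ℝ × Plane) × Plane => fderiv ℝ χ w.2) (q, y) :=
    (hd.comp contDiff_snd).contDiffAt
  have hH := contDiffAt_displace hχ (r := r) (q, y)
  have hVH : ContDiffAt ℝ r (fun w : (ℝ × Plane) × Plane =>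
      a (displace χ w.1.2 w.2) + w.1.1 • b (displace χ w.1.2 w.2)) (q, y) :=
    (haH.comp (q, y) hH).add (h1.smul (hbH.comp (q, y) hH))
  have hV : ContDiffAt ℝ r (fun w : (ℝ × Plane) × Plane => a w.2 + w.1.1 • b w.2) (q, y) :=
    (hay.comp (q, y) contDiffAt_snd).add (h1.smul (hby.comp (q, y) contDiffAt_snd))
  exact (hVH.sub (((h3.clm_apply hVH).div (contDiffAt_const.add (h3.clm_apply h2)) hne).smul h2)).sub
    hV

/-- The derivative of the displacement is the identity plus the rank-one map `u ↦ dχ(u) v`, with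
inverse `u ↦ u - (dχ(u) / (1 + dχ(v))) v`. The correction is chosen so that the corrected field is
this inverse applied to the field at the displaced point. -/
theorem hasDerivAt_displace {χ : Plane → ℝ} {y : ℝ → Plane} {t : ℝ} {a b : Plane → Plane}
    {q : ℝ × Plane} (hχ : DifferentiableAt ℝ χ (y t)) (hne : 1 + fderiv ℝ χ (y t) q.2 ≠ 0)
    (h : HasDerivAt y (a (y t) + q.1 • b (y t) + pullbackCorrection χ a b q (y t)) t) :
    HasDerivAt (fun s => displace χ q.2 (y s))
      (a (displace χ q.2 (y t)) + q.1 • b (displace χ q.2 (y t))) t := by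
  have h1 := h.add ((hχ.hasFDerivAt.comp_hasDerivAt t h).smul_const q.2)
  refine h1.congr_deriv ?_
  set u := a (displace χ q.2 (y t)) + q.1 • b (displace χ q.2 (y t)) with hu
  set d := fderiv ℝ χ (y t) with hd
  have h2 : a (y t) + q.1 • b (y t) + pullbackCorrection χ a b q (y t) =
      u - (d u / (1 + d q.2)) • q.2 := by
    rw [pullbackCorrection, ← hu, ← hd]
    abel
  rw [h2, map_sub, map_smul, smul_eq_mul]
  have h3 : d u - d u / (1 + d q.2) * d q.2 = d u / (1 + d q.2) := by
    field_simp
    ring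
  rw [h3]
  abel

/-- The displacement differs from the identity by a contraction. -/
theorem displace_injective {χ : Plane → ℝ} {C : NNReal} (hC : LipschitzWith C χ) {v : Plane}
    (hv : C * ‖v‖ < 1) : Function.Injective (displace χ v) := by
  intro y z h
  have h1 : y - z = (χ z - χ y) • v := by
    have : y + χ y • v = z + χ z • v := h
    rw [sub_smul, sub_eq_sub_iff_add_eq_add, this]
    abel
  by_contra hne
  have h2 : ‖χ z - χ y‖ ≤ C * ‖z - y‖ := by
    simpa [dist_eq_norm] using hC.dist_le_mul z y
  have h3 : ‖y - z‖ ≤ C * ‖v‖ * ‖y - z‖ := by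
    calc ‖y - z‖ = ‖χ z - χ y‖ * ‖v‖ := by rw [h1, norm_smul]
      _ ≤ C * ‖z - y‖ * ‖v‖ := by gcongr
      _ = C * ‖v‖ * ‖y - z‖ := by rw [norm_sub_rev]; ring
  have h4 : 0 < ‖y - z‖ := norm_pos_iff.2 (sub_ne_zero.2 hne)
  nlinarith

theorem one_add_fderiv_ne_zero {χ : Plane → ℝ} {C : NNReal} (hC : LipschitzWith C χ) {v : Plane}
    (hv : C * ‖v‖ < 1) (y : Plane) : 1 + fderiv ℝ χ y v ≠ 0 := by
  have h1 := (fderiv ℝ χ y).le_of_opNorm_le (norm_fderiv_le_of_lipschitz ℝ hC) v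
  have h2 := abs_lt.1 ((Real.norm_eq_abs _ ▸ h1).trans_lt hv)
  linarith [h2.1]

section Pullback

variable {M : Type*} [TopologicalSpace M] [ChartedSpace Plane M] [IsManifold (𝓡 2) ∞ M]

/-- A cut-off function in the chart around `p`, together with a bound `ρ` on the size of the
displacements for which `displace` is a diffeomorphism of the domain of the chart. -/
structure ChartBump (p : M) where
  χ : Plane → ℝ
  C : NNReal
  ρ : ℝ
  ρ_pos : 0 < ρ
  smooth : ContDiff ℝ ∞ χ
  compact : HasCompactSupport χ
  subset : tsupport χ ⊆ (extChartAt (𝓡 2) p).target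
  one : χ (extChartAt (𝓡 2) p p) = 1
  lipschitz : LipschitzWith C χ
  small : ∀ v : Plane, ‖v‖ < ρ → C * ‖v‖ < 1
  maps : ∀ y ∈ (extChartAt (𝓡 2) p).target, ∀ v : Plane, ‖v‖ < ρ →
    displace χ v y ∈ (extChartAt (𝓡 2) p).target

theorem nonempty_chartBump (p : M) : Nonempty (ChartBump p) := by
  have hto := isOpen_extChartAt_target (I := 𝓡 2) p
  obtain ⟨χ, hsub, hcomp, hsm, hran, hone⟩ := exists_contDiff_tsupport_subset (n := ⊤)
    (extChartAt_target_mem_nhds (I := 𝓡 2) p)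
  obtain ⟨C, hC⟩ := ContDiff.lipschitzWith_of_hasCompactSupport hcomp hsm (by simp)
  obtain ⟨ρ, hρ, hthick⟩ := hcomp.isCompact.exists_thickening_subset_open hto hsub
  -- The bound `1 / (C + 1)` makes `C * ‖v‖ < 1`; the other bound keeps displaced points of the
  -- support in the chart.
  refine ⟨⟨χ, C, min ρ (1 / (C + 1)), by positivity, hsm, hcomp, hsub, hone, hC, ?_, ?_⟩⟩
  · intro v hv
    have h1 : ‖v‖ < 1 / (C + 1) := hv.trans_le (min_le_right _ _)
    rw [lt_div_iff₀ (by positivity)] at h1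
    nlinarith [norm_nonneg v]
  · intro y hy v hv
    by_cases hys : y ∈ tsupport χ
    · refine hthick (Metric.mem_thickening_iff.2 ⟨y, hys, ?_⟩)
      have h1 := hran (mem_range_self y)
      rw [displace, dist_eq_norm, add_sub_cancel_left, norm_smul, Real.norm_eq_abs,
        abs_of_nonneg h1.1]
      have h2 : ‖v‖ < ρ := hv.trans_le (min_le_left _ _)
      nlinarith [norm_nonneg v, h1.2]
    · rwa [displace_of_notMem_tsupport hys]

/-- The tangent vector at `x` with coordinates `w` in the chart around `p`; zero outside the domain
of the chart. -/
def chartLift (p x : M) : Plane →L[ℝ] TangentSpace (𝓡 2) x :=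
  (trivializationAt Plane (fun x : M => TangentSpace (𝓡 2) x) p).symmL ℝ x

theorem chartLift_of_notMem {p x : M} (hx : x ∉ (chartAt Plane p).source) (w : Plane) :
    chartLift p x w = 0 :=
  Bundle.Trivialization.symmL_apply_of_notMem _ (by simpa using hx) w

theorem chartDeriv_chartLift {p x : M} (hx : x ∈ (chartAt Plane p).source) (w : Plane) :
    chartDeriv p x (chartLift p x w) = w :=
  Bundle.Trivialization.continuousLinearMapAt_symmL _ (by simpa using hx) w

theorem contMDiffAt_chartLift (r : ℕ∞) {p x : M} (hx : x ∈ (chartAt Plane p).source) (w : Plane) :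
    ContMDiffAt (𝓡 2) ((𝓡 2).prod 𝓘(ℝ, Plane)) r
      (fun x => Bundle.TotalSpace.mk' Plane (E := fun x : M => TangentSpace (𝓡 2) x) x
        (chartLift p x w)) x := by
  have := isManifold_coe (M := M) r
  have := contMDiffVectorBundle_tangent (M := M) r
  rw [Bundle.Trivialization.contMDiffAt_section_iff
    (trivializationAt Plane (fun x : M => TangentSpace (𝓡 2) x) p) (by simpa using hx)]
  refine (contMDiffAt_const (c := w)).congr_of_eventuallyEq ?_
  filter_upwards [(chartAt Plane p).open_source.mem_nhds hx] with z hz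
  rw [← chartDeriv_apply hz, chartDeriv_chartLift hz]

variable {r : ℕ∞} {p : M}

/-- The pullback of `X + ε • W` under the displacement by `v` in the chart around `p`, where
`q = (ε, v)`. -/
def ChartBump.pullback (β : ChartBump p) (X W : VField r M) (q : ℝ × Plane) (x : M) :
    TangentSpace (𝓡 2) x :=
  X x + q.1 • W x + chartLift p x (pullbackCorrection β.χ (localRep (fun x => X x) p)
    (localRep (fun x => W x) p) q (extChartAt (𝓡 2) p x))

/-- The displacement by `v` in the chart around `p`. -/
def ChartBump.move (β : ChartBump p) (v : Plane) (x : M) : M :=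
  open Classical in
  if x ∈ (extChartAt (𝓡 2) p).source then
    (extChartAt (𝓡 2) p).symm (displace β.χ v (extChartAt (𝓡 2) p x)) else x

theorem ChartBump.move_of_mem (β : ChartBump p) (v : Plane) {x : M}
    (hx : x ∈ (extChartAt (𝓡 2) p).source) :
    β.move v x = (extChartAt (𝓡 2) p).symm (displace β.χ v (extChartAt (𝓡 2) p x)) := if_pos hx

/-- The set of points that are moved lies in this compact set. -/
def ChartBump.support (β : ChartBump p) : Set M := (extChartAt (𝓡 2) p).symm '' tsupport β.χ

theorem ChartBump.isClosed_support [T2Space M] (β : ChartBump p) : IsClosed β.support :=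
  (β.compact.isCompact.image_of_continuousOn
    ((continuousOn_extChartAt_symm (I := 𝓡 2) p).mono β.subset)).isClosed

theorem ChartBump.support_subset (β : ChartBump p) : β.support ⊆ (extChartAt (𝓡 2) p).source := by
  rintro _ ⟨y, hy, rfl⟩
  exact (extChartAt (𝓡 2) p).map_target (β.subset hy)

theorem ChartBump.notMem_tsupport (β : ChartBump p) {x : M}
    (hx : x ∈ (extChartAt (𝓡 2) p).source) (h : x ∉ β.support) :
    extChartAt (𝓡 2) p x ∉ tsupport β.χ := fun h' =>
  h ⟨_, h', (extChartAt (𝓡 2) p).left_inv hx⟩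

theorem ChartBump.move_of_notMem_support (β : ChartBump p) (v : Plane) {x : M}
    (h : x ∉ β.support) : β.move v x = x := by
  by_cases hx : x ∈ (extChartAt (𝓡 2) p).source
  · rw [β.move_of_mem v hx, displace_of_notMem_tsupport (β.notMem_tsupport hx h),
      (extChartAt (𝓡 2) p).left_inv hx]
  · exact if_neg hx

theorem ChartBump.pullback_of_notMem_support (β : ChartBump p) (X W : VField r M) (q : ℝ × Plane)
    {x : M} (h : x ∉ β.support) : β.pullback X W q x = X x + q.1 • W x := by
  by_cases hx : x ∈ (extChartAt (𝓡 2) p).source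
  · rw [pullback, pullbackCorrection_of_notMem_tsupport (β.notMem_tsupport hx h), map_zero,
      add_zero]
  · rw [pullback, chartLift_of_notMem (by simpa using hx), add_zero]

theorem ChartBump.move_injective (β : ChartBump p) {v : Plane} (hv : ‖v‖ < β.ρ) :
    Function.Injective (β.move v) := by
  let c := extChartAt (𝓡 2) p
  have hmem : ∀ x, β.move v x ∈ c.source ↔ x ∈ c.source := by
    intro x
    by_cases hx : x ∈ c.source
    · rw [β.move_of_mem v hx]
      exact iff_of_true (c.map_target (β.maps _ (c.map_source hx) v hv)) hx
    · rw [show β.move v x = x from if_neg hx]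
  intro x y h
  by_cases hx : x ∈ c.source
  · have hy : y ∈ c.source := by rwa [← hmem, ← h, hmem]
    rw [β.move_of_mem v hx, β.move_of_mem v hy] at h
    exact c.injOn hx hy (displace_injective β.lipschitz (β.small v hv)
      (c.symm.injOn (β.maps _ (c.map_source hx) v hv) (β.maps _ (c.map_source hy) v hv) h))
  · have hy : y ∉ c.source := by rwa [← hmem, ← h, hmem]
    rw [show β.move v x = x from if_neg hx, show β.move v y = y from if_neg hy] at h
    exact h

theorem ChartBump.pullback_zero (β : ChartBump p) (X W : VField r M) (x : M) :
    β.pullback X W 0 x = X x := by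
  rw [pullback, pullbackCorrection_zero, map_zero, add_zero, Prod.fst_zero, zero_smul, add_zero]

theorem ChartBump.chartDeriv_pullback (β : ChartBump p) (X W : VField r M) (q : ℝ × Plane) {x : M}
    (hx : x ∈ (chartAt Plane p).source) :
    chartDeriv p x (β.pullback X W q x) =
      localRep (fun x => X x) p (extChartAt (𝓡 2) p x) +
        q.1 • localRep (fun x => W x) p (extChartAt (𝓡 2) p x) +
        pullbackCorrection β.χ (localRep (fun x => X x) p) (localRep (fun x => W x) p) q
          (extChartAt (𝓡 2) p x) := by
  rw [pullback, map_add, map_add, map_smul, chartDeriv_chartLift hx, localRep_extChartAt _ hx,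
    localRep_extChartAt _ hx]

/-- In the chart this is the computation for `displace`; off the chart, points are away from the
closed support, where nothing moves and the field is unchanged. -/
theorem ChartBump.isMIntegralCurve_move [T2Space M] (β : ChartBump p) {X W : VField r M}
    {q : ℝ × Plane} (hq : ‖q.2‖ < β.ρ) {γ : ℝ → M} (hγ : IsMIntegralCurve γ (β.pullback X W q)) :
    IsMIntegralCurve (fun t => β.move q.2 (γ t)) (fun x => X x + q.1 • W x) := by
  intro t
  let c := extChartAt (𝓡 2) p
  have hγc : ContinuousAt γ t := (hγ t).continuousAt
  by_cases hx : γ t ∈ c.source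
  · have hx' : γ t ∈ (chartAt Plane p).source := by simpa [c] using hx
    have h1 := hasDerivAt_extChartAt_comp hx' (hγ t)
    rw [β.chartDeriv_pullback X W q hx'] at h1
    have h2 := hasDerivAt_displace (β.smooth.differentiable (by simp) _)
      (one_add_fderiv_ne_zero β.lipschitz (β.small _ hq) _) h1
    have hev : ∀ᶠ s in 𝓝 t, γ s ∈ c.source :=
      hγc ((isOpen_extChartAt_source (I := 𝓡 2) p).mem_nhds hx)
    have hmt : ∀ x ∈ c.source, displace β.χ q.2 (c x) ∈ c.target := fun x hx =>
      β.maps _ (c.map_source hx) _ hq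
    have hms : β.move q.2 (γ t) ∈ c.source := by
      rw [β.move_of_mem _ hx]
      exact c.map_target (hmt _ hx)
    have hms' : β.move q.2 (γ t) ∈ (chartAt Plane p).source := by simpa [c] using hms
    have hcm : ∀ x ∈ c.source, c (β.move q.2 x) = displace β.χ q.2 (c x) := fun x hx => by
      rw [β.move_of_mem _ hx]
      exact c.right_inv (hmt x hx)
    refine hasMFDerivAt_of_hasDerivAt_extChartAt (x₀ := p) hms' ?_ ?_
    · have h3 : ContinuousAt (fun s => c.symm (displace β.χ q.2 (c (γ s)))) t :=
        ContinuousAt.comp (f := fun s => displace β.χ q.2 (c (γ s)))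
          ((continuousOn_extChartAt_symm (I := 𝓡 2) p).continuousAt
            ((isOpen_extChartAt_target (I := 𝓡 2) p).mem_nhds (hmt _ hx))) h2.continuousAt
      refine h3.congr ?_
      filter_upwards [hev] with s hs
      exact (β.move_of_mem _ hs).symm
    · have h4 : (fun s => c (β.move q.2 (γ s))) =ᶠ[𝓝 t] fun s => displace β.χ q.2 (c (γ s)) := by
        filter_upwards [hev] with s hs
        exact hcm _ hs
      refine (h2.congr_of_eventuallyEq h4).congr_deriv ?_
      rw [map_add, map_smul, ← localRep_extChartAt (fun x => X x) hms',
        ← localRep_extChartAt (fun x => W x) hms']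
      change _ = localRep _ p (c (β.move q.2 (γ t))) + q.1 • localRep _ p (c (β.move q.2 (γ t)))
      rw [hcm _ hx]
  · have hns : γ t ∉ β.support := fun h => hx (β.support_subset h)
    have hev : ∀ᶠ s in 𝓝 t, γ s ∉ β.support := hγc (β.isClosed_support.isOpen_compl.mem_nhds hns)
    have h1 : (fun s => β.move q.2 (γ s)) =ᶠ[𝓝 t] γ := by
      filter_upwards [hev] with s hs
      exact β.move_of_notMem_support _ hs
    have h2 := (hγ t).congr_of_eventuallyEq h1
    rw [β.pullback_of_notMem_support X W q hns] at h2
    let V : M → Plane := fun x => X x + q.1 • W x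
    have h3 : V (β.move q.2 (γ t)) = V (γ t) := by rw [β.move_of_notMem_support q.2 hns]
    change HasMFDerivAt _ _ _ t ((1 : ℝ →L[ℝ] ℝ).smulRight (V (β.move q.2 (γ t))))
    rw [h3]
    exact h2

/-- Separates the coefficients, which depend on the parameter, from fixed vector fields; joint
smoothness of the pullback is checked on each factor. -/
theorem chartLift_eq_sum (p x : M) (w : Plane) :
    chartLift p x w = ∑ i, w i • chartLift p x (EuclideanSpace.basisFun (Fin 2) ℝ i) := by
  conv_lhs => rw [← (EuclideanSpace.basisFun (Fin 2) ℝ).sum_repr w, map_sum]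
  simp only [map_smul, EuclideanSpace.basisFun_repr]

theorem ChartBump.contDiffAt_localRep_pullback [T2Space M] (β : ChartBump p) (X W : VField r M)
    {q : ℝ × Plane} (hq : ‖q.2‖ < β.ρ) {x₀ : M} {y : Plane}
    (hy : y ∈ (extChartAt (𝓡 2) x₀).target) :
    ContDiffAt ℝ r (fun w : (ℝ × Plane) × Plane => localRep (β.pullback X W w.1) x₀ w.2)
      (q, y) := by
  have := isManifold_coe (M := M) r
  let c := extChartAt (𝓡 2) p
  let c₀ := extChartAt (𝓡 2) x₀
  have hlin : ContDiffAt ℝ r (fun w : (ℝ × Plane) × Plane =>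
      localRep (fun x => X x) x₀ w.2 + w.1.1 • localRep (fun x => W x) x₀ w.2) (q, y) := by
    have h1 : ContDiffAt ℝ r (fun w : (ℝ × Plane) × Plane => w.1.1) (q, y) :=
      (contDiff_fst.comp contDiff_fst).contDiffAt
    exact ((X.contDiffAt_localRep hy).comp (q, y) contDiffAt_snd).add
      (h1.smul ((W.contDiffAt_localRep hy).comp (q, y) contDiffAt_snd))
  have hev : ∀ᶠ w in 𝓝 (q, y), w.2 ∈ c₀.target :=
    continuousAt_snd.eventually ((isOpen_extChartAt_target (I := 𝓡 2) x₀).mem_nhds hy)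
  have hsc : ContinuousAt c₀.symm y := (continuousOn_extChartAt_symm (I := 𝓡 2) x₀).continuousAt
    ((isOpen_extChartAt_target (I := 𝓡 2) x₀).mem_nhds hy)
  by_cases hs : c₀.symm y ∈ β.support
  · have hx : c₀.symm y ∈ c.source := β.support_subset hs
    have hx' : c₀.symm y ∈ (chartAt Plane p).source := by simpa [c] using hx
    have hcc : ContDiffAt ℝ r (fun y => c (c₀.symm y)) y := by
      have h1 : ContMDiffAt (𝓡 2) 𝓘(ℝ, Plane) r c (c₀.symm y) := contMDiffAt_extChartAt' hx'
      have h2 : ContMDiffAt 𝓘(ℝ, Plane) (𝓡 2) r c₀.symm y :=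
        (contMDiffOn_extChartAt_symm (I := 𝓡 2) x₀).contMDiffAt
          ((isOpen_extChartAt_target (I := 𝓡 2) x₀).mem_nhds hy)
      exact (h1.comp y h2).contDiffAt
    have hyt := c.map_source hx
    have hHt := β.maps _ hyt _ hq
    have hcorr := contDiffAt_pullbackCorrection β.smooth (q := q) (X.contDiffAt_localRep hyt)
      (W.contDiffAt_localRep hyt) (X.contDiffAt_localRep hHt) (W.contDiffAt_localRep hHt)
      (one_add_fderiv_ne_zero β.lipschitz (β.small _ hq) _)
    have hcorr' : ContDiffAt ℝ r (fun w : (ℝ × Plane) × Plane =>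
        pullbackCorrection β.χ (localRep (fun x => X x) p) (localRep (fun x => W x) p) w.1
          (c (c₀.symm w.2))) (q, y) :=
      ContDiffAt.comp (g := fun w : (ℝ × Plane) × Plane =>
        pullbackCorrection β.χ (localRep (fun x => X x) p) (localRep (fun x => W x) p) w.1 w.2)
        (f := fun w : (ℝ × Plane) × Plane => (w.1, c (c₀.symm w.2))) (q, y) hcorr
        (contDiffAt_fst.prodMk (ContDiffAt.comp (g := fun y => c (c₀.symm y)) (q, y) hcc contDiffAt_snd))
    have hsum := hlin.add (ContDiffAt.sum (s := Finset.univ) fun i (_ : i ∈ Finset.univ) =>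
      ((contDiffAt_euclidean.1 hcorr') i).smul ((contDiffAt_localRep (contMDiffAt_chartLift r hx'
        (EuclideanSpace.basisFun (Fin 2) ℝ i)) hy).comp (q, y) contDiffAt_snd))
    refine hsum.congr_of_eventuallyEq ?_
    filter_upwards [hev] with w hw
    simp only [Function.comp_def, Pi.smul_apply']
    simp only [localRep_eq_chartDeriv _ hw, ChartBump.pullback, map_add, map_smul]
    rw [chartLift_eq_sum, map_sum]
    simp only [map_smul]
    rfl
  · refine hlin.congr_of_eventuallyEq ?_
    have hev' : ∀ᶠ w in 𝓝 (q, y), c₀.symm w.2 ∉ β.support :=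
      (ContinuousAt.comp (g := c₀.symm) (f := Prod.snd) (x := (q, y)) hsc
        continuousAt_snd).eventually (β.isClosed_support.isOpen_compl.mem_nhds hs)
    filter_upwards [hev, hev'] with w hw hw'
    rw [localRep_eq_chartDeriv _ hw, localRep_eq_chartDeriv _ hw, localRep_eq_chartDeriv _ hw,
      β.pullback_of_notMem_support X W w.1 hw', map_add, map_smul]

/-- If `X + ε • W`, with `ε` small, has a closed trajectory through a point close to `p`, then
there is a field close to `X` with a closed trajectory through `p`. -/
theorem exists_hasClosedTrajectory_of_near [T2Space M] [CompactSpace M] (hr : 1 ≤ r)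
    (X W : VField r M) (p : M) {𝒱 : Set (VField r M)} (h𝒱 : 𝒱 ∈ 𝓝 X) :
    ∃ δ : ℝ, 0 < δ ∧ ∃ N ∈ 𝓝 p, ∀ ε ∈ Icc 0 δ, ∀ b ∈ N,
      HasClosedTrajectory (fun x => X x + ε • W x) b →
      ∃ Y ∈ 𝒱, HasClosedTrajectory (fun x => Y x) p := by
  have := isManifold_one (M := M)
  obtain ⟨β⟩ := nonempty_chartBump p
  let c := extChartAt (𝓡 2) p
  let N₀ : Set (ℝ × Plane) := {q | ‖q.2‖ < β.ρ}
  have hN₀ : N₀ ∈ 𝓝 0 := by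
    refine (isOpen_lt (by fun_prop) continuous_const).mem_nhds ?_
    rw [mem_ofPred_eq]
    simpa using β.ρ_pos
  have h1 := (eventually_mem_of_contDiffAt_localRep hN₀ (β.pullback_zero X W)
    (fun q hq x₀ y hy => β.contDiffAt_localRep_pullback X W hq hy) h𝒱).and hN₀
  obtain ⟨η, hη, hball⟩ := Metric.eventually_nhds_iff_ball.1 h1
  have hcc : ContinuousAt (fun b => ‖c b - c p‖) p :=
    ((continuousAt_extChartAt (I := 𝓡 2) p).sub continuousAt_const).norm
  refine ⟨η / 2, by positivity, {b | b ∈ c.source ∧ ‖c b - c p‖ < η},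
    inter_mem (extChartAt_source_mem_nhds (I := 𝓡 2) p)
      (hcc.eventually_lt continuousAt_const (by simpa using hη)), ?_⟩
  rintro ε ⟨hε0, hεδ⟩ b ⟨hbs, hbη⟩ ⟨hne, γ, hγ, hγ0, T, hT, hper⟩
  -- As `χ` equals `1` at the centre of the chart, this displacement carries `p` to `b`.
  let q : ℝ × Plane := (ε, c b - c p)
  obtain ⟨⟨Y, hY𝒱, hY⟩, hq⟩ := hball q (by
    rw [mem_ball_zero_iff, Prod.norm_def, max_lt_iff]
    refine ⟨?_, hbη⟩
    rw [Real.norm_eq_abs, abs_of_nonneg hε0]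
    linarith)
  have hps : p ∈ c.source := mem_extChartAt_source (I := 𝓡 2) p
  have hpb : β.move q.2 p = b := by
    rw [β.move_of_mem _ hps, displace, β.one]
    change c.symm (c p + (1 : ℝ) • (c b - c p)) = b
    rw [one_smul, add_sub_cancel]
    exact c.left_inv hbs
  obtain ⟨σ, hσ0, hσ⟩ := Y.exists_isMIntegralCurve hr p
  have hYq : (fun x => Y x) = β.pullback X W q := funext hY
  rw [hYq] at hσ
  have hmove := β.isMIntegralCurve_move hq hσ
  -- The displacement carries the trajectory of the pullback through `p` to the periodic one through
  -- `b`; being injective, it lets the period be transferred back.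
  have heq : (fun t => β.move q.2 (σ t)) = γ :=
    isMIntegralCurve_Ioo_eq_of_contMDiff_boundaryless (t₀ := 0)
      (VField.contMDiff_add_smul hr X W ε) hmove hγ (by rw [hσ0, hpb, hγ0])
  refine ⟨Y, hY𝒱, ?_, σ, by rwa [hYq], hσ0, T, hT, fun t => β.move_injective hq ?_⟩
  -- A singularity of the pullback at `p` would be carried to a constant trajectory at `b`.
  · intro h0
    apply hne
    have hp0 : β.pullback X W q p = 0 := by rw [← hY]; exact h0
    have h2 := β.isMIntegralCurve_move hq (isMIntegralCurve_const hp0) 0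
    simp only at h2
    have hbs' : β.move q.2 p ∈ (chartAt Plane p).source := by
      rw [hpb]
      simpa [c] using hbs
    have h3 := (hasDerivAt_extChartAt_comp hbs' h2).unique (hasDerivAt_const _ _)
    have h4 := chartDeriv_injective hbs' (h3.trans (map_zero _).symm)
    rw [← hpb]
    exact h4
  · have := hper t
    rw [← heq] at this
    exact this

end Pullback

/-! ### Proof of the theorem. -/

section Main

variable {M : Type*} [TopologicalSpace M] [ChartedSpace Plane M] [IsManifold (𝓡 2) ∞ M]

theorem IsTrajectoryArc.neg {W : (x : M) → TangentSpace (𝓡 2) x} {O : Set M} {a c : M}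
    (h : IsTrajectoryArc W O c a) : IsTrajectoryArc (fun x => -W x) O a c := by
  obtain ⟨γ, T, hT, hγ, h0, h1, hinj, rfl⟩ := h
  have him : (fun t => T - t) '' Icc 0 T = Icc 0 T := by simp
  refine ⟨fun t => γ (T - t), T, hT, ?_, by simpa using h1, by simpa using h0, ?_, ?_⟩
  · have h2 := (hγ.comp_add T).comp_mul (-1)
    have h3 : ((γ ∘ fun t => t + T) ∘ fun t => t * (-1)) = fun t => γ (T - t) := by
      funext t
      simp only [Function.comp_apply]
      congr 1
      ring
    rw [h3] at h2
    have h4 : ((-1 : ℝ) • fun x => W x) = fun x => -W x := by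
      funext x
      exact neg_one_smul ℝ (W x)
    rw [← h4]
    exact h2
  · exact hinj.comp (fun s _ t _ h => by simpa using h) (by
      rw [mapsTo_iff_image_subset, him])
  · rw [← him, ← image_comp, him]
    rfl

/-- Close to `p`, figure-eight flow boxes yield closed trajectories through `p` of fields close
to `X`. -/
theorem exists_nhds_forall_figureEight [T2Space M] [CompactSpace M] {r : ℕ∞} (hr : 1 ≤ r)
    {X W : VField r M} (hind : ∀ x, X x ≠ 0 → LinearIndependent ℝ ![X x, W x])
    (hzero : ∀ x, X x = 0 → W x = 0) {p : M} (hp : X p ≠ 0) {𝒱 : Set (VField r M)}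
    (h𝒱 : 𝒱 ∈ 𝓝 X) :
    ∃ V ∈ 𝓝 p, ∀ (F A O : Set M) (a b c : M), IsCompact F →
      IsFlowBox r (fun x => X x) (interior F) → IsTrajectoryArc (fun x => X x) A c a →
      IsTrajectoryArc (fun x => W x) O a c → frontier F = A ∪ O → A ∩ O = {a, b, c} →
      b ≠ a → b ≠ c → O ⊆ V → ∃ Y ∈ 𝒱, HasClosedTrajectory (fun x => Y x) p := by
  obtain ⟨δ, hδ, N, hN, hclose⟩ := exists_hasClosedTrajectory_of_near hr X W p h𝒱
  obtain ⟨Z, hZ⟩ := exists_isFlowFamily hr X W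
  obtain ⟨B, hBN⟩ := exists_transverseBox hr X W (hind p hp) hN
  have hψ : ContinuousAt B.ψ p := B.ψ.continuousAt B.mem_source
  have hsmall : ∀ᶠ x in 𝓝 p, (B.ψ x).2 < B.κ / 2 ∧
      1 * B.hi / (δ * B.lo) * (2 * |(B.ψ x).1|) < B.κ / 2 := by
    have h1 : ContinuousAt (fun x => (B.ψ x).2) p := continuous_snd.continuousAt.comp hψ
    have h2 : ContinuousAt (fun x => 1 * B.hi / (δ * B.lo) * (2 * |(B.ψ x).1|)) p :=
      (((continuous_fst.continuousAt.comp hψ).abs).const_mul 2).const_mul _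
    refine (h1.eventually_lt continuousAt_const ?_).and (h2.eventually_lt continuousAt_const ?_)
    · simpa [B.map_center] using B.κ_pos
    · simpa [B.map_center] using B.κ_pos
  -- The admissible size of the orthogonal edge depends on `δ`, which was fixed by the neighbourhood
  -- of `X`, and not on the figure-eight box.
  refine ⟨_, inter_mem hsmall (B.ψ.open_source.mem_nhds B.mem_source), ?_⟩
  intro F A O a b c hF hU hA hO hfr hinter hba hbc hOV
  obtain ⟨E, rfl⟩ := exists_figureEight hr hind hzero hF hU hA hO hfr hinter hba hbc
  have hOs : ∀ s ∈ Icc 0 E.L, E.O s ∈ B.ψ.source := fun s hs => (hOV (mem_image_of_mem _ hs)).2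
  obtain ⟨t₁, ht₁, hout, hret⟩ := E.exists_crossing hZ B hδ hOs
    fun s hs => (hOV (mem_image_of_mem _ hs)).1
  obtain ⟨ε, hε, t, ht, hper⟩ := E.exists_closed hZ hδ ht₁ hout hret
  have hsb : E.O E.sb ∈ B.ψ.source := hOs _ ⟨E.sb_pos.le, E.sb_lt.le⟩
  refine hclose ε ⟨hε.1.le, hε.2⟩ (E.O E.sb) (hBN hsb) ⟨?_, fun s => Z ε s (E.O E.sb),
    hZ.curve ε _, hZ.zero ε _, t, ht, fun s => ?_⟩
  -- In a box the vertical speed of `X + ε W` is positive, so this field has no zero there.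
  · intro h0
    have h1 : HasVelocity (fun _ : ℝ => E.O E.sb) 0
        ((1 : ℝ) • X (E.O E.sb) + ε • W (E.O E.sb)) := by
      rw [one_smul]
      exact isMIntegralCurve_const (v := fun x => X x + ε • W x) h0 0
    have h2 := (B.hasDerivAt (fun _ => E.O E.sb) 0 1 ε hsb h1).2.unique (hasDerivAt_const _ _)
    linarith [(B.q_mem _ hsb).1, B.lo_pos]
  · simp only
    rw [hZ.add, hper]

end Main

theorem theorem3p2 {M : Type*} [TopologicalSpace M] [T2Space M] [CompactSpace M]
    [ChartedSpace Plane M] [IsManifold (𝓡 2) ∞ M]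
    (g : SurfaceMetric M) (o : SurfaceOrientation M)
    (r : ℕ∞) (hr : 1 ≤ r) (X : VField r M) (p : M)
    (hp : IsNontrivialRecurrent (fun x => X x) p)
    (hX : IsTClosable g o r (fun x => X x) p) :
    ∀ 𝒱 ∈ 𝓝 X, ∃ Y ∈ 𝒱, HasClosedTrajectory (fun x => Y x) p := by
  intro 𝒱 h𝒱
  obtain ⟨Xp, hperp, q, S, -, hbox⟩ := hX
  let W : VField r M := ⟨Xp, hperp.contMDiff⟩
  have hW : ∀ x, W x = Xp x := fun x => rfl
  have hW' : ∀ x, (-W) x = -Xp x := fun x => rfl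
  obtain ⟨V₁, hV₁, h₁⟩ := exists_nhds_forall_figureEight hr (W := W)
    (fun x hx => hperp.linearIndependent hx) (fun x hx => hperp.eq_zero hx) hp.1 h𝒱
  obtain ⟨V₂, hV₂, h₂⟩ := exists_nhds_forall_figureEight hr (W := -W)
    (fun x hx => by
      rw [hW']
      have := hperp.linearIndependent hx
      rw [LinearIndependent.pair_iff] at this ⊢
      intro s t hst
      have h := this s (-t) (by rw [neg_smul, ← smul_neg]; exact hst)
      exact ⟨h.1, neg_eq_zero.1 h.2⟩)
    (fun x hx => by rw [hW', hperp.eq_zero hx, neg_zero]) hp.1 h𝒱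
  -- Whether the orthogonal edge runs along `X^⊥` from `a` to `c` or from `c` to `a` is known only
  -- once the box is given, so the neighbourhood is made to suit both `X^⊥` and `-X^⊥`.
  obtain ⟨F, O, ⟨hF, hU, a, b, c, A, hA, hO, hfr, hinter, hba, hbc⟩, hOV⟩ :=
    hbox (V₁ ∩ V₂) (inter_mem hV₁ hV₂)
  rcases hO with hO | hO
  · exact h₁ F A O a b c hF hU hA hO hfr hinter hba hbc fun x hx => (hOV hx).2.1
  · exact h₂ F A O a b c hF hU hA hO.neg hfr hinter hba hbc fun x hx => (hOV hx).2.2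

end
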